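/- Let $r\ge 2$ and $\mathfrak g=\mathfrak{so}(2r+1)$ over $\mathbb C$, with simple roots $\alpha_1,\dots,\alpha_r$, coroots $\alpha_i^\vee$, Chevalley generators $E_i,H_i=\alpha_i^\vee,F_i$, and the invariant form $(\cdot,\cdot)$ normalized so that $(\alpha_i,\alpha_i)=4$ for $i<r$ and $(\alpha_r,\alpha_r)=2$. Let $\Omega=\sum_k x_k\otimes x_k$, where $(x_k)$ is an orthonormal basis of $\mathfrak g$. Let $\lambda$ be a dominant integral weight, $\omega_1$ the first fundamental weight, and let $V_\lambda$, $V_{\omega_1}$ be the finite-dimensional irreducible $\mathfrak g$-modules with these highest weights and highest weight vectors $v_1\in V_\lambda$, $v_2\in V_{\omega_1}$. Put $\Lambda_1=\lambda$, $\Lambda_2=\omega_1$ and let $z_1\ne z_2$ be complex numbers. The Gaudin Hamiltonians on $V_\lambda\otimes V_{\omega_1}$ are $$\mathcal H_1=\frac{\Omega^{(1,2)}}{z_1-z_2},\qquad \mathcal H_2=\frac{\Omega^{(2,1)}}{z_2-z_1}.$$ Let $\boldsymbol l=(l_1,\dots,l_r)$ be a tuple of the form $(1,\dots,1,0,\dots,0)$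 or $(1,\dots,1,2,\dots,2)$ with $k$ ones, $0\le k\le r$; its length is $l=l_1+\dots+l_r$. Take $l$ complex variables $t_1,\dots,t_l$ with colors $c(1)\le\dots\le c(l)$ such that color $i$ occurs $l_i$ times. A point $\boldsymbol t\in\mathbb C^l$ is a solution of the Bethe ansatz equation if $t_i\neq z_s$ whenever $(\alpha_{c(i)},\Lambda_s)\ne0$, $t_i\ne t_j$ whenever $i\neq j$ and $(\alpha_{c(i)},\alpha_{c(j)})\neq 0$, and $$-\sum_{s=1}^2\frac{(\alpha_{c(i)},\Lambda_s)}{t_i-z_s}+\sum_{j\ne i}\frac{(\alpha_{c(i)},\alpha_{c(j)})}{t_i-t_j}=0,\qquad i=1,\dots,l,$$ where terms with zero numerator are omitted. The weight function is the rational function of $\boldsymbol t$ with values in $V_\lambda\otimes V_{\omega_1}$ $$\omega(\boldsymbol t)=\sum_{j=0}^{l}\sum_{\sigma\in\Sigma_l}\omega_{\sigma(1),\dots,\sigma(j)}(z_1)\,\omega_{\sigma(j+1),\dots,\sigma(l)}(z_2)\;F_{c(\sigma(1))}\cdots F_{c(\sigma(j))}v_1\otimes F_{c(\sigma(j+1))}\cdots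 F_{c(\sigma(l))}v_2,$$ $$\omega_{i_1,\dots,i_m}(z)=\frac1{(t_{i_1}-t_{i_2})\cdots(t_{i_{m-1}}-t_{i_m})(t_{i_m}-z)},$$ with the empty product equal to $1$. The value of this rational function (after cancellation of poles) at a solution $\boldsymbol t$ of the Bethe ansatz equation is the Bethe vector of $\boldsymbol t$. **Proposition.** One has $\mathcal H_1=-\mathcal H_2$. Let $\boldsymbol t,\boldsymbol t'$ be solutions of the Bethe ansatz equations for two tuples $\boldsymbol l,\boldsymbol l'$ of the above form with different lengths. Then the Bethe vectors of $\boldsymbol t$ and $\boldsymbol t'$ are well defined and are (nonzero) eigenvectors of $\mathcal H:=\mathcal H_1=-\mathcal H_2$ with distinct eigenvalues. -/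

import Mathlib

open scoped TensorProduct Topology

attribute [local instance 100] LieRing.ofAssociativeRing

noncomputable section

namespace GaudinB

/-! ### The Lie algebra `so(2r+1)` with its Chevalley generators -/

/-- Indices of the basis `e_0, e_1, …, e_r, e_{-1}, …, e_{-r}` of the space `ℂ^(2r+1)`. -/
abbrev Idx (r : ℕ) : Type := Unit ⊕ (Fin r ⊕ Fin r)

/-- The Lie algebra `so(2r+1)`: matrices that are skew-adjoint for the symmetric bilinear form with
`(e_0, e_0) = 2`, `(e_i, e_{-i}) = 1`, all other pairings of basis vectors being zero. -/
abbrev so (r : ℕ) : LieSubalgebra ℂ (Matrix (Idx r) (Idx r) ℂ) :=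
  LieAlgebra.Orthogonal.typeB (Fin r) ℂ

/-- The index `0`. -/
abbrev zro {r : ℕ} : Idx r := Sum.inl ()

/-- The index `i > 0`. -/
abbrev pos {r : ℕ} (i : Fin r) : Idx r := Sum.inr (Sum.inl i)

/-- The index `-i < 0`. -/
abbrev ngt {r : ℕ} (i : Fin r) : Idx r := Sum.inr (Sum.inr i)

/-- The matrix of `E_i`: a root vector for `α_i = ε_i - ε_{i+1}` if `i` is not the last index,
and for `α_r = ε_r` if it is. -/
def matE {r : ℕ} (i : Fin r) : Matrix (Idx r) (Idx r) ℂ :=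
  if h : i.val + 1 < r then
    Matrix.single (pos i) (pos ⟨i.val + 1, h⟩) 1 - Matrix.single (ngt ⟨i.val + 1, h⟩) (ngt i) 1
  else
    Matrix.single (pos i) zro 2 - Matrix.single zro (ngt i) 1

/-- The matrix of `F_i`: a root vector for `-α_i`. -/
def matF {r : ℕ} (i : Fin r) : Matrix (Idx r) (Idx r) ℂ :=
  if h : i.val + 1 < r then
    Matrix.single (pos ⟨i.val + 1, h⟩) (pos i) 1 - Matrix.single (ngt i) (ngt ⟨i.val + 1, h⟩) 1
  else
    Matrix.single zro (pos i) 1 - Matrix.single (ngt i) zro 2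

theorem mem_so_iff {r : ℕ} (A : Matrix (Idx r) (Idx r) ℂ) :
    A ∈ so r ↔ A.transpose * LieAlgebra.Orthogonal.JB (Fin r) ℂ =
      LieAlgebra.Orthogonal.JB (Fin r) ℂ * (-A) := by
  rw [so, LieAlgebra.Orthogonal.typeB, mem_skewAdjointMatricesLieSubalgebra,
    mem_skewAdjointMatricesSubmodule]
  rfl

theorem matE_mem {r : ℕ} (i : Fin r) : matE i ∈ so r := by
  rw [mem_so_iff]
  unfold matE
  split_ifs with h
  all_goals
    ext (⟨⟩ | a | a) (⟨⟩ | b | b) <;>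
    simp [Matrix.mul_apply, LieAlgebra.Orthogonal.JB, LieAlgebra.Orthogonal.JD, Matrix.single_apply,
      Matrix.one_apply, ite_and, eq_comm] <;> grind

theorem matF_mem {r : ℕ} (i : Fin r) : matF i ∈ so r := by
  rw [mem_so_iff]
  unfold matF
  split_ifs with h
  all_goals
    ext (⟨⟩ | a | a) (⟨⟩ | b | b) <;>
    simp [Matrix.mul_apply, LieAlgebra.Orthogonal.JB, LieAlgebra.Orthogonal.JD, Matrix.single_apply,
      Matrix.one_apply, ite_and, eq_comm] <;> grind

/-- The Chevalley generator `E_i`. -/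
def E {r : ℕ} (i : Fin r) : so r := ⟨matE i, matE_mem i⟩

/-- The Chevalley generator `F_i`. -/
def F {r : ℕ} (i : Fin r) : so r := ⟨matF i, matF_mem i⟩

/-- The simple coroot `H_i = α_i^∨ = [E_i, F_i]`. These elements form a basis of the Cartan
subalgebra of diagonal matrices in `so(2r+1)`. -/
def H {r : ℕ} (i : Fin r) : so r := ⁅E i, F i⁆

/-- The invariant form on `so(2r+1)`, normalized by `(α_i^∨, α_i^∨) = 1` for `i < r` and
`(α_r^∨, α_r^∨) = 2`, so that long roots have square length `4` and short roots `2`. -/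
def form {r : ℕ} (x y : so r) : ℂ :=
  (1 / 4) * Matrix.trace ((x : Matrix (Idx r) (Idx r) ℂ) * (y : Matrix (Idx r) (Idx r) ℂ))

/-- `x` is an orthonormal basis of `so(2r+1)` with respect to the invariant form. -/
def IsOrthonormalBasis {r : ℕ} {ι : Type*} [DecidableEq ι] (x : Module.Basis ι ℂ (so r)) : Prop :=
  ∀ i j, form (x i) (x j) = if i = j then 1 else 0

/-! ### Weights

A dominant integral weight `Λ` is given by its labels `Λ i = ⟨Λ, α_i^∨⟩ ∈ ℕ`. -/

/-- The number `d_i = (α_i, α_i) / 2`. -/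
def symm {r : ℕ} (i : Fin r) : ℤ := if i.val + 1 = r then 1 else 2

/-- The scalar product `(α_i, α_j)` of simple roots. -/
def rootPairing {r : ℕ} (i j : Fin r) : ℤ :=
  if i = j then 2 * symm i
  else if i.val + 1 = j.val ∨ j.val + 1 = i.val then -2
  else 0

/-- The scalar product `(α_i, Λ) = d_i ⟨Λ, α_i^∨⟩`. -/
def weightPairing {r : ℕ} (i : Fin r) (Λ : Fin r → ℕ) : ℤ := symm i * Λ i

/-- The first fundamental weight `ω_1`. -/
def omegaOne (r : ℕ) : Fin r → ℕ := fun i => if i.val = 0 then 1 else 0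

/-- `v` is a highest weight vector of weight `Λ`. -/
structure IsHighestWeightVector {r : ℕ} {V : Type*} [AddCommGroup V] [Module ℂ V]
    [LieRingModule (so r) V] (Λ : Fin r → ℕ) (v : V) : Prop where
  ne_zero : v ≠ 0
  lie_E : ∀ i, ⁅(E i : so r), v⁆ = 0
  lie_H : ∀ i, ⁅(H i : so r), v⁆ = (Λ i : ℂ) • v

/-! ### Gaudin Hamiltonians on a tensor product of two modules -/

section Hamiltonians

variable {r : ℕ} (V W : Type*)
  [AddCommGroup V] [Module ℂ V] [LieRingModule (so r) V] [LieModule ℂ (so r) V]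
  [AddCommGroup W] [Module ℂ W] [LieRingModule (so r) W] [LieModule ℂ (so r) W]

/-- The action `X^(s)` of an element `X` of the Lie algebra on the `s`-th tensor factor. -/
def siteAction (s : Fin 2) (X : so r) : Module.End ℂ (V ⊗[ℂ] W) :=
  if s = 0 then (LieModule.toEnd ℂ (so r) V X).rTensor W
  else (LieModule.toEnd ℂ (so r) W X).lTensor V

/-- The operator `Ω^(s,u) = ∑_k x_k^(s) x_k^(u)` for a basis `x` of the Lie algebra. -/
def Omega {ι : Type*} [Fintype ι] (x : Module.Basis ι ℂ (so r)) (s u : Fin 2) :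
    Module.End ℂ (V ⊗[ℂ] W) :=
  ∑ k, siteAction V W s (x k) * siteAction V W u (x k)

/-- The Gaudin Hamiltonian `ℋ_s(z) = ∑_{u ≠ s} Ω^(s,u) / (z_s - z_u)`. -/
def hamiltonian {ι : Type*} [Fintype ι] (x : Module.Basis ι ℂ (so r)) (z : Fin 2 → ℂ)
    (s : Fin 2) : Module.End ℂ (V ⊗[ℂ] W) :=
  ∑ u ∈ Finset.univ.erase s, (z s - z u)⁻¹ • Omega V W x s u

end Hamiltonians

/-! ### The Bethe ansatz equation -/

/-- The indices of the variables: `l i` variables of color `i`, for every `i`. -/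
abbrev Var {r : ℕ} (l : Fin r → ℕ) : Type := Σ i : Fin r, Fin (l i)

/-- `t` is a critical point associated to `z`, `Λ`, `l`, that is, a solution of the Bethe ansatz
equation; every denominator that comes with a nonzero numerator is required to be nonzero. -/
structure IsCriticalPoint {r : ℕ} (z : Fin 2 → ℂ) (Λ : Fin 2 → Fin r → ℕ) (l : Fin r → ℕ)
    (t : Var l → ℂ) : Prop where
  ne_of_rootPairing : ∀ a b, a ≠ b → rootPairing a.1 b.1 ≠ 0 → t a ≠ t b
  ne_of_weightPairing : ∀ a s, weightPairing a.1 (Λ s) ≠ 0 → t a ≠ z s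
  equation : ∀ a,
    - ∑ s, (weightPairing a.1 (Λ s) : ℂ) / (t a - z s)
      + ∑ b ∈ Finset.univ.erase a, (rootPairing a.1 b.1 : ℂ) / (t a - t b) = 0

/-- The tuples `(1,…,1,0,…,0)` and `(1,…,1,2,…,2)` with `k` ones, `0 ≤ k ≤ r`. -/
def HasAdmissibleForm {r : ℕ} (l : Fin r → ℕ) : Prop :=
  ∃ k : ℕ, k ≤ r ∧
    ((∀ i, l i = if i.val < k then 1 else 0) ∨ (∀ i, l i = if i.val < k then 1 else 2))

/-! ### The weight function and Bethe vectors -/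

section BetheVector

variable {r : ℕ} {V W : Type*}
  [AddCommGroup V] [Module ℂ V] [LieRingModule (so r) V] [LieModule ℂ (so r) V]
  [AddCommGroup W] [Module ℂ W] [LieRingModule (so r) W] [LieModule ℂ (so r) W]

/-- `1 / ((t_{a_1} - t_{a_2}) ⋯ (t_{a_{j-1}} - t_{a_j}) (t_{a_j} - z))` for the list
`a_1, …, a_j`, and `1` for the empty list. -/
def chain {l : Fin r → ℕ} (t : Var l → ℂ) (z : ℂ) : List (Var l) → ℂ
  | [] => 1
  | [a] => (t a - z)⁻¹
  | a :: b :: L => (t a - t b)⁻¹ * chain t z (b :: L)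

/-- `F_{c(a_1)} ⋯ F_{c(a_j)} v` for the list `a_1, …, a_j` of variables with colors `c(a_i)`. -/
def applyF {U : Type*} [AddCommGroup U] [Module ℂ U] [LieRingModule (so r) U] {l : Fin r → ℕ}
    (L : List (Var l)) (v : U) : U :=
  L.foldr (fun a u => ⁅(F a.1 : so r), u⁆) v

/-- The canonical weight function at a point `t` without vanishing denominators: the sum over all
orderings `σ` of the variables and all ways to cut the resulting list into an initial segment, for
the first tensor factor, and the remaining segment, for the second one. -/
def weightFunction (z : Fin 2 → ℂ) {l : Fin r → ℕ} (v : V) (w : W) (t : Var l → ℂ) : V ⊗[ℂ] W :=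
  ∑ j : Fin (Fintype.card (Var l) + 1), ∑ σ : Fin (Fintype.card (Var l)) ≃ Var l,
    (chain t (z 0) ((List.ofFn σ).take j) * chain t (z 1) ((List.ofFn σ).drop j)) •
      (applyF ((List.ofFn σ).take j) v ⊗ₜ[ℂ] applyF ((List.ofFn σ).drop j) w)

/-- The points at which no denominator of the weight function vanishes. -/
def regularPoints (z : Fin 2 → ℂ) (l : Fin r → ℕ) : Set (Var l → ℂ) :=
  {t | Function.Injective t ∧ ∀ a s, t a ≠ z s}

/-- `ω` is the value at `t` of the weight function, as a rational function: poles of single terms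
at `t` may cancel in the sum, so the value is the limit along the points where all terms are
defined (coordinatewise in the target space). -/
def IsWeightFunctionValue (z : Fin 2 → ℂ) {l : Fin r → ℕ} (v : V) (w : W) (t : Var l → ℂ)
    (ω : V ⊗[ℂ] W) : Prop :=
  ∀ φ : Module.Dual ℂ (V ⊗[ℂ] W),
    Filter.Tendsto (fun s => φ (weightFunction z v w s)) (𝓝[regularPoints z l] t) (𝓝 (φ ω))

open Classical in
/-- The value of the weight function at `t`; it is set to `0` if the weight function is not regular
at `t`. At a critical point `t` this is the Bethe vector. -/
def betheVector (z : Fin 2 → ℂ) {l : Fin r → ℕ} (v : V) (w : W) (t : Var l → ℂ) : V ⊗[ℂ] W :=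
  if h : ∃ ω : V ⊗[ℂ] W, IsWeightFunctionValue z v w t ω then h.choose else 0

end BetheVector

end GaudinB

end

/-! The Bethe vector is a singular vector of `V ⊗ W`, and its component along one basis vector of
`W` is a nonzero multiple of `v`. Both the eigenvalue and the nonvanishing can be read off from that
component.

Singularity: grouping the weight function by the set `T` of variables sent to the first factor
writes it as a sum of products of one-module weight functions. By `E_lie_partialWeight`, `E i` acts
on such a function by deleting one variable `a` of color `i`, with coefficient `kCoeff`. In the
tensor product the two coefficients for the same `a` add up to a multiple of the Bethe equation of
`a`, hence to zero. At a solution, variables of orthogonal colors may coincide and single terms have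
poles. The limit still exists in each factor: in an irreducible module a vector of weight below the
top is determined by its images under all `E i`, and these converge by induction on the number of
variables (`exists_weakLimit_partialWeight`).

Nonvanishing: `W` is the vector representation, whose basis vectors are numbered by heights `0, …,
2r`, so its `D`-eigenspaces are lines. With `L` variables, the component of the Bethe vector at
height `L` is `v` times one coordinate of the second-factor function. The deletion rule becomes a
scalar recursion for this coordinate, and for admissible tuples the solution is an explicit nonzero
product (`coeff_univ_ne_zero`).

Eigenvalue: `Ω` commutes with the Lie algebra, so `Ω u - c u` is again singular of the same weight.
A singular vector of this weight vanishes once its component at height `L` does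
(`eq_zero_of_comp_eq_zero`), and `comp_Omega_of_singular` computes that component of `Ω u`. The
resulting `casimirValue` decreases strictly in `L`, except that it takes equal values at `r` and `r
+ 1` if the last label of `λ` is zero. In that case the Bethe equations for `(1, …, 1)`, the only
admissible tuple of length `r`, have no solution (`label_ne_zero_of_isCriticalPoint`). -/

noncomputable section

namespace GaudinB

/-! ### Wedge products: a spanning family of `so(2r+1)` -/

section Wedge

variable {r : ℕ}

/-- The negation of indices. -/
def bar : Idx r → Idx r
  | Sum.inl _ => zro
  | Sum.inr (Sum.inl i) => ngt i
  | Sum.inr (Sum.inr i) => pos i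

/-- The value `(e_a, e_{-a})` of the symmetric bilinear form. -/
def nrm : Idx r → ℂ
  | Sum.inl _ => 2
  | Sum.inr _ => 1

/-- The height of an index in the order `1, …, r, 0, -r, …, -1`. -/
def ht : Idx r → ℕ
  | Sum.inl _ => r
  | Sum.inr (Sum.inl i) => i
  | Sum.inr (Sum.inr i) => 2 * r - i

theorem ht_pos (i : Fin r) : ht (pos i) = i := rfl

theorem ht_zro : ht (zro : Idx r) = r := rfl

theorem ht_ngt (i : Fin r) : ht (ngt i) = 2 * r - i := rfl

@[simp] theorem bar_bar (a : Idx r) : bar (bar a) = a := by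
  rcases a with (⟨⟩ | a | a) <;> rfl

@[simp] theorem nrm_bar (a : Idx r) : nrm (bar a) = nrm a := by
  rcases a with (⟨⟩ | a | a) <;> rfl

theorem nrm_ne_zero (a : Idx r) : nrm a ≠ 0 := by
  rcases a with (⟨⟩ | a | a) <;> simp [nrm]

theorem bar_eq_iff {a b : Idx r} : bar a = b ↔ a = bar b :=
  ⟨fun h => by rw [← h, bar_bar], fun h => by rw [h, bar_bar]⟩

theorem eq_bar_comm (a b : Idx r) : a = bar b ↔ b = bar a := by
  rw [← bar_eq_iff, eq_comm]

theorem ht_le (a : Idx r) : ht a ≤ 2 * r := by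
  rcases a with (⟨⟩ | a | a) <;> simp [ht] <;> omega

theorem ht_bar (a : Idx r) : ht (bar a) = 2 * r - ht a := by
  rcases a with (⟨⟩ | a | a) <;> simp [ht, bar] <;> omega

theorem ht_injective : Function.Injective (ht (r := r)) := by
  rintro (⟨⟩ | a | a) (⟨⟩ | b | b) h <;> simp [ht, Fin.ext_iff] at h ⊢ <;> omega

theorem exists_ht_eq {m : ℕ} (hm : m ≤ 2 * r) : ∃ a : Idx r, ht a = m := by
  rcases lt_trichotomy m r with h | h | h
  · exact ⟨pos ⟨m, h⟩, rfl⟩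
  · exact ⟨zro, h.symm⟩
  · exact ⟨ngt ⟨2 * r - m, by omega⟩, by simp [ht]; omega⟩

theorem eq_bar_iff_ht {a b : Idx r} : a = bar b ↔ ht a + ht b = 2 * r := by
  have := ht_le a
  have := ht_le b
  rw [← ht_injective.eq_iff, ht_bar]
  omega

theorem nrm_eq_one {a : Idx r} (h : ht a ≠ r) : nrm a = 1 := by
  rcases a with (⟨⟩ | a | a) <;> simp_all [ht, nrm]

theorem nrm_eq_two {a : Idx r} (h : ht a = r) : nrm a = 2 := by
  rw [show a = zro from ht_injective (by simpa [ht] using h)]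
  rfl

theorem JB_apply (a b : Idx r) :
    LieAlgebra.Orthogonal.JB (Fin r) ℂ a b = if b = bar a then nrm a else 0 := by
  rcases a with (⟨⟩ | a | a) <;> rcases b with (⟨⟩ | b | b) <;>
    simp [LieAlgebra.Orthogonal.JB, LieAlgebra.Orthogonal.JD, bar, nrm, Matrix.one_apply, eq_comm]

theorem mem_so_iff_apply (A : Matrix (Idx r) (Idx r) ℂ) :
    A ∈ so r ↔ ∀ a c, nrm c * A (bar c) a = - (nrm a * A (bar a) c) := by
  rw [mem_so_iff, ← Matrix.ext_iff]
  refine forall_congr' fun a => forall_congr' fun c => ?_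
  have h1 : ∀ x : Idx r, (c = bar x) = (x = bar c) := fun x => propext (eq_bar_comm c x)
  simp only [Matrix.mul_apply, Matrix.transpose_apply, JB_apply, Matrix.neg_apply, h1]
  simp [mul_comm]

/-- The operator `y ↦ (e_b, y) e_a - (e_a, y) e_b`. -/
def wedgeMat (a b : Idx r) : Matrix (Idx r) (Idx r) ℂ :=
  nrm b • Matrix.single a (bar b) 1 - nrm a • Matrix.single b (bar a) 1

theorem wedgeMat_apply (a b c d : Idx r) :
    wedgeMat a b c d = (if c = a ∧ d = bar b then nrm b else 0) -
      (if c = b ∧ d = bar a then nrm a else 0) := by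
  simp [wedgeMat, Matrix.single_apply, eq_comm]

theorem wedgeMat_mem (a b : Idx r) : wedgeMat a b ∈ so r := by
  rw [mem_so_iff_apply]
  intro c d
  have hn : ∀ x y : Idx r, x = bar y → nrm x = nrm y := fun x y h => by rw [h, nrm_bar]
  have hca := hn c a
  have hcb := hn c b
  have hda := hn d a
  have hdb := hn d b
  simp only [wedgeMat_apply, bar_eq_iff]
  by_cases h1 : c = bar a <;> by_cases h2 : c = bar b <;> by_cases h3 : d = bar a <;>
    by_cases h4 : d = bar b <;> simp only [h1, h2, h3, h4, forall_const] at hca hcb hda hdb <;>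
    simp only [h1, h2, h3, h4, and_self, and_true, and_false, true_and, false_and, if_true,
      if_false] <;> grind

/-- `wedgeMat a b` as an element of `so(2r+1)`. -/
def wedge (a b : Idx r) : so r := ⟨wedgeMat a b, wedgeMat_mem a b⟩

theorem wedge_swap (a b : Idx r) : wedge b a = - wedge a b := by
  apply Subtype.ext
  simp [wedge, wedgeMat]

theorem wedge_self (a : Idx r) : wedge a a = 0 := by
  apply Subtype.ext
  simp [wedge, wedgeMat]

theorem smul_single_mul_single (a b c d : Idx r) :
    (Matrix.single a b 1 * Matrix.single c d 1 : Matrix (Idx r) (Idx r) ℂ) =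
      if c = b then Matrix.single a d 1 else 0 := by
  split_ifs with h
  · subst h; simp
  · rw [Matrix.single_mul_single_of_ne _ _ _ _ (Ne.symm h)]

/-- All commutation relations below follow from this formula: once indices are replaced by heights,
deciding which terms survive is linear arithmetic. -/
theorem lie_wedge (p q a b : Idx r) :
    ⁅wedge p q, wedge a b⁆ =
      (if a = bar q then nrm q • wedge p b else 0) - (if a = bar p then nrm p • wedge q b else 0)
      + (if b = bar q then nrm q • wedge a p else 0)
      - (if b = bar p then nrm p • wedge a q else 0) := by
  have h1 : ∀ x y : Idx r, (x = bar y) = (y = bar x) := fun x y => propext (eq_bar_comm x y)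
  have hn : ∀ x y : Idx r, x = bar y → nrm x = nrm y := fun x y h => by rw [h, nrm_bar]
  have haq := hn a q
  have hap := hn a p
  have hbq := hn b q
  have hbp := hn b p
  apply Subtype.ext
  rw [LieSubalgebra.coe_bracket, Ring.lie_def]
  simp only [wedge, wedgeMat, sub_mul, mul_sub, Matrix.smul_mul, Matrix.mul_smul,
    smul_single_mul_single, h1 p, h1 q]
  split_ifs <;>
    simp only [AddSubgroupClass.coe_sub, AddMemClass.coe_add, ZeroMemClass.coe_zero,
      SetLike.val_smul] <;> match_scalars <;> grind

/-- Heights treat the long simple roots and the short one alike: a simple root vector has total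
height `2r - 1`, its negative `2r + 1`, and Cartan elements `2r`. -/
theorem E_eq_wedge {i : Fin r} {a b : Idx r} (ha : ht a = i) (hb : ht b + i + 1 = 2 * r) :
    E i = wedge a b := by
  obtain rfl : a = pos i := ht_injective ha
  apply Subtype.ext
  simp only [E, wedge, matE]
  split_ifs with h
  · obtain rfl : b = ngt ⟨i + 1, h⟩ := ht_injective (by simp only [ht_ngt]; omega)
    simp [wedgeMat, nrm, bar]
  · obtain rfl : b = zro := ht_injective (by simp only [ht_zro]; omega)
    simp [wedgeMat, nrm, bar]

theorem F_eq_wedge {i : Fin r} {a b : Idx r} (ha : ht a = i + 1) (hb : ht b + i = 2 * r) :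
    F i = wedge a b := by
  obtain rfl : b = ngt i := ht_injective (by simp only [ht_ngt]; omega)
  apply Subtype.ext
  simp only [F, wedge, matF]
  split_ifs with h
  · obtain rfl : a = pos ⟨i + 1, h⟩ := ht_injective (by simp only [ht_pos]; omega)
    simp [wedgeMat, nrm, bar]
  · obtain rfl : a = zro := ht_injective (by simp only [ht_zro]; omega)
    simp [wedgeMat, nrm, bar]

/-- Induction on the height of the positive root, which is `n + 1`: with `c` directly after `b`,
bracketing `wedge a c` with the root vector `wedge b (bar c)` of height one gives a multiple of
`wedge a b`. -/
theorem wedge_mem_of_E_mem {S : LieSubalgebra ℂ (so r)} (hS : ∀ i : Fin r, E i ∈ S) (n : ℕ) :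
    ∀ a b : Idx r, ht a + ht b + n + 1 = 2 * r → wedge a b ∈ S := by
  have main : ∀ a b : Idx r, ht a < ht b → ht a + ht b + n + 1 = 2 * r → wedge a b ∈ S := by
    induction n with
    | zero =>
      intro a b hab h
      rw [← E_eq_wedge (i := ⟨ht a, by omega⟩) rfl (by simp; omega)]
      exact hS _
    | succ n ih =>
      intro a b hab h
      obtain ⟨c, hc⟩ := exists_ht_eq (r := r) (m := ht b + 1) (by omega)
      have h1 : wedge a c ∈ S := ih a c (by omega) (by omega)
      have h2 : wedge b (bar c) ∈ S := by
        -- Up to sign this is a simple root vector; which of its two indices carries the color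
        -- depends on the side of the middle index on which `b` lies.
        by_cases hb : ht b < r
        · rw [← E_eq_wedge (i := ⟨ht b, hb⟩) rfl (by rw [ht_bar]; simp; omega)]
          exact hS _
        · rw [wedge_swap, ← E_eq_wedge (i := ⟨2 * r - (ht b + 1), by omega⟩)
            (by rw [ht_bar, hc]) (by simp; omega)]
          exact S.neg_mem (hS _)
      have h3 := lie_wedge b (bar c) a c
      have h4 : a ≠ c := fun h => by rw [h] at hab; omega
      rw [bar_bar, if_neg h4, if_neg (by rw [eq_bar_iff_ht]; omega), if_pos rfl,
        if_neg (by rw [eq_bar_iff_ht]; omega), nrm_bar] at h3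
      rw [show wedge a b = (nrm c)⁻¹ • ⁅wedge b (bar c), wedge a c⁆ by
        rw [h3]; simp [smul_smul, nrm_ne_zero]]
      exact S.smul_mem _ (S.lie_mem h2 h1)
  intro a b h
  rcases lt_trichotomy (ht a) (ht b) with hab | hab | hab
  · exact main a b hab h
  · rw [ht_injective hab, wedge_self]
    exact S.zero_mem
  · rw [wedge_swap]
    exact S.neg_mem (main b a hab (by omega))

theorem wedge_mem_of_F_mem {S : LieSubalgebra ℂ (so r)} (hS : ∀ i : Fin r, F i ∈ S) (n : ℕ) :
    ∀ a b : Idx r, ht a + ht b = 2 * r + n + 1 → wedge a b ∈ S := by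
  have main : ∀ a b : Idx r, ht a < ht b → ht a + ht b = 2 * r + n + 1 → wedge a b ∈ S := by
    induction n with
    | zero =>
      intro a b hab h
      have := ht_le b
      rw [← F_eq_wedge (i := ⟨2 * r - ht b, by omega⟩) (by simp; omega) (by simp; omega)]
      exact hS _
    | succ n ih =>
      intro b a hab h
      have := ht_le a
      obtain ⟨c, hc⟩ := exists_ht_eq (r := r) (m := ht b - 1) (by omega)
      have h1 : wedge c a ∈ S := ih c a (by omega) (by omega)
      have h2 : wedge b (bar c) ∈ S := by
        by_cases hb : ht b ≤ r
        · rw [← F_eq_wedge (i := ⟨ht b - 1, by omega⟩) (by simp; omega)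
            (by rw [ht_bar]; simp; omega)]
          exact hS _
        · rw [wedge_swap, ← F_eq_wedge (i := ⟨2 * r - ht b, by omega⟩)
            (by rw [ht_bar, hc]; simp; omega) (by simp; omega)]
          exact S.neg_mem (hS _)
      have h3 := lie_wedge b (bar c) c a
      have h4 : a ≠ c := fun h => by rw [h] at hab; omega
      rw [bar_bar, if_pos rfl, if_neg (by rw [eq_bar_iff_ht]; omega), if_neg h4,
        if_neg (by rw [eq_bar_iff_ht]; omega), nrm_bar] at h3
      rw [show wedge b a = (nrm c)⁻¹ • ⁅wedge b (bar c), wedge c a⁆ by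
        rw [h3]; simp [smul_smul, nrm_ne_zero]]
      exact S.smul_mem _ (S.lie_mem h2 h1)
  intro a b h
  rcases lt_trichotomy (ht a) (ht b) with hab | hab | hab
  · exact main a b hab h
  · rw [ht_injective hab, wedge_self]
    exact S.zero_mem
  · rw [wedge_swap]
    exact S.neg_mem (main b a hab (by omega))

theorem H_eq_wedge {i : Fin r} {a c : Idx r} (ha : ht a = i) (hc : ht c = i + 1) :
    H i = nrm c • wedge a (bar a) - wedge c (bar c) := by
  rw [H, E_eq_wedge (b := bar c) ha (by rw [ht_bar]; omega),
    F_eq_wedge (b := bar a) hc (by rw [ht_bar]; omega), lie_wedge, bar_bar, if_pos rfl,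
    if_neg (by rw [eq_bar_iff_ht]; omega), if_neg (by rw [bar_eq_iff, eq_bar_iff_ht]; omega),
    if_pos rfl, nrm_bar, nrm_eq_one (a := a) (by omega)]
  simp

theorem wedge_bar_mem_span_H (n : ℕ) : ∀ a : Idx r, ht a + n = r →
    wedge a (bar a) ∈ Submodule.span ℂ (Set.range (H (r := r))) := by
  induction n with
  | zero =>
    intro a ha
    obtain rfl : a = zro := ht_injective ha
    rw [show bar zro = (zro : Idx r) from rfl, wedge_self]
    exact zero_mem _
  | succ n ih =>
    intro a ha
    obtain ⟨c, hc⟩ := exists_ht_eq (r := r) (m := ht a + 1) (by omega)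
    have h := H_eq_wedge (i := ⟨ht a, by omega⟩) (a := a) rfl hc
    rw [show wedge a (bar a) = (nrm c)⁻¹ • (H ⟨ht a, by omega⟩ + wedge c (bar c)) by
      rw [h]; simp [smul_smul, nrm_ne_zero]]
    exact Submodule.smul_mem _ _
      (add_mem (Submodule.subset_span ⟨_, rfl⟩) (ih c (by omega)))

theorem wedge_bar_mem_span_H' (a : Idx r) :
    wedge a (bar a) ∈ Submodule.span ℂ (Set.range (H (r := r))) := by
  by_cases h : ht a ≤ r
  · exact wedge_bar_mem_span_H (r - ht a) a (by omega)
  · have h1 := wedge_bar_mem_span_H (r - ht (bar a)) (bar a) (by rw [ht_bar]; omega)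
    rw [bar_bar] at h1
    rw [wedge_swap]
    exact neg_mem h1

/-- The sum is over ordered pairs, so each wedge is counted twice; this accounts for the factor 2 in
the denominators. -/
theorem eq_sum_wedge (x : so r) :
    x = ∑ a, ∑ b, (x.1 a (bar b) / (2 * nrm b)) • wedge a b := by
  have hx := (mem_so_iff_apply x.1).1 x.2
  apply Subtype.ext
  ext c d
  have h1 := hx (bar c) d
  rw [bar_bar, nrm_bar] at h1
  have hc := nrm_ne_zero c
  have hd := nrm_ne_zero d
  simp only [AddSubmonoidClass.coe_finsetSum, SetLike.val_smul, wedge, Matrix.sum_apply,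
    Matrix.smul_apply, wedgeMat_apply, smul_eq_mul, mul_sub, Finset.sum_sub_distrib, ite_and,
    mul_ite, mul_zero]
  simp only [eq_bar_comm d, Finset.sum_ite_eq, Finset.sum_ite_eq', Finset.mem_univ, if_true]
  rw [Finset.sum_comm]
  simp only [Finset.sum_ite_eq, Finset.sum_ite_eq', Finset.mem_univ, if_true, bar_bar, nrm_bar]
  field_simp
  linear_combination h1

/-- The Chevalley generators `E_i`, `F_i` generate `so(2r+1)`. -/
theorem eq_top_of_E_F_mem {S : LieSubalgebra ℂ (so r)} (hE : ∀ i : Fin r, E i ∈ S)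
    (hF : ∀ i : Fin r, F i ∈ S) (x : so r) : x ∈ S := by
  rw [eq_sum_wedge x]
  refine sum_mem fun a _ => sum_mem fun b _ => S.smul_mem _ ?_
  rcases lt_trichotomy (ht a + ht b) (2 * r) with h | h | h
  · exact wedge_mem_of_E_mem hE (2 * r - 1 - (ht a + ht b)) a b (by omega)
  · rw [show b = bar a by rw [eq_bar_iff_ht]; omega]
    have : Submodule.span ℂ (Set.range (H (r := r))) ≤ S.toSubmodule := by
      rw [Submodule.span_le]
      rintro _ ⟨i, rfl⟩
      exact S.lie_mem (hE i) (hF i)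
    exact this (wedge_bar_mem_span_H' a)
  · exact wedge_mem_of_F_mem hF (ht a + ht b - (2 * r + 1)) a b (by omega)

/-- The element of the Cartan subalgebra that acts on basis vectors by `r - ht`. -/
def D (r : ℕ) : so r := ⟨Matrix.diagonal fun a => (r : ℂ) - ht a, by
  rw [mem_so_iff_apply]
  intro a c
  simp only [Matrix.diagonal_apply, bar_eq_iff, eq_bar_comm a c]
  split_ifs with h
  · subst h
    have : ((ht (bar a) : ℕ) : ℂ) = 2 * r - ht a := by
      rw [ht_bar, Nat.cast_sub (ht_le a)]; push_cast; ring
    simp only [bar_bar, this, nrm_bar]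
    ring
  · simp⟩

theorem lie_D_wedge (a b : Idx r) : ⁅D r, wedge a b⁆ = (2 * r - ht a - ht b : ℂ) • wedge a b := by
  have h : ∀ a : Idx r, ((ht (bar a) : ℕ) : ℂ) = 2 * r - ht a := fun a => by
    rw [ht_bar, Nat.cast_sub (ht_le a)]; push_cast; ring
  apply Subtype.ext
  rw [LieSubalgebra.coe_bracket, Ring.lie_def]
  ext c d
  simp only [D, wedge, Matrix.sub_apply, Matrix.diagonal_mul, Matrix.mul_diagonal, wedgeMat_apply,
    SetLike.val_smul, Matrix.smul_apply, smul_eq_mul]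
  have h1 : c = a ∧ d = bar b → ((ht c : ℕ) : ℂ) = ht a ∧ ((ht d : ℕ) : ℂ) = 2 * r - ht b := by
    rintro ⟨rfl, rfl⟩; exact ⟨rfl, h b⟩
  have h2 : c = b ∧ d = bar a → ((ht c : ℕ) : ℂ) = ht b ∧ ((ht d : ℕ) : ℂ) = 2 * r - ht a := by
    rintro ⟨rfl, rfl⟩; exact ⟨rfl, h a⟩
  split_ifs <;> grind

theorem D_eq_sum : D r = ∑ a, (((r : ℂ) - ht a) / (2 * nrm a)) • wedge a (bar a) := by
  rw [eq_sum_wedge (D r)]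
  refine Finset.sum_congr rfl fun a _ => ?_
  rw [Finset.sum_eq_single (bar a)]
  · simp [D]
  · intro b _ hb
    have : a ≠ bar b := fun h => hb (by rw [h, bar_bar])
    simp [D, Matrix.diagonal_apply_ne _ this]
  · simp

theorem lie_D_E (i : Fin r) : ⁅D r, E i⁆ = E i := by
  obtain ⟨a, ha⟩ := exists_ht_eq (r := r) (m := i) (by omega)
  obtain ⟨b, hb⟩ := exists_ht_eq (r := r) (m := 2 * r - 1 - i) (by omega)
  rw [E_eq_wedge (b := b) ha (by omega), lie_D_wedge]
  have : ((ht b : ℕ) : ℂ) = 2 * r - 1 - ht a := by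
    have : ht a + ht b + 1 = 2 * r := by omega
    linear_combination (by exact_mod_cast this : (ht a + ht b + 1 : ℂ) = 2 * r)
  rw [this]
  module

theorem lie_D_F (i : Fin r) : ⁅D r, F i⁆ = - F i := by
  obtain ⟨a, ha⟩ := exists_ht_eq (r := r) (m := i + 1) (by omega)
  obtain ⟨b, hb⟩ := exists_ht_eq (r := r) (m := 2 * r - i) (by omega)
  rw [F_eq_wedge (b := b) ha (by omega), lie_D_wedge]
  have : ((ht b : ℕ) : ℂ) = 2 * r + 1 - ht a := by
    have : ht a + ht b = 2 * r + 1 := by omega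
    linear_combination (by exact_mod_cast this : (ht a + ht b : ℂ) = 2 * r + 1)
  rw [this]
  module

theorem lie_wedge_bar (a p q : Idx r) : ⁅wedge a (bar a), wedge p q⁆ =
    (nrm a * ((if p = a then 1 else 0) - (if p = bar a then 1 else 0)
      + (if q = a then 1 else 0) - (if q = bar a then 1 else 0))) • wedge p q := by
  rw [lie_wedge, bar_bar, nrm_bar]
  have h1 : (if p = a then nrm a • wedge a q else 0) =
      (nrm a * if p = a then 1 else 0) • wedge p q := by split_ifs with h <;> simp [h]
  have h2 : (if p = bar a then nrm a • wedge (bar a) q else 0) =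
      (nrm a * if p = bar a then 1 else 0) • wedge p q := by split_ifs with h <;> simp [h]
  have h3 : (if q = a then nrm a • wedge p a else 0) =
      (nrm a * if q = a then 1 else 0) • wedge p q := by split_ifs with h <;> simp [h]
  have h4 : (if q = bar a then nrm a • wedge p (bar a) else 0) =
      (nrm a * if q = bar a then 1 else 0) • wedge p q := by split_ifs with h <;> simp [h]
  rw [h1, h2, h3, h4]
  module

end Wedge

/-! ### Weights and highest weight vectors -/

section Commutators

variable {r : ℕ}

theorem lie_H_wedge {i : Fin r} {a c : Idx r} (ha : ht a = i) (hc : ht c = i + 1) (p q : Idx r) :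
    ⁅H i, wedge p q⁆ = (nrm c * (((if p = a then 1 else 0) - (if p = bar a then 1 else 0)
      + (if q = a then 1 else 0) - (if q = bar a then 1 else 0))
      - ((if p = c then 1 else 0) - (if p = bar c then 1 else 0)
      + (if q = c then 1 else 0) - (if q = bar c then 1 else 0)))) • wedge p q := by
  rw [H_eq_wedge ha hc, sub_lie, smul_lie, lie_wedge_bar, lie_wedge_bar,
    nrm_eq_one (a := a) (by omega)]
  module

theorem lie_H_F (i j : Fin r) :
    ⁅H i, F j⁆ = (-((rootPairing i j : ℂ) / (symm i : ℂ))) • F j := by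
  obtain ⟨a, ha⟩ := exists_ht_eq (r := r) (m := i) (by omega)
  obtain ⟨c, hc⟩ := exists_ht_eq (r := r) (m := i + 1) (by omega)
  obtain ⟨p, hp⟩ := exists_ht_eq (r := r) (m := j + 1) (by omega)
  obtain ⟨q, hq⟩ := exists_ht_eq (r := r) (m := 2 * r - j) (by omega)
  rw [F_eq_wedge (b := q) hp (by omega), lie_H_wedge ha hc]
  congr 1
  simp only [← ht_injective.eq_iff (a := p) (b := a), ← ht_injective.eq_iff (a := q) (b := a),
    ← ht_injective.eq_iff (a := p) (b := c), ← ht_injective.eq_iff (a := q) (b := c),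
    eq_bar_iff_ht, ha, hc, hp, hq, rootPairing, symm, Fin.ext_iff]
  have hi := i.2
  have hj := j.2
  -- Each coincidence of indices is rewritten as a relation between the colors: equal, adjacent, or
  -- impossible.
  have h1 : (j.val + 1 + i = 2 * r) = False := by simp; omega
  have h2 : (2 * r - j.val = i) = False := by simp; omega
  have h3 : (2 * r - j.val + i = 2 * r) = (i.val = j) := by rw [eq_iff_iff]; omega
  have h4 : (j.val + 1 = i + 1) = (i.val = j) := by rw [eq_iff_iff]; omega
  have h5 : (j.val + 1 + (i + 1) = 2 * r) = (i.val = j ∧ i.val + 1 = r) := by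
    rw [eq_iff_iff]; omega
  have h6 : (2 * r - j.val = i + 1) = False := by simp; omega
  have h7 : (2 * r - j.val + (i + 1) = 2 * r) = (i.val + 1 = j) := by rw [eq_iff_iff]; omega
  have h8 : nrm c = if i.val + 1 = r then 2 else 1 := by
    split_ifs with h
    · exact nrm_eq_two (by omega)
    · exact nrm_eq_one (by omega)
  simp only [h1, h2, h3, h4, h5, h6, h7, h8, if_false]
  split_ifs <;> first | omega | norm_num

theorem exists_lie_H_E (i j : Fin r) : ∃ k : ℂ, ⁅H i, E j⁆ = k • E j := by
  obtain ⟨a, ha⟩ := exists_ht_eq (r := r) (m := i) (by omega)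
  obtain ⟨c, hc⟩ := exists_ht_eq (r := r) (m := i + 1) (by omega)
  obtain ⟨p, hp⟩ := exists_ht_eq (r := r) (m := j) (by omega)
  obtain ⟨q, hq⟩ := exists_ht_eq (r := r) (m := 2 * r - 1 - j) (by omega)
  rw [E_eq_wedge (b := q) hp (by omega), lie_H_wedge ha hc]
  exact ⟨_, rfl⟩

theorem lie_E_F_of_ne {i j : Fin r} (hij : i ≠ j) : ⁅E i, F j⁆ = 0 := by
  obtain ⟨a, ha⟩ := exists_ht_eq (r := r) (m := i) (by omega)
  obtain ⟨c, hc⟩ := exists_ht_eq (r := r) (m := 2 * r - 1 - i) (by omega)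
  obtain ⟨p, hp⟩ := exists_ht_eq (r := r) (m := j + 1) (by omega)
  obtain ⟨q, hq⟩ := exists_ht_eq (r := r) (m := 2 * r - j) (by omega)
  have hij : i.val ≠ j.val := fun h => hij (Fin.ext h)
  rw [E_eq_wedge (b := c) ha (by omega), F_eq_wedge (b := q) hp (by omega), lie_wedge,
    if_neg (by rw [eq_bar_iff_ht]; omega), if_neg (by rw [eq_bar_iff_ht]; omega),
    if_neg (by rw [eq_bar_iff_ht]; omega), if_neg (by rw [eq_bar_iff_ht]; omega)]
  simp

theorem lie_E_F (i j : Fin r) : ⁅E i, F j⁆ = if j = i then H i else 0 := by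
  split_ifs with h
  · rw [h, H]
  · exact lie_E_F_of_ne (Ne.symm h)

theorem lie_D_H (i : Fin r) : ⁅D r, H i⁆ = 0 := by
  rw [H, leibniz_lie, lie_D_E, lie_D_F, lie_neg, add_neg_cancel]

theorem exists_D_eq_sum_H : ∃ c : Fin r → ℂ, ∑ i, c i • H i = D r := by
  rw [← Submodule.mem_span_range_iff_exists_fun, D_eq_sum]
  exact sum_mem fun a _ => Submodule.smul_mem _ _ (wedge_bar_mem_span_H' a)

/-- The value of a weight at `D`. -/
def topWeight (Λ : Fin r → ℕ) : ℂ := ∑ i, (exists_D_eq_sum_H (r := r)).choose i * Λ i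

end Commutators

/-! ### The grading by `D` and submodules generated by singular vectors. -/

section Weights

variable {r : ℕ} {X : Type*} [AddCommGroup X] [Module ℂ X] [LieRingModule (so r) X]
  [LieModule ℂ (so r) X]

theorem lie_D_of_lie_H {Λ : Fin r → ℕ} {v : X} (hv : ∀ i, ⁅(H i : so r), v⁆ = (Λ i : ℂ) • v) :
    ⁅D r, v⁆ = topWeight Λ • v := by
  rw [← (exists_D_eq_sum_H (r := r)).choose_spec, sum_lie, topWeight, Finset.sum_smul]
  exact Finset.sum_congr rfl fun i _ => by rw [smul_lie, hv, smul_smul]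

omit [Module ℂ X] [LieModule ℂ (so r) X] in
theorem E_lie_F_lie (i j : Fin r) (x : X) :
    ⁅(E i : so r), ⁅(F j : so r), x⁆⁆ =
      (if j = i then ⁅(H i : so r), x⁆ else 0) + ⁅(F j : so r), ⁅(E i : so r), x⁆⁆ := by
  rw [leibniz_lie, lie_E_F]
  split_ifs <;> simp

variable (r X) in
/-- The subspace of `X` on which `D` acts by the scalar `δ`. -/
def Dspace (δ : ℂ) : Submodule ℂ X := (LieModule.toEnd ℂ (so r) X (D r)).eigenspace δ

theorem mem_Dspace {δ : ℂ} {x : X} : x ∈ Dspace r X δ ↔ ⁅D r, x⁆ = δ • x := by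
  rw [Dspace, Module.End.mem_eigenspace_iff]
  rfl

theorem F_lie_mem_Dspace {δ : ℂ} {x : X} (hx : x ∈ Dspace r X δ) (i : Fin r) :
    ⁅(F i : so r), x⁆ ∈ Dspace r X (δ - 1) := by
  rw [mem_Dspace] at hx ⊢
  rw [leibniz_lie, lie_D_F, hx, neg_lie, lie_smul]
  module

theorem H_lie_mem_Dspace {δ : ℂ} {x : X} (hx : x ∈ Dspace r X δ) (i : Fin r) :
    ⁅(H i : so r), x⁆ ∈ Dspace r X δ := by
  rw [mem_Dspace] at hx ⊢
  rw [leibniz_lie, lie_D_H, hx, lie_smul]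
  simp

variable (r X) in
/-- The sum of the eigenspaces of `D` with eigenvalues `δ, δ - 1, δ - 2, …`. -/
def Dlow (δ : ℂ) : Submodule ℂ X := ⨆ n : ℕ, Dspace r X (δ - n)

theorem Dspace_le_Dlow (δ : ℂ) : Dspace r X δ ≤ Dlow r X δ :=
  le_iSup_of_le 0 (by simp)

theorem Dlow_sub_one_le (δ : ℂ) : Dlow r X (δ - 1) ≤ Dlow r X δ :=
  iSup_le fun n => le_iSup_of_le (n + 1) (by push_cast; rw [sub_sub, add_comm])

theorem F_lie_mem_Dlow {δ : ℂ} {x : X} (hx : x ∈ Dlow r X δ) (i : Fin r) :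
    ⁅(F i : so r), x⁆ ∈ Dlow r X (δ - 1) := by
  have : Dlow r X δ ≤ (Dlow r X (δ - 1)).comap (LieModule.toEnd ℂ (so r) X (F i)) :=
    iSup_le fun n y hy => Submodule.mem_iSup_of_mem n (by
      have := F_lie_mem_Dspace hy i
      rwa [sub_right_comm] at this)
  exact this hx

theorem H_lie_mem_Dlow {δ : ℂ} {x : X} (hx : x ∈ Dlow r X δ) (i : Fin r) :
    ⁅(H i : so r), x⁆ ∈ Dlow r X δ := by
  have : Dlow r X δ ≤ (Dlow r X δ).comap (LieModule.toEnd ℂ (so r) X (H i)) :=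
    iSup_le fun n y hy => Submodule.mem_iSup_of_mem n (H_lie_mem_Dspace hy i)
  exact this hx

theorem exists_eq_sub_of_mem_Dlow {δ ε : ℂ} {x : X} (hx : x ∈ Dlow r X δ)
    (hx' : x ∈ Dspace r X ε) (h0 : x ≠ 0) : ∃ n : ℕ, ε = δ - n := by
  by_contra! hne
  have h1 := (Module.End.eigenspaces_iSupIndep (LieModule.toEnd ℂ (so r) X (D r))) ε
  have h2 : Dlow r X δ ≤ ⨆ (μ : ℂ) (_ : μ ≠ ε), Dspace r X μ :=
    iSup_le fun n => le_iSup₂_of_le (δ - n) (hne n).symm le_rfl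
  exact h0 (Submodule.disjoint_def.1 h1 x hx' (h2 hx))

/-- The Lie submodule generated by a singular vector is contained in every subspace that contains
the vector and is stable under all `F_i` and `H_i`. -/
theorem exists_lieSubmodule_le {u : X} (hu : ∀ i, ⁅(E i : so r), u⁆ = 0) {N : Submodule ℂ X}
    (huN : u ∈ N) (hF : ∀ i, ∀ x ∈ N, ⁅(F i : so r), x⁆ ∈ N)
    (hH : ∀ i, ∀ x ∈ N, ⁅(H i : so r), x⁆ ∈ N) :
    ∃ M : LieSubmodule ℂ (so r) X, u ∈ M ∧ M.toSubmodule ≤ N := by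
  let 𝒮 : Set (Submodule ℂ X) := {N | u ∈ N ∧ (∀ i, ∀ x ∈ N, ⁅(F i : so r), x⁆ ∈ N) ∧
    (∀ i, ∀ x ∈ N, ⁅(H i : so r), x⁆ ∈ N)}
  let M : Submodule ℂ X := sInf 𝒮
  have hM : M ∈ 𝒮 := by
    refine ⟨Submodule.mem_sInf.2 fun N hN => hN.1, fun i x hx => ?_, fun i x hx => ?_⟩
    · exact Submodule.mem_sInf.2 fun N hN => hN.2.1 i x (Submodule.mem_sInf.1 hx N hN)
    · exact Submodule.mem_sInf.2 fun N hN => hN.2.2 i x (Submodule.mem_sInf.1 hx N hN)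
  obtain ⟨hM1, hM2, hM3⟩ := hM
  -- Stability of the minimal subspace under `E i` comes for free: the vectors of `M` sent into `M`
  -- by all `E i` again form a subspace in `𝒮`, because `E F = F E + [E, F]` and `[H, E]` is
  -- proportional to `E`. Minimality forces it to be all of `M`.
  have hME : ∀ x ∈ M, ∀ i, ⁅(E i : so r), x⁆ ∈ M := by
    let M' : Submodule ℂ X :=
      M ⊓ ⨅ i, M.comap (LieModule.toEnd ℂ (so r) X (E i))
    have hM' : M' ∈ 𝒮 := by
      have hmem : ∀ x, x ∈ M' ↔ x ∈ M ∧ ∀ i, ⁅(E i : so r), x⁆ ∈ M := fun x => by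
        simp [M', Submodule.mem_iInf]
      refine ⟨(hmem u).2 ⟨hM1, fun i => by rw [hu i]; exact zero_mem _⟩, fun j x hx => ?_,
        fun j x hx => ?_⟩
      · obtain ⟨h1, h2⟩ := (hmem x).1 hx
        refine (hmem _).2 ⟨hM2 j x h1, fun i => ?_⟩
        rw [E_lie_F_lie]
        refine add_mem ?_ (hM2 j _ (h2 i))
        split_ifs
        · exact hM3 i x h1
        · exact zero_mem _
      · obtain ⟨h1, h2⟩ := (hmem x).1 hx
        refine (hmem _).2 ⟨hM3 j x h1, fun i => ?_⟩
        obtain ⟨k, hk⟩ := exists_lie_H_E j i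
        rw [leibniz_lie, ← lie_skew, hk, neg_lie, smul_lie]
        exact add_mem (neg_mem (Submodule.smul_mem _ _ (h2 i))) (hM3 j _ (h2 i))
    intro x hx i
    have : x ∈ M' := Submodule.mem_sInf.1 hx M' hM'
    exact (Submodule.mem_iInf _).1 this.2 i
  -- The stabilizer of `M` is a subalgebra containing the Chevalley generators, hence everything.
  let S : LieSubalgebra ℂ (so r) :=
    { carrier := {y | ∀ x ∈ M, ⁅y, x⁆ ∈ M}
      add_mem' := fun ha hb y hy => by simpa only [add_lie] using add_mem (ha y hy) (hb y hy)
      zero_mem' := fun x _ => by rw [zero_lie]; exact zero_mem _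
      smul_mem' := fun c y hy x hx => by rw [smul_lie]; exact Submodule.smul_mem _ _ (hy x hx)
      lie_mem' := fun {a b} ha hb x hx => by
        rw [lie_lie]; exact sub_mem (ha _ (hb x hx)) (hb _ (ha x hx)) }
  have hS : ∀ y, y ∈ S := eq_top_of_E_F_mem (fun i x hx => hME x hx i) (fun i x hx => hM2 i x hx)
  exact ⟨{ M with lie_mem := fun {y x} hx => hS y x hx }, hM1, sInf_le ⟨huN, hF, hH⟩⟩

theorem exists_lieSubmodule_le_Dlow {u : X} (hu : ∀ i, ⁅(E i : so r), u⁆ = 0) {δ : ℂ}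
    (hD : u ∈ Dspace r X δ) :
    ∃ M : LieSubmodule ℂ (so r) X, u ∈ M ∧ M.toSubmodule ≤ Dlow r X δ :=
  exists_lieSubmodule_le hu (Dspace_le_Dlow δ hD)
    (fun i _ hx => Dlow_sub_one_le δ (F_lie_mem_Dlow hx i)) (fun i _ hx => H_lie_mem_Dlow hx i)

theorem IsHighestWeightVector.mem_Dspace {Λ : Fin r → ℕ} {v : X}
    (hv : IsHighestWeightVector Λ v) : v ∈ Dspace r X (topWeight Λ) :=
  GaudinB.mem_Dspace.2 (lie_D_of_lie_H hv.lie_H)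

/-- This replaces the PBW argument that the top weight occurs once in a highest weight module: every
`F i` lowers the `D`-eigenvalue by one, so only multiples of `v` remain at the top. -/
theorem IsHighestWeightVector.exists_lieSubmodule {Λ : Fin r → ℕ} {v : X}
    (hv : IsHighestWeightVector Λ v) :
    ∃ M : LieSubmodule ℂ (so r) X, v ∈ M ∧
      M.toSubmodule ≤ Submodule.span ℂ {v} ⊔ Dlow r X (topWeight Λ - 1) := by
  have hle : Submodule.span ℂ {v} ≤ Dspace r X (topWeight Λ) := by
    rw [Submodule.span_singleton_le_iff_mem]
    exact hv.mem_Dspace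
  refine exists_lieSubmodule_le hv.lie_E
    (Submodule.mem_sup_left (Submodule.mem_span_singleton_self v)) (fun i x hx => ?_)
    (fun i x hx => ?_)
  · have : x ∈ Dlow r X (topWeight Λ) :=
      sup_le (hle.trans (Dspace_le_Dlow _)) (Dlow_sub_one_le _) hx
    exact Submodule.mem_sup_right (F_lie_mem_Dlow this i)
  · obtain ⟨y, hy, g, hg, rfl⟩ := Submodule.mem_sup.1 hx
    obtain ⟨c, rfl⟩ := Submodule.mem_span_singleton.1 hy
    rw [lie_add, lie_smul, hv.lie_H]
    exact Submodule.add_mem_sup (Submodule.smul_mem _ _ (Submodule.smul_mem _ _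
      (Submodule.mem_span_singleton_self v))) (H_lie_mem_Dlow hg i)

theorem mem_span_of_mem_sup {δ : ℂ} {v x : X} (hv : v ∈ Dspace r X δ)
    (hx : x ∈ Submodule.span ℂ {v} ⊔ Dlow r X (δ - 1)) (hx' : x ∈ Dspace r X δ) :
    ∃ c : ℂ, x = c • v := by
  obtain ⟨y, hy, g, hg, rfl⟩ := Submodule.mem_sup.1 hx
  obtain ⟨c, rfl⟩ := Submodule.mem_span_singleton.1 hy
  refine ⟨c, ?_⟩
  by_contra hne
  have hg0 : g ≠ 0 := fun h => hne (by rw [h, add_zero])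
  have hg' : g ∈ Dspace r X δ :=
    (Submodule.add_mem_iff_right _ (Submodule.smul_mem _ c hv)).1 hx'
  obtain ⟨n, hn⟩ := exists_eq_sub_of_mem_Dlow hg hg' hg0
  have : ((n + 1 : ℕ) : ℂ) = 0 := by push_cast; linear_combination hn
  exact absurd this (Nat.cast_ne_zero.2 (Nat.succ_ne_zero n))

omit [LieModule ℂ (so r) X] in
theorem mem_of_isIrreducible [LieModule.IsIrreducible ℂ (so r) X] {M : LieSubmodule ℂ (so r) X}
    {x : X} (hx : x ∈ M) (hx0 : x ≠ 0) (y : X) : y ∈ M := by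
  rcases eq_bot_or_eq_top M with h | h
  · rw [h, LieSubmodule.mem_bot] at hx
    exact absurd hx hx0
  · rw [h]
    exact LieSubmodule.mem_top y

/-- In an irreducible module all singular vectors that are eigenvectors of `D` are multiples of
the highest weight vector. -/
theorem IsHighestWeightVector.eq_smul_of_singular [LieModule.IsIrreducible ℂ (so r) X]
    {Λ : Fin r → ℕ} {v : X} (hv : IsHighestWeightVector Λ v) {u : X} (hu0 : u ≠ 0)
    (hu : ∀ i, ⁅(E i : so r), u⁆ = 0) {δ : ℂ} (hD : u ∈ Dspace r X δ) :
    δ = topWeight Λ ∧ ∃ c : ℂ, u = c • v := by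
  obtain ⟨M, hM1, hM2⟩ := hv.exists_lieSubmodule
  have hu1 := hM2 (mem_of_isIrreducible hM1 hv.ne_zero u)
  obtain ⟨M', hM1', hM2'⟩ := exists_lieSubmodule_le_Dlow hu hD
  have hv1 := hM2' (mem_of_isIrreducible hM1' hu0 v)
  have hvD := hv.mem_Dspace
  have hu2 : u ∈ Dlow r X (topWeight Λ) := sup_le
    ((Submodule.span_singleton_le_iff_mem _ _).2 (Dspace_le_Dlow _ hvD)) (Dlow_sub_one_le _) hu1
  obtain ⟨n, hn⟩ := exists_eq_sub_of_mem_Dlow hv1 hvD hv.ne_zero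
  obtain ⟨m, hm⟩ := exists_eq_sub_of_mem_Dlow hu2 hD hu0
  -- Each of `u` and `v` generates the whole module, so each lies weakly below the other; the two
  -- depths `n` and `m` add up to zero.
  have h0 : ((n + m : ℕ) : ℂ) = 0 := by push_cast; linear_combination hn + hm
  have hm0 : m = 0 := by have := Nat.cast_eq_zero.1 h0; omega
  have hδ : δ = topWeight Λ := by rw [hm, hm0]; simp
  exact ⟨hδ, mem_span_of_mem_sup hvD hu1 (hδ ▸ hD)⟩

end Weights

/-! ### The vector representation -/

section Vector

variable {r : ℕ}

theorem so_lie_apply (x : so r) (y : Idx r → ℂ) : ⁅x, y⁆ = x.1.mulVec y := rfl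

theorem wedge_lie (p q : Idx r) (y : Idx r → ℂ) :
    ⁅wedge p q, y⁆ = (nrm q * y (bar q)) • Pi.single p 1 - (nrm p * y (bar p)) • Pi.single q 1 := by
  rw [so_lie_apply]
  ext c
  simp [wedge, wedgeMat, Matrix.sub_mulVec, Matrix.single_mulVec,
    Pi.single_apply, Function.update_apply, mul_comm]

theorem isHighestWeightVector_single (hr : 2 ≤ r) {a : Idx r} (ha : ht a = 0) :
    IsHighestWeightVector (omegaOne r) (Pi.single a 1 : Idx r → ℂ) := by
  refine ⟨by simp, fun i => ?_, fun i => ?_⟩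
  · obtain ⟨p, hp⟩ := exists_ht_eq (r := r) (m := i) (by omega)
    obtain ⟨q, hq⟩ := exists_ht_eq (r := r) (m := 2 * r - 1 - i) (by omega)
    rw [E_eq_wedge (b := q) hp (by omega), wedge_lie, Pi.single_eq_of_ne, Pi.single_eq_of_ne]
    · simp
    · rw [ne_comm, Ne, eq_bar_iff_ht]; omega
    · rw [ne_comm, Ne, eq_bar_iff_ht]; omega
  · obtain ⟨p, hp⟩ := exists_ht_eq (r := r) (m := i) (by omega)
    obtain ⟨c, hc⟩ := exists_ht_eq (r := r) (m := i + 1) (by omega)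
    rw [H_eq_wedge hp hc, sub_lie, smul_lie, wedge_lie, wedge_lie, bar_bar, bar_bar,
      Pi.single_eq_of_ne (i := a) (i' := c), Pi.single_eq_of_ne (i := a) (i' := bar c),
      Pi.single_eq_of_ne (i := a) (i' := bar p)]
    · by_cases hi : i.val = 0
      · obtain rfl : p = a := ht_injective (by omega)
        -- Here `2 ≤ r` matters: it keeps `c` away from the middle index. For `r = 1` the label
        -- would be 2 rather than 1.
        rw [nrm_bar, nrm_eq_one (a := p) (by omega), nrm_eq_one (a := c) (by omega)]
        simp [omegaOne, hi]
      · rw [Pi.single_eq_of_ne]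
        · simp [omegaOne, hi]
        · rintro rfl; omega
    · rw [ne_comm, Ne, eq_bar_iff_ht]; omega
    · rw [ne_comm, Ne, eq_bar_iff_ht]; omega
    · rintro rfl; omega

/-- If the coordinate of `y` at `bar a` vanishes, `wedge a (bar c)` extracts any other coordinate
`c` and places it at `a`. Otherwise `wedge a zro` first produces a nonzero vector of that kind. -/
theorem single_mem_of_mem (hr : 1 ≤ r) {K : LieSubmodule ℂ (so r) (Idx r → ℂ)} {y : Idx r → ℂ}
    (hy : y ∈ K) (hy0 : y ≠ 0) {a : Idx r} (ha : ht a = 0) : Pi.single a 1 ∈ K := by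
  have main : ∀ y ∈ K, y ≠ 0 → y (bar a) = 0 → Pi.single a 1 ∈ K := by
    intro y hy hy0 hya
    obtain ⟨c, hc⟩ := Function.ne_iff.1 hy0
    have h := K.lie_mem (x := wedge a (bar c)) hy
    rw [wedge_lie, bar_bar, hya, mul_zero, zero_smul, sub_zero, nrm_bar] at h
    have := K.smul_mem (nrm c * y c)⁻¹ h
    rwa [smul_smul, inv_mul_cancel₀ (mul_ne_zero (nrm_ne_zero c) hc), one_smul] at this
  by_cases h : y (bar a) = 0
  · exact main y hy hy0 h
  · have haz : a ≠ zro := by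
      rintro rfl; rw [ht_zro] at ha; omega
    have hbz : bar a ≠ zro := fun h => haz (by rw [bar_eq_iff] at h; exact h)
    have haa : bar a ≠ a := fun h => by
      rw [eq_comm, eq_bar_iff_ht] at h; omega
    refine main _ (K.lie_mem (x := wedge a zro) hy) ?_ ?_
    · rw [wedge_lie]
      refine Function.ne_iff.2 ⟨zro, ?_⟩
      simp [haz.symm, h, nrm_ne_zero]
    · rw [wedge_lie]
      simp [haa, hbz]

theorem eq_top_of_single_mem (hr : 1 ≤ r) {K : LieSubmodule ℂ (so r) (Idx r → ℂ)} {a : Idx r}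
    (ha : ht a = 0) (hK : Pi.single a 1 ∈ K) (y : Idx r → ℂ) : y ∈ K := by
  have haz : a ≠ zro := by
    rintro rfl; rw [ht_zro] at ha; omega
  have haa : a ≠ bar a := fun h => by
    rw [eq_bar_iff_ht] at h; omega
  have h1 : ∀ p, p ≠ bar a → Pi.single p (1 : ℂ) ∈ K := fun p hp => by
    have h := K.lie_mem (x := wedge p (bar a)) hK
    rw [wedge_lie, bar_bar, Pi.single_eq_same, Pi.single_eq_of_ne (i := a) (i' := bar p)
      (fun h => hp (by rw [← h, bar_bar])), mul_zero, zero_smul, sub_zero, mul_one] at h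
    have := K.smul_mem (nrm (bar a))⁻¹ h
    rwa [smul_smul, inv_mul_cancel₀ (nrm_ne_zero _), one_smul] at this
  have h2 : Pi.single (bar a) (1 : ℂ) ∈ K := by
    have h := K.lie_mem (x := wedge (bar a) zro)
      (h1 zro (fun h => haz (by rw [eq_comm, bar_eq_iff] at h; exact h)))
    rw [wedge_lie, bar_bar, show bar (zro : Idx r) = zro from rfl, Pi.single_eq_same,
      Pi.single_eq_of_ne haz, mul_zero, zero_smul, sub_zero, mul_one] at h
    have := K.smul_mem (nrm (zro : Idx r))⁻¹ h
    rwa [smul_smul, inv_mul_cancel₀ (nrm_ne_zero _), one_smul] at this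
  rw [show y = ∑ p, y p • Pi.single p (1 : ℂ) by ext; simp [Pi.single_apply]]
  refine sum_mem fun p _ => K.smul_mem _ ?_
  by_cases hp : p = bar a
  · rwa [hp]
  · exact h1 p hp

variable {W : Type*} [AddCommGroup W] [Module ℂ W] [LieRingModule (so r) W] [LieModule ℂ (so r) W]

variable (W) in
/-- The direct sum of a module and the vector representation. -/
abbrev prodLieRingModule : LieRingModule (so r) (W × (Idx r → ℂ)) where
  bracket x p := (⁅x, p.1⁆, ⁅x, p.2⁆)
  add_lie x y p := Prod.ext (add_lie x y p.1) (add_lie x y p.2)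
  lie_add x p q := Prod.ext (lie_add x p.1 q.1) (lie_add x p.2 q.2)
  leibniz_lie x y p := Prod.ext (leibniz_lie x y p.1) (leibniz_lie x y p.2)

attribute [local instance] prodLieRingModule

variable (W) in
theorem prodLieModule : LieModule ℂ (so r) (W × (Idx r → ℂ)) where
  smul_lie c x p := Prod.ext (smul_lie c x p.1) (smul_lie c x p.2)
  lie_smul c x p := Prod.ext (lie_smul c x p.1) (lie_smul c x p.2)

attribute [local instance] prodLieModule

/-- The irreducible module with highest weight `ω_1` is the vector representation. -/
theorem exists_basis_of_omegaOne (hr : 2 ≤ r) [LieModule.IsIrreducible ℂ (so r) W] {w : W}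
    (hw : IsHighestWeightVector (omegaOne r) w) :
    ∃ b : Module.Basis (Idx r) ℂ W, (∀ (x : so r) a, ⁅x, b a⁆ = ∑ c, x.1 c a • b c) ∧
      ∀ a, ht a = 0 → b a = w := by
  obtain ⟨a, ha⟩ := exists_ht_eq (r := r) (m := 0) (by omega)
  have he := isHighestWeightVector_single hr ha
  set e : Idx r → ℂ := Pi.single a 1 with he_def
  have hp : IsHighestWeightVector (omegaOne r) ((w, e) : W × (Idx r → ℂ)) :=
    ⟨fun h => hw.ne_zero (congrArg Prod.fst h),
      fun i => Prod.ext (hw.lie_E i) (he.lie_E i), fun i => Prod.ext (hw.lie_H i) (he.lie_H i)⟩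
  -- The submodule generated by the diagonal vector `(w, e)` will turn out to be the graph of an
  -- isomorphism between `W` and the vector representation. Its top `D`-eigenspace is the line
  -- through `(w, e)`, so it contains neither `(w, 0)` nor `(0, e)`.
  obtain ⟨M, hM1, hM2⟩ := hp.exists_lieSubmodule
  have hD : ∀ x : W × (Idx r → ℂ), x ∈ M → x ∈ Dspace r _ (topWeight (omegaOne r)) →
      ∃ c : ℂ, x = c • (w, e) := fun x hx hxD => mem_span_of_mem_sup hp.mem_Dspace (hM2 hx) hxD
  have hwM : ((w, 0) : W × (Idx r → ℂ)) ∉ M := fun h => by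
    obtain ⟨c, hc⟩ := hD _ h (mem_Dspace.2 (Prod.ext (mem_Dspace.1 hw.mem_Dspace) (by
      change ⁅D r, (0 : Idx r → ℂ)⁆ = _; simp)))
    have h2 : (0 : Idx r → ℂ) = c • e := congrArg Prod.snd hc
    have h1 : w = c • w := congrArg Prod.fst hc
    rcases smul_eq_zero.1 h2.symm with h | h
    · rw [h, zero_smul] at h1; exact hw.ne_zero h1
    · exact he.ne_zero h
  have heM : ((0, e) : W × (Idx r → ℂ)) ∉ M := fun h => by
    obtain ⟨c, hc⟩ := hD _ h (mem_Dspace.2 (Prod.ext (by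
      change ⁅D r, (0 : W)⁆ = _; simp) (mem_Dspace.1 he.mem_Dspace)))
    have h2 : e = c • e := congrArg Prod.snd hc
    have h1 : (0 : W) = c • w := congrArg Prod.fst hc
    rcases smul_eq_zero.1 h1.symm with h | h
    · rw [h, zero_smul] at h2; exact he.ne_zero h2
    · exact hw.ne_zero h
  -- The intersections of `M` with the two summands are zero and its projections are onto, since
  -- either summand is generated by each of its nonzero vectors.
  let K1 : LieSubmodule ℂ (so r) W :=
    { M.toSubmodule.comap (LinearMap.inl ℂ W (Idx r → ℂ)) with
      lie_mem := fun {x m} hm => by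
        have := M.lie_mem (x := x) (m := (m, 0)) hm
        rwa [show ⁅x, ((m, 0) : W × (Idx r → ℂ))⁆ = (⁅x, m⁆, 0) from
          Prod.ext rfl (lie_zero x)] at this }
  let K2 : LieSubmodule ℂ (so r) (Idx r → ℂ) :=
    { M.toSubmodule.comap (LinearMap.inr ℂ W (Idx r → ℂ)) with
      lie_mem := fun {x m} hm => by
        have := M.lie_mem (x := x) (m := (0, m)) hm
        rwa [show ⁅x, ((0, m) : W × (Idx r → ℂ))⁆ = (0, ⁅x, m⁆) from
          Prod.ext (lie_zero x) rfl] at this }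
  let I1 : LieSubmodule ℂ (so r) W :=
    { M.toSubmodule.map (LinearMap.fst ℂ W (Idx r → ℂ)) with
      lie_mem := fun {x m} hm => by
        obtain ⟨y, hy, rfl⟩ := hm
        exact ⟨⁅x, y⁆, M.lie_mem hy, rfl⟩ }
  let I2 : LieSubmodule ℂ (so r) (Idx r → ℂ) :=
    { M.toSubmodule.map (LinearMap.snd ℂ W (Idx r → ℂ)) with
      lie_mem := fun {x m} hm => by
        obtain ⟨y, hy, rfl⟩ := hm
        exact ⟨⁅x, y⁆, M.lie_mem hy, rfl⟩ }
  have hK1 : ∀ y : W, (y, 0) ∈ M → y = 0 := fun y hy => by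
    by_contra h0
    exact hwM (mem_of_isIrreducible (M := K1) (x := y) hy h0 w)
  have hK2 : ∀ y : Idx r → ℂ, (0, y) ∈ M → y = 0 := fun y hy => by
    by_contra h0
    exact heM (single_mem_of_mem (by omega) (K := K2) (y := y) hy h0 ha)
  have hI1 : ∀ y : W, ∃ z, (y, z) ∈ M := fun y => by
    obtain ⟨⟨y', z⟩, h, rfl⟩ := mem_of_isIrreducible (M := I1) (x := w) ⟨_, hM1, rfl⟩ hw.ne_zero y
    exact ⟨z, h⟩
  have hI2 : ∀ z : Idx r → ℂ, ∃ y, (y, z) ∈ M := fun z => by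
    obtain ⟨⟨y, z'⟩, h, rfl⟩ := eq_top_of_single_mem (by omega) (K := I2) ha ⟨_, hM1, rfl⟩ z
    exact ⟨y, h⟩
  let f1 : M.toSubmodule →ₗ[ℂ] W := LinearMap.fst ℂ W (Idx r → ℂ) ∘ₗ M.toSubmodule.subtype
  let f2 : M.toSubmodule →ₗ[ℂ] (Idx r → ℂ) :=
    LinearMap.snd ℂ W (Idx r → ℂ) ∘ₗ M.toSubmodule.subtype
  have hf1 : Function.Bijective f1 := by
    refine ⟨(injective_iff_map_eq_zero f1).2 ?_, fun y => ?_⟩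
    · rintro ⟨⟨y, z⟩, hyz⟩ (rfl : y = 0)
      exact Subtype.ext (Prod.ext rfl (hK2 z hyz))
    · obtain ⟨z, hz⟩ := hI1 y
      exact ⟨⟨_, hz⟩, rfl⟩
  have hf2 : Function.Bijective f2 := by
    refine ⟨(injective_iff_map_eq_zero f2).2 ?_, fun z => ?_⟩
    · rintro ⟨⟨y, z⟩, hyz⟩ (rfl : z = 0)
      exact Subtype.ext (Prod.ext (hK1 y hyz) rfl)
    · obtain ⟨y, hy⟩ := hI2 z
      exact ⟨⟨_, hy⟩, rfl⟩
  let ψ : W ≃ₗ[ℂ] (Idx r → ℂ) :=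
    (LinearEquiv.ofBijective f1 hf1).symm.trans (LinearEquiv.ofBijective f2 hf2)
  have hψ : ∀ y z, (y, z) ∈ M → ψ.symm z = y := fun y z h => by
    rw [LinearEquiv.symm_apply_eq]
    have : (LinearEquiv.ofBijective f1 hf1).symm y = ⟨(y, z), h⟩ := by
      rw [LinearEquiv.symm_apply_eq]; rfl
    simp only [ψ, LinearEquiv.trans_apply, this]
    rfl
  have hψM : ∀ z, (ψ.symm z, z) ∈ M := fun z => by
    obtain ⟨y, hy⟩ := hI2 z
    rwa [hψ y z hy]
  refine ⟨Module.Basis.ofEquivFun ψ, fun x c => ?_, fun c hc => ?_⟩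
  · simp only [Module.Basis.coe_ofEquivFun]
    have h := M.lie_mem (x := x) (hψM (Pi.single c 1))
    rw [← hψ _ _ h]
    simp only [← map_smul, ← map_sum]
    congr 1
    change x.1.mulVec _ = _
    ext d
    simp [Pi.single_apply]
  · obtain rfl : c = a := ht_injective (by omega)
    simp only [Module.Basis.coe_ofEquivFun]
    exact hψ _ _ hM1

end Vector

/-! ### Sums over orderings of finite sets -/

section Orderings

variable {α : Type*} [DecidableEq α] {β : Type*} [AddCommMonoid β]

/-- All lists that enumerate a finite set without repetition. -/
def orderings (S : Finset α) : Finset (List α) := S.toList.permutations.toFinset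

theorem mem_orderings {S : Finset α} {L : List α} :
    L ∈ orderings S ↔ L.Nodup ∧ L.toFinset = S := by
  rw [orderings, List.mem_toFinset, List.mem_permutations]
  constructor
  · intro h
    exact ⟨h.nodup_iff.2 S.nodup_toList, by
      rw [List.toFinset_eq_of_perm _ _ h, Finset.toList_toFinset]⟩
  · rintro ⟨h1, rfl⟩
    exact (List.toFinset_toList h1).symm

theorem length_of_mem_orderings {S : Finset α} {L : List α} (h : L ∈ orderings S) :
    L.length = S.card := by
  obtain ⟨h1, rfl⟩ := mem_orderings.1 h
  rw [List.toFinset_card_of_nodup h1]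

theorem orderings_empty : orderings (∅ : Finset α) = {[]} := by
  simp [orderings]

theorem sum_orderings_of_nonempty {S : Finset α} (hS : S.Nonempty) (f : List α → β) :
    ∑ L ∈ orderings S, f L = ∑ a ∈ S, ∑ L ∈ orderings (S.erase a), f (a :: L) := by
  rw [Finset.sum_sigma']
  symm
  refine Finset.sum_bij (fun p _ => p.1 :: p.2) ?_ ?_ ?_ ?_
  · rintro ⟨a, L⟩ h
    obtain ⟨ha, hL⟩ := Finset.mem_sigma.1 h
    obtain ⟨h1, h2⟩ := mem_orderings.1 hL
    refine mem_orderings.2 ⟨List.nodup_cons.2 ⟨fun h => ?_, h1⟩, ?_⟩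
    · have := List.mem_toFinset.2 h
      rw [h2] at this
      exact Finset.notMem_erase a S this
    · rw [List.toFinset_cons, h2, Finset.insert_erase ha]
  · rintro ⟨a, L⟩ _ ⟨a', L'⟩ _ h
    obtain ⟨rfl, rfl⟩ := List.cons.inj h
    rfl
  · intro L hL
    obtain ⟨h1, h2⟩ := mem_orderings.1 hL
    cases L with
    | nil => rw [← h2] at hS; simp at hS
    | cons a L =>
      have h1' := List.nodup_cons.1 h1
      refine ⟨⟨a, L⟩, Finset.mem_sigma.2 ⟨by rw [← h2]; simp, mem_orderings.2 ⟨h1'.2, ?_⟩⟩, rfl⟩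
      rw [← h2, List.toFinset_cons, Finset.erase_insert]
      simpa using h1'.1
  · intros; rfl

/-- An ordering together with a cut amounts to a subset with an ordering of it and an ordering of
its complement. This makes the weight function a convolution over subsets. -/
theorem sum_orderings_take_drop (S : Finset α) (g : List α → List α → β) :
    ∑ j ∈ Finset.range (S.card + 1), ∑ L ∈ orderings S, g (L.take j) (L.drop j) =
      ∑ T ∈ S.powerset, ∑ L ∈ orderings T, ∑ M ∈ orderings (S \ T), g L M := by
  simp only [Finset.sum_sigma']
  refine Finset.sum_bij' (fun p _ => ⟨(p.2.take p.1).toFinset, p.2.take p.1, p.2.drop p.1⟩)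
    (fun q _ => ⟨q.2.1.length, q.2.1 ++ q.2.2⟩) ?_ ?_ ?_ ?_ ?_
  · rintro ⟨j, L⟩ h
    obtain ⟨hj, hL⟩ := Finset.mem_sigma.1 h
    obtain ⟨h1, rfl⟩ := mem_orderings.1 hL
    have h1' := h1
    rw [← List.take_append_drop j L, List.nodup_append'] at h1'
    simp only [Finset.mem_sigma, Finset.mem_powerset, mem_orderings]
    refine ⟨fun x hx => ?_, ⟨h1'.1, trivial⟩, h1'.2.1, ?_⟩
    · rw [List.mem_toFinset] at hx ⊢
      exact List.mem_of_mem_take hx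
    · ext x
      simp only [Finset.mem_sdiff, List.mem_toFinset]
      constructor
      · exact fun hx => ⟨List.mem_of_mem_drop hx, fun hx' => h1'.2.2 hx' hx⟩
      · rintro ⟨hx, hx'⟩
        rw [← List.take_append_drop j L, List.mem_append] at hx
        exact hx.resolve_left hx'
  · rintro ⟨T, L, M⟩ h
    simp only [Finset.mem_sigma, Finset.mem_powerset, mem_orderings] at h
    obtain ⟨h1, ⟨h2, rfl⟩, h3, h4⟩ := h
    have hd : Disjoint L.toFinset M.toFinset := by
      rw [h4]; exact Finset.disjoint_sdiff
    simp only [Finset.mem_sigma, Finset.mem_range, mem_orderings]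
    refine ⟨?_, ?_, ?_⟩
    · have := Finset.card_le_card h1
      rw [List.toFinset_card_of_nodup h2] at this
      omega
    · rw [List.nodup_append']
      exact ⟨h2, h3, List.disjoint_toFinset_iff_disjoint.1 hd⟩
    · rw [List.toFinset_append, h4, Finset.union_sdiff_of_subset h1]
  · rintro ⟨j, L⟩ h
    obtain ⟨hj, hL⟩ := Finset.mem_sigma.1 h
    have := length_of_mem_orderings hL
    replace hj := Finset.mem_range.1 hj
    simp only at hj hL this
    simp only [List.take_append_drop, List.length_take, show min j L.length = j by omega]
  · rintro ⟨T, L, M⟩ h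
    simp only [Finset.mem_sigma, Finset.mem_powerset, mem_orderings] at h
    obtain ⟨h1, ⟨h2, rfl⟩, h3, h4⟩ := h
    simp
  · intros; rfl

theorem sum_equiv_ofFn [Fintype α] (f : List α → β) :
    ∑ σ : Fin (Fintype.card α) ≃ α, f (List.ofFn σ) = ∑ L ∈ orderings Finset.univ, f L := by
  refine Finset.sum_bij (fun σ _ => List.ofFn σ) ?_ ?_ ?_ ?_
  · intro σ _
    refine mem_orderings.2 ⟨List.nodup_ofFn.2 σ.injective, ?_⟩
    ext x
    simpa using σ.surjective x
  · intro σ _ τ _ h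
    exact DFunLike.coe_injective (List.ofFn_injective h)
  · intro L hL
    have hlen := length_of_mem_orderings hL
    obtain ⟨h1, h2⟩ := mem_orderings.1 hL
    have h3 : ∀ x, x ∈ L := fun x => by rw [← List.mem_toFinset, h2]; exact Finset.mem_univ x
    rw [Finset.card_univ] at hlen
    refine ⟨(finCongr hlen.symm).trans (h1.getEquivOfForallMemList L h3), Finset.mem_univ _, ?_⟩
    refine List.ext_getElem (by simp [hlen]) fun n h4 h5 => ?_
    simp
  · intros; rfl

end Orderings

/-! ### Weight functions of a single module -/

section SingleModule

variable {r : ℕ} {l : Fin r → ℕ} {X : Type*} [AddCommGroup X] [Module ℂ X]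
  [LieRingModule (so r) X]

/-- The entry `⟨α_j, α_i^∨⟩` of the Cartan matrix. -/
def cart (i j : Fin r) : ℂ := (rootPairing i j : ℂ) / (symm i : ℂ)

/-- `1 / ((x - t_{a_1}) (t_{a_1} - t_{a_2}) ⋯ (t_{a_j} - z))`. -/
def chainFrom (t : Var l → ℂ) (z : ℂ) : ℂ → List (Var l) → ℂ
  | x, [] => (x - z)⁻¹
  | x, a :: L => (x - t a)⁻¹ * chainFrom t z (t a) L

theorem chain_cons (t : Var l → ℂ) (z : ℂ) (a : Var l) (L : List (Var l)) :
    chain t z (a :: L) = chainFrom t z (t a) L := by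
  induction L generalizing a with
  | nil => rfl
  | cons b L ih => rw [chain, ih, chainFrom]

/-- The weight function of a single module with a further variable `x` on the left. -/
def partialFrom (t : Var l → ℂ) (z : ℂ) (v : X) (S : Finset (Var l)) (x : ℂ) : X :=
  ∑ L ∈ orderings S, chainFrom t z x L • applyF L v

/-- The weight function of a single module for the set `S` of variables. -/
def partialWeight (t : Var l → ℂ) (z : ℂ) (v : X) (S : Finset (Var l)) : X :=
  ∑ L ∈ orderings S, chain t z L • applyF L v

theorem partialFrom_empty (t : Var l → ℂ) (z : ℂ) (v : X) (x : ℂ) :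
    partialFrom t z v ∅ x = (x - z)⁻¹ • v := by
  simp [partialFrom, orderings_empty, chainFrom, applyF]

theorem partialWeight_empty (t : Var l → ℂ) (z : ℂ) (v : X) : partialWeight t z v ∅ = v := by
  simp [partialWeight, orderings_empty, chain, applyF]

variable [LieModule ℂ (so r) X]

theorem partialFrom_of_nonempty (t : Var l → ℂ) (z : ℂ) (v : X) {S : Finset (Var l)}
    (hS : S.Nonempty) (x : ℂ) : partialFrom t z v S x =
      ∑ a ∈ S, (x - t a)⁻¹ • ⁅(F a.1 : so r), partialFrom t z v (S.erase a) (t a)⁆ := by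
  rw [partialFrom, sum_orderings_of_nonempty hS]
  refine Finset.sum_congr rfl fun a _ => ?_
  rw [partialFrom, lie_sum, Finset.smul_sum]
  refine Finset.sum_congr rfl fun L _ => ?_
  rw [chainFrom, lie_smul, smul_smul]
  rfl

theorem partialWeight_of_nonempty (t : Var l → ℂ) (z : ℂ) (v : X) {S : Finset (Var l)}
    (hS : S.Nonempty) : partialWeight t z v S =
      ∑ a ∈ S, ⁅(F a.1 : so r), partialFrom t z v (S.erase a) (t a)⁆ := by
  rw [partialWeight, sum_orderings_of_nonempty hS]
  refine Finset.sum_congr rfl fun a _ => ?_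
  rw [partialFrom, lie_sum]
  refine Finset.sum_congr rfl fun L _ => ?_
  rw [chain_cons, lie_smul]
  rfl

theorem applyF_mem_Dspace {δ : ℂ} {v : X} (hv : v ∈ Dspace r X δ) (L : List (Var l)) :
    applyF L v ∈ Dspace r X (δ - L.length) := by
  induction L with
  | nil => simpa [applyF] using hv
  | cons a L ih =>
    have := F_lie_mem_Dspace ih a.1
    rw [sub_sub] at this
    simpa [applyF] using this

theorem partialWeight_mem_Dspace {δ : ℂ} {v : X} (hv : v ∈ Dspace r X δ) (t : Var l → ℂ) (z : ℂ)
    (S : Finset (Var l)) : partialWeight t z v S ∈ Dspace r X (δ - S.card) := by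
  refine sum_mem fun L hL => Submodule.smul_mem _ _ ?_
  rw [← length_of_mem_orderings hL]
  exact applyF_mem_Dspace hv L

/-- The value of `H_i` on the vectors `F_L v` for orderings `L` of the set `S`. -/
def hCoeff (Λ : Fin r → ℕ) (i : Fin r) (S : Finset (Var l)) : ℂ := Λ i - ∑ b ∈ S, cart i b.1

/-- The left side of the Bethe ansatz equation of the variable `a` for a single module. -/
def kCoeff (t : Var l → ℂ) (z : ℂ) (Λ : Fin r → ℕ) (a : Var l) (S : Finset (Var l)) : ℂ :=
  Λ a.1 / (t a - z) - ∑ b ∈ S, cart a.1 b.1 / (t a - t b)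

theorem H_lie_applyF {Λ : Fin r → ℕ} {v : X} {i : Fin r} (hv : ⁅(H i : so r), v⁆ = (Λ i : ℂ) • v)
    (L : List (Var l)) :
    ⁅(H i : so r), applyF L v⁆ = ((Λ i : ℂ) - (L.map fun b => cart i b.1).sum) • applyF L v := by
  induction L with
  | nil => simpa [applyF] using hv
  | cons a L ih =>
    change ⁅(H i : so r), ⁅(F a.1 : so r), applyF L v⁆⁆ = _ • ⁅(F a.1 : so r), applyF L v⁆
    rw [leibniz_lie, lie_H_F, ih, smul_lie, lie_smul, List.map_cons, List.sum_cons, cart]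
    module

theorem H_lie_partialFrom {Λ : Fin r → ℕ} {v : X} {i : Fin r}
    (hv : ⁅(H i : so r), v⁆ = (Λ i : ℂ) • v) (t : Var l → ℂ) (z : ℂ) (S : Finset (Var l)) (x : ℂ) :
    ⁅(H i : so r), partialFrom t z v S x⁆ = hCoeff Λ i S • partialFrom t z v S x := by
  rw [partialFrom, lie_sum, Finset.smul_sum]
  refine Finset.sum_congr rfl fun L hL => ?_
  obtain ⟨h1, rfl⟩ := mem_orderings.1 hL
  rw [lie_smul, H_lie_applyF hv, smul_comm, hCoeff, List.sum_toFinset _ h1]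

theorem hCoeff_erase (Λ : Fin r → ℕ) (i : Fin r) {S : Finset (Var l)} {b : Var l} (hb : b ∈ S) :
    hCoeff Λ i (S.erase b) = hCoeff Λ i S + cart i b.1 := by
  rw [hCoeff, hCoeff, ← Finset.add_sum_erase S _ hb]
  ring

theorem kCoeff_erase (t : Var l → ℂ) (z : ℂ) (Λ : Fin r → ℕ) (a : Var l) {S : Finset (Var l)}
    {b : Var l} (hb : b ∈ S) :
    kCoeff t z Λ a (S.erase b) = kCoeff t z Λ a S + cart a.1 b.1 / (t a - t b) := by
  rw [kCoeff, kCoeff, ← Finset.add_sum_erase S _ hb]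
  ring

/-- This is the rational function identity behind the action of `E_i`. The right side collects what
arises when `a` is placed directly after `x` and `E i` meets `F a.1`, or when it is placed further
to the right, behind some first letter `b`. Comparing coefficients of each first letter leaves
partial fractions in `x`, `t a`, `t b`. -/
theorem insert_smul_partialFrom {t : Var l → ℂ} {z : ℂ} (Λ : Fin r → ℕ) (v : X) {a : Var l}
    {S : Finset (Var l)} {x : ℂ} (ht : ∀ b ∈ S, t a ≠ t b) (hz : t a ≠ z) (hxa : x ≠ t a)
    (hxz : x ≠ z) (hxS : ∀ b ∈ S, x ≠ t b) :
    (kCoeff t z Λ a S + hCoeff Λ a.1 S / (x - t a)) • partialFrom t z v S x =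
      (hCoeff Λ a.1 S / (x - t a)) • partialFrom t z v S (t a) +
      ∑ b ∈ S, ((x - t b)⁻¹ * (kCoeff t z Λ a (S.erase b) +
        hCoeff Λ a.1 (S.erase b) / (t b - t a))) •
          ⁅(F b.1 : so r), partialFrom t z v (S.erase b) (t b)⁆ := by
  have hxa' := sub_ne_zero.2 hxa
  have hxz' := sub_ne_zero.2 hxz
  have hz' := sub_ne_zero.2 hz
  rcases S.eq_empty_or_nonempty with rfl | hS
  · simp only [partialFrom_empty, kCoeff, hCoeff, Finset.sum_empty, sub_zero, add_zero, smul_smul]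
    congr 1
    field_simp
    ring
  · rw [partialFrom_of_nonempty t z v hS x, partialFrom_of_nonempty t z v hS (t a),
      Finset.smul_sum, Finset.smul_sum, ← Finset.sum_add_distrib]
    refine Finset.sum_congr rfl fun b hb => ?_
    rw [smul_smul, smul_smul, ← add_smul, hCoeff_erase Λ _ hb, kCoeff_erase t z Λ a hb]
    congr 1
    have h1 := sub_ne_zero.2 (ht b hb)
    have h2 := sub_ne_zero.2 (ht b hb).symm
    have h3 := sub_ne_zero.2 (hxS b hb)
    field_simp
    ring

/-- The version without a left neighbour: formally the preceding identity multiplied by `x`, in the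
limit `x → ∞`. -/
theorem insert_smul_partialWeight {t : Var l → ℂ} {z : ℂ} (Λ : Fin r → ℕ) (v : X) {a : Var l}
    {S : Finset (Var l)} (ht : ∀ b ∈ S, t a ≠ t b) (hz : t a ≠ z) :
    kCoeff t z Λ a S • partialWeight t z v S =
      hCoeff Λ a.1 S • partialFrom t z v S (t a) +
      ∑ b ∈ S, (kCoeff t z Λ a (S.erase b) + hCoeff Λ a.1 (S.erase b) / (t b - t a)) •
          ⁅(F b.1 : so r), partialFrom t z v (S.erase b) (t b)⁆ := by
  have hz' := sub_ne_zero.2 hz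
  rcases S.eq_empty_or_nonempty with rfl | hS
  · simp only [partialFrom_empty, partialWeight_empty, kCoeff, hCoeff, Finset.sum_empty, sub_zero,
      add_zero, smul_smul]
    congr 1
  · rw [partialFrom_of_nonempty t z v hS (t a), partialWeight_of_nonempty t z v hS,
      Finset.smul_sum, Finset.smul_sum, ← Finset.sum_add_distrib]
    refine Finset.sum_congr rfl fun b hb => ?_
    rw [smul_smul, ← add_smul, hCoeff_erase Λ _ hb, kCoeff_erase t z Λ a hb]
    congr 1
    have h1 := sub_ne_zero.2 (ht b hb)
    have h2 := sub_ne_zero.2 (ht b hb).symm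
    field_simp
    ring

theorem sum_filter_erase_comm {β : Type*} [AddCommMonoid β] (S : Finset (Var l)) (i : Fin r)
    (f : Var l → Var l → β) :
    ∑ b ∈ S, ∑ a ∈ S.erase b with a.1 = i, f a b =
      ∑ a ∈ S with a.1 = i, ∑ b ∈ S.erase a, f a b := by
  refine Finset.sum_comm' fun b a => ?_
  simp only [Finset.mem_filter, Finset.mem_erase]
  tauto

/-- The inductive step shared by both kinds of weight function: `c` is the factor linking the first
letter to its left neighbour (or 1), and `k` holds the coefficients known for smaller sets. The
double sum is reordered so that the deleted variable `a` comes first. -/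
theorem E_lie_sum_F_lie {Λ : Fin r → ℕ} {v : X} {i : Fin r}
    (hH : ⁅(H i : so r), v⁆ = (Λ i : ℂ) • v) (t : Var l → ℂ) (z : ℂ) (S : Finset (Var l))
    (c : Var l → ℂ) (k : Var l → Var l → ℂ)
    (hk : ∀ b ∈ S, ⁅(E i : so r), partialFrom t z v (S.erase b) (t b)⁆ =
      ∑ a ∈ S.erase b with a.1 = i, k a b • partialFrom t z v ((S.erase a).erase b) (t b)) :
    ⁅(E i : so r), ∑ a ∈ S, c a • ⁅(F a.1 : so r), partialFrom t z v (S.erase a) (t a)⁆⁆ =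
      ∑ a ∈ S with a.1 = i,
        ((c a * hCoeff Λ i (S.erase a)) • partialFrom t z v (S.erase a) (t a) +
        ∑ b ∈ S.erase a, (c b * k a b) •
          ⁅(F b.1 : so r), partialFrom t z v ((S.erase a).erase b) (t b)⁆) := by
  rw [lie_sum, Finset.sum_add_distrib, ← sum_filter_erase_comm, Finset.sum_filter,
    ← Finset.sum_add_distrib]
  refine Finset.sum_congr rfl fun a ha => ?_
  rw [lie_smul, E_lie_F_lie, smul_add, H_lie_partialFrom hH, smul_ite, smul_smul, smul_zero,
    hk a ha, lie_sum, Finset.smul_sum]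
  congr 1
  refine Finset.sum_congr rfl fun b _ => ?_
  rw [lie_smul, smul_smul]

/-- The left neighbour `x` has to be carried through the induction; it contributes the extra term
with `hCoeff`, which is absent for `partialWeight`. -/
theorem E_lie_partialFrom {t : Var l → ℂ} (ht : Function.Injective t) {z : ℂ}
    (hz : ∀ a, t a ≠ z) {Λ : Fin r → ℕ} {v : X} {i : Fin r} (hE : ⁅(E i : so r), v⁆ = 0)
    (hH : ⁅(H i : so r), v⁆ = (Λ i : ℂ) • v) (S : Finset (Var l)) :
    ∀ x : ℂ, x ≠ z → (∀ a ∈ S, x ≠ t a) → ⁅(E i : so r), partialFrom t z v S x⁆ =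
      ∑ a ∈ S with a.1 = i, (kCoeff t z Λ a (S.erase a) + hCoeff Λ a.1 (S.erase a) / (x - t a)) •
        partialFrom t z v (S.erase a) x := by
  induction S using Finset.strongInduction with
  | H S ih =>
    intro x hxz hxS
    rcases S.eq_empty_or_nonempty with rfl | hS
    · simp [partialFrom_empty, hE]
    · rw [partialFrom_of_nonempty t z v hS, E_lie_sum_F_lie hH t z S _
        (fun a b => kCoeff t z Λ a ((S.erase a).erase b) +
          hCoeff Λ a.1 ((S.erase a).erase b) / (t b - t a)) fun b hb => ?_]
      · refine Finset.sum_congr rfl fun a ha => ?_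
        obtain ⟨haS, rfl⟩ := Finset.mem_filter.1 ha
        rw [insert_smul_partialFrom Λ v (fun b hb h => Finset.ne_of_mem_erase hb (ht h).symm)
          (hz a) (hxS a haS) hxz (fun b hb => hxS b (Finset.mem_of_mem_erase hb)), div_eq_inv_mul]
      · rw [ih (S.erase b) (Finset.erase_ssubset hb) (t b) (hz b)
          (fun a ha h => Finset.ne_of_mem_erase ha (ht h).symm)]
        exact Finset.sum_congr rfl fun a _ => by rw [Finset.erase_right_comm]

/-- The action of `E_i` on the weight function of a single module. -/
theorem E_lie_partialWeight {t : Var l → ℂ} (ht : Function.Injective t) {z : ℂ}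
    (hz : ∀ a, t a ≠ z) {Λ : Fin r → ℕ} {v : X} {i : Fin r} (hE : ⁅(E i : so r), v⁆ = 0)
    (hH : ⁅(H i : so r), v⁆ = (Λ i : ℂ) • v) (S : Finset (Var l)) :
    ⁅(E i : so r), partialWeight t z v S⁆ =
      ∑ a ∈ S with a.1 = i, kCoeff t z Λ a (S.erase a) • partialWeight t z v (S.erase a) := by
  rcases S.eq_empty_or_nonempty with rfl | hS
  · simp [partialWeight_empty, hE]
  · have h := E_lie_sum_F_lie hH t z S (fun _ => 1)
      (fun a b => kCoeff t z Λ a ((S.erase a).erase b) +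
        hCoeff Λ a.1 ((S.erase a).erase b) / (t b - t a)) fun b hb => by
      rw [E_lie_partialFrom ht hz hE hH (S.erase b) (t b) (hz b)
        (fun a ha h => Finset.ne_of_mem_erase ha (ht h).symm)]
      exact Finset.sum_congr rfl fun a _ => by rw [Finset.erase_right_comm]
    simp only [one_smul, one_mul] at h
    rw [partialWeight_of_nonempty t z v hS, h]
    refine Finset.sum_congr rfl fun a ha => ?_
    obtain ⟨haS, rfl⟩ := Finset.mem_filter.1 ha
    rw [insert_smul_partialWeight Λ v (fun b hb h => Finset.ne_of_mem_erase hb (ht h).symm) (hz a)]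

end SingleModule

/-! ### Singularity of the weight function in the tensor product. -/

section TensorProduct

variable {r : ℕ} {l : Fin r → ℕ} {V W : Type*}
  [AddCommGroup V] [Module ℂ V] [LieRingModule (so r) V] [LieModule ℂ (so r) V]
  [AddCommGroup W] [Module ℂ W] [LieRingModule (so r) W] [LieModule ℂ (so r) W]

omit [LieModule ℂ (so r) V] [LieModule ℂ (so r) W] in
theorem weightFunction_eq_sum (z : Fin 2 → ℂ) (v : V) (w : W) (t : Var l → ℂ) :
    weightFunction z v w t = ∑ T ∈ Finset.univ.powerset,
      partialWeight t (z 0) v T ⊗ₜ[ℂ] partialWeight t (z 1) w (Finset.univ \ T) := by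
  let g : List (Var l) → List (Var l) → V ⊗[ℂ] W := fun L M =>
    (chain t (z 0) L * chain t (z 1) M) • (applyF L v ⊗ₜ[ℂ] applyF M w)
  have h1 : weightFunction z v w t = ∑ j ∈ Finset.range (Fintype.card (Var l) + 1),
      ∑ L ∈ orderings Finset.univ, g (L.take j) (L.drop j) := by
    rw [weightFunction, Finset.sum_range]
    refine Finset.sum_congr rfl fun j _ => ?_
    exact sum_equiv_ofFn fun L => g (L.take j) (L.drop j)
  rw [h1, ← Finset.card_univ, sum_orderings_take_drop]
  refine Finset.sum_congr rfl fun T _ => ?_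
  rw [partialWeight, partialWeight, TensorProduct.sum_tmul]
  refine Finset.sum_congr rfl fun L _ => ?_
  rw [TensorProduct.tmul_sum]
  refine Finset.sum_congr rfl fun M _ => ?_
  rw [TensorProduct.smul_tmul_smul]

/-- If two families of vectors satisfy the same relations as the weight functions of single
modules, then the sum of their products is singular at solutions of the Bethe ansatz equation. -/
theorem E_lie_sum_tmul_eq_zero {t : Var l → ℂ} {z : Fin 2 → ℂ} {Λ : Fin 2 → Fin r → ℕ} {i : Fin r}
    {f : Finset (Var l) → V} {g : Finset (Var l) → W}
    (hf : ∀ S, ⁅(E i : so r), f S⁆ =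
      ∑ a ∈ S with a.1 = i, kCoeff t (z 0) (Λ 0) a (S.erase a) • f (S.erase a))
    (hg : ∀ S, ⁅(E i : so r), g S⁆ =
      ∑ a ∈ S with a.1 = i, kCoeff t (z 1) (Λ 1) a (S.erase a) • g (S.erase a))
    {S : Finset (Var l)}
    (hS : ∀ a ∈ S, ∀ T ⊆ S.erase a,
      kCoeff t (z 0) (Λ 0) a T + kCoeff t (z 1) (Λ 1) a (S.erase a \ T) = 0) :
    ⁅(E i : so r), ∑ T ∈ S.powerset, f T ⊗ₜ[ℂ] g (S \ T)⁆ = 0 := by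
  -- A set `T` with a deleted `a ∈ T` is recorded as `a` and the remaining set. When `a` is deleted
  -- from the complement instead, the same index set appears, so the two sums can be added term by
  -- term.
  have h1 : ∑ T ∈ S.powerset, ⁅(E i : so r), f T⁆ ⊗ₜ[ℂ] g (S \ T) =
      ∑ a ∈ S with a.1 = i, ∑ T ∈ (S.erase a).powerset,
        kCoeff t (z 0) (Λ 0) a T • (f T ⊗ₜ[ℂ] g (S.erase a \ T)) := by
    simp only [hf, TensorProduct.sum_tmul, Finset.sum_sigma', ← TensorProduct.smul_tmul']
    refine Finset.sum_bij' (fun p _ => ⟨p.2, p.1.erase p.2⟩) (fun q _ => ⟨insert q.1 q.2, q.1⟩)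
      ?_ ?_ ?_ ?_ ?_
    · rintro ⟨T, a⟩ h
      simp only [Finset.mem_sigma, Finset.mem_powerset, Finset.mem_filter] at h ⊢
      exact ⟨⟨h.1 h.2.1, h.2.2⟩, Finset.erase_subset_erase _ h.1⟩
    · rintro ⟨a, T⟩ h
      simp only [Finset.mem_sigma, Finset.mem_powerset, Finset.mem_filter] at h ⊢
      exact ⟨Finset.insert_subset h.1.1 (h.2.trans (Finset.erase_subset _ _)),
        Finset.mem_insert_self _ _, h.1.2⟩
    · rintro ⟨T, a⟩ h
      simp only [Finset.mem_sigma, Finset.mem_filter] at h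
      simp [Finset.insert_erase h.2.1]
    · rintro ⟨a, T⟩ h
      simp only [Finset.mem_sigma, Finset.mem_powerset] at h
      simp [Finset.erase_insert (fun h' => Finset.notMem_erase a S (h.2 h'))]
    · rintro ⟨T, a⟩ h
      simp only [Finset.mem_sigma, Finset.mem_filter] at h
      have : S.erase a \ T.erase a = S \ T := by
        ext b
        have := h.2.1
        simp only [Finset.mem_sdiff, Finset.mem_erase]
        grind
      simp only [this]
  have h2 : ∑ T ∈ S.powerset, f T ⊗ₜ[ℂ] ⁅(E i : so r), g (S \ T)⁆ =
      ∑ a ∈ S with a.1 = i, ∑ T ∈ (S.erase a).powerset,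
        kCoeff t (z 1) (Λ 1) a (S.erase a \ T) • (f T ⊗ₜ[ℂ] g (S.erase a \ T)) := by
    simp only [hg, TensorProduct.tmul_sum, TensorProduct.tmul_smul]
    rw [Finset.sum_comm' (t' := S.filter (·.1 = i)) (s' := fun a => (S.erase a).powerset)]
    · refine Finset.sum_congr rfl fun a _ => Finset.sum_congr rfl fun T _ => ?_
      rw [← Finset.erase_sdiff_comm]
    · intro T a
      simp only [Finset.mem_powerset, Finset.mem_filter, Finset.mem_sdiff, Finset.subset_erase]
      tauto
  simp only [lie_sum, TensorProduct.LieModule.lie_tmul_right, Finset.sum_add_distrib]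
  rw [h1, h2, ← Finset.sum_add_distrib]
  refine Finset.sum_eq_zero fun a ha => ?_
  rw [← Finset.sum_add_distrib]
  refine Finset.sum_eq_zero fun T hT => ?_
  rw [← add_smul, hS a (Finset.mem_filter.1 ha).1 T (Finset.mem_powerset.1 hT), zero_smul]

end TensorProduct

/-! ### Limits of weight functions -/

section WeakLimits

variable {γ X Y : Type*} [AddCommGroup X] [Module ℂ X] [AddCommGroup Y] [Module ℂ Y]

/-- Convergence of vectors tested on linear functionals. -/
def WeakLimit (f : γ → X) (𝓕 : Filter γ) (u : X) : Prop :=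
  ∀ φ : Module.Dual ℂ X, Filter.Tendsto (fun s => φ (f s)) 𝓕 (𝓝 (φ u))

variable {𝓕 : Filter γ}

theorem WeakLimit.unique [𝓕.NeBot] {f : γ → X} {u u' : X} (h : WeakLimit f 𝓕 u)
    (h' : WeakLimit f 𝓕 u') : u = u' := by
  rw [← sub_eq_zero, ← Module.forall_dual_apply_eq_zero_iff ℂ]
  intro φ
  rw [map_sub, tendsto_nhds_unique (h φ) (h' φ), sub_self]

theorem WeakLimit.congr' {f g : γ → X} {u : X} (h : WeakLimit f 𝓕 u) (hfg : f =ᶠ[𝓕] g) :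
    WeakLimit g 𝓕 u :=
  fun φ => (h φ).congr' (hfg.mono fun s hs => by rw [hs])

theorem weakLimit_const (u : X) : WeakLimit (fun _ => u) 𝓕 u := fun _ => tendsto_const_nhds

theorem WeakLimit.map {f : γ → X} {u : X} (h : WeakLimit f 𝓕 u) (T : X →ₗ[ℂ] Y) :
    WeakLimit (fun s => T (f s)) 𝓕 (T u) := fun φ => h (φ ∘ₗ T)

theorem WeakLimit.smul {f : γ → X} {u : X} (h : WeakLimit f 𝓕 u) {c : γ → ℂ} {c₀ : ℂ}
    (hc : Filter.Tendsto c 𝓕 (𝓝 c₀)) : WeakLimit (fun s => c s • f s) 𝓕 (c₀ • u) := fun φ => by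
  simpa only [map_smul, smul_eq_mul] using hc.mul (h φ)

theorem weakLimit_sum {ι : Type*} (S : Finset ι) {f : ι → γ → X} {u : ι → X}
    (h : ∀ i ∈ S, WeakLimit (f i) 𝓕 (u i)) :
    WeakLimit (fun s => ∑ i ∈ S, f i s) 𝓕 (∑ i ∈ S, u i) := fun φ => by
  simpa only [map_sum] using tendsto_finsetSum S fun i hi => h i hi φ

/-- A basis of the finite-dimensional factor reduces the claim to a finite sum of convergent scalars
times weakly convergent vectors. -/
theorem WeakLimit.tmul [FiniteDimensional ℂ X] {f : γ → X} {g : γ → Y} {u : X} {w : Y}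
    (hf : WeakLimit f 𝓕 u) (hg : WeakLimit g 𝓕 w) :
    WeakLimit (fun s => f s ⊗ₜ[ℂ] g s) 𝓕 (u ⊗ₜ[ℂ] w) := by
  let b := Module.finBasis ℂ X
  have key : ∀ (x : X) (y : Y), x ⊗ₜ[ℂ] y = ∑ i, b.coord i x • TensorProduct.mk ℂ X Y (b i) y := by
    intro x y
    conv_lhs => rw [← b.sum_repr x, TensorProduct.sum_tmul]
    simp only [TensorProduct.mk_apply, Module.Basis.coord_apply, TensorProduct.smul_tmul']
  simp only [key]
  exact weakLimit_sum _ fun i _ => (hg.map (TensorProduct.mk ℂ X Y (b i))).smul (hf (b.coord i))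

theorem WeakLimit.exists_of_injective {f : γ → X} {T : X →ₗ[ℂ] Y} (hT : Function.Injective T)
    {y : Y} (h : WeakLimit (fun s => T (f s)) 𝓕 y) : ∃ u, WeakLimit f 𝓕 u := by
  obtain ⟨G, hG⟩ := T.exists_leftInverse_of_injective (LinearMap.ker_eq_bot.2 hT)
  refine ⟨G y, (h.map G).congr' (Filter.Eventually.of_forall fun s => ?_)⟩
  exact LinearMap.congr_fun hG (f s)

end WeakLimits

/-! ### Approximation of a solution by regular points. -/

section RegularPoints

variable {r : ℕ} {l : Fin r → ℕ}

/-- The regular points are dense. -/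
theorem neBot_nhdsWithin_regularPoints (z : Fin 2 → ℂ) (t : Var l → ℂ) :
    (𝓝[regularPoints z l] t).NeBot := by
  -- A direction with distinct nonzero coordinates: `t + ε p` is regular for all small `ε ≠ 0`.
  let p : Var l → ℂ := fun a => ((Fintype.equivFin (Var l) a : ℕ) : ℂ) + 1
  have hp : Function.Injective p := fun a b h => by
    have h1 : ((Fintype.equivFin (Var l) a : ℕ) : ℂ) = (Fintype.equivFin (Var l) b : ℕ) :=
      add_right_cancel h
    exact (Fintype.equivFin (Var l)).injective (Fin.ext (Nat.cast_injective h1))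
  have hp0 : ∀ a, p a ≠ 0 := fun a => Nat.cast_add_one_ne_zero _
  have key : ∀ c d : ℂ, (c = 0 → d ≠ 0) → ∀ᶠ ε in 𝓝[≠] (0 : ℂ), c + ε * d ≠ 0 := by
    intro c d h
    by_cases hc : c = 0
    · filter_upwards [self_mem_nhdsWithin] with ε hε
      rw [hc, zero_add]
      exact mul_ne_zero hε (h hc)
    · have : Filter.Tendsto (fun ε : ℂ => c + ε * d) (𝓝[≠] 0) (𝓝 (c + 0 * d)) :=
        (Continuous.tendsto (by fun_prop) 0).mono_left nhdsWithin_le_nhds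
      rw [zero_mul, add_zero] at this
      exact this.eventually_ne hc
  let q : ℂ → Var l → ℂ := fun ε a => t a + ε * p a
  have hq : ∀ᶠ ε in 𝓝[≠] (0 : ℂ), q ε ∈ regularPoints z l := by
    have h1 : ∀ᶠ ε in 𝓝[≠] (0 : ℂ), ∀ a b, a ≠ b → t a - t b + ε * (p a - p b) ≠ 0 := by
      simp only [Filter.eventually_all]
      intro a b hab
      exact key _ _ fun _ => sub_ne_zero.2 (hp.ne hab)
    have h2 : ∀ᶠ ε in 𝓝[≠] (0 : ℂ), ∀ a s, t a - z s + ε * p a ≠ 0 := by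
      simp only [Filter.eventually_all]
      intro a s
      exact key _ _ fun _ => hp0 a
    filter_upwards [h1, h2] with ε h1 h2
    refine ⟨fun a b hab => ?_, fun a s h => h2 a s ?_⟩
    · by_contra hne
      refine h1 a b hne ?_
      simp only [q] at hab
      linear_combination hab
    · simp only [q] at h
      linear_combination h
  have hq' : Filter.Tendsto q (𝓝[≠] 0) (𝓝[regularPoints z l] t) := by
    refine tendsto_nhdsWithin_iff.2 ⟨?_, hq⟩
    have : Filter.Tendsto q (𝓝 0) (𝓝 (q 0)) := Continuous.tendsto (by fun_prop) 0
    rw [show q 0 = t by ext a; simp [q]] at this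
    exact this.mono_left nhdsWithin_le_nhds
  exact hq'.neBot

theorem symm_ne_zero (i : Fin r) : symm i ≠ 0 := by
  rw [symm]; split_ifs <;> norm_num

theorem cart_eq_zero {i j : Fin r} (h : rootPairing i j = 0) : cart i j = 0 := by
  rw [cart, h]; simp

/-- A denominator can vanish at `t` only where its numerator is zero, and such a term is identically
zero nearby as well. -/
theorem tendsto_kCoeff {z : ℂ} {Λ : Fin r → ℕ} {t : Var l → ℂ} {𝓕 : Filter (Var l → ℂ)}
    (h𝓕 : 𝓕 ≤ 𝓝 t) {a : Var l} {S : Finset (Var l)} (hz : weightPairing a.1 Λ ≠ 0 → t a ≠ z)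
    (ht : ∀ b ∈ S, rootPairing a.1 b.1 ≠ 0 → t a ≠ t b) :
    Filter.Tendsto (fun s => kCoeff s z Λ a S) 𝓕 (𝓝 (kCoeff t z Λ a S)) := by
  have hc : ∀ b, Filter.Tendsto (fun s : Var l → ℂ => s b) 𝓕 (𝓝 (t b)) := fun b =>
    ((continuous_apply b).tendsto t).mono_left h𝓕
  refine Filter.Tendsto.sub ?_ (tendsto_finsetSum S fun b hb => ?_)
  · by_cases h : weightPairing a.1 Λ = 0
    · have : Λ a.1 = 0 := by simpa [weightPairing, symm_ne_zero] using h
      simpa [this] using tendsto_const_nhds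
    · exact tendsto_const_nhds.div ((hc a).sub tendsto_const_nhds) (sub_ne_zero.2 (hz h))
  · by_cases h : rootPairing a.1 b.1 = 0
    · simpa [cart_eq_zero h] using tendsto_const_nhds
    · exact tendsto_const_nhds.div ((hc a).sub (hc b)) (sub_ne_zero.2 (ht b hb h))

end RegularPoints

/-! ### Existence of the limits in an irreducible module. -/

section LimitWeight

variable {r : ℕ} {l : Fin r → ℕ} {X : Type*} [AddCommGroup X] [Module ℂ X]
  [LieRingModule (so r) X] [LieModule ℂ (so r) X] [LieModule.IsIrreducible ℂ (so r) X]

/-- A family of vectors with the properties of the weight functions of a highest weight module. -/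
structure IsWeightFamily (t : Var l → ℂ) (z : ℂ) (Λ : Fin r → ℕ) (v : X)
    (f : Finset (Var l) → X) : Prop where
  map_empty : f ∅ = v
  mem_Dspace : ∀ S, f S ∈ Dspace r X (topWeight Λ - S.card)
  lie_E : ∀ i S, ⁅(E i : so r), f S⁆ =
    ∑ a ∈ S with a.1 = i, kCoeff t z Λ a (S.erase a) • f (S.erase a)

/-- Poles of single terms are never cancelled by hand. The images of the weight function under all
`E i` converge by induction on `S`, and the weight function is recovered from them linearly. -/
theorem exists_weakLimit_partialWeight {z : Fin 2 → ℂ} {e : Fin 2} {Λ : Fin r → ℕ} {v : X}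
    (hv : IsHighestWeightVector Λ v) {t : Var l → ℂ}
    (ht : ∀ a b : Var l, a ≠ b → rootPairing a.1 b.1 ≠ 0 → t a ≠ t b)
    (hz : ∀ a : Var l, weightPairing a.1 Λ ≠ 0 → t a ≠ z e) :
    ∃ f : Finset (Var l) → X, IsWeightFamily t (z e) Λ v f ∧
      ∀ S, WeakLimit (fun s => partialWeight s (z e) v S) (𝓝[regularPoints z l] t) (f S) := by
  have := neBot_nhdsWithin_regularPoints z t
  have hreg : ∀ᶠ s in 𝓝[regularPoints z l] t, s ∈ regularPoints z l := self_mem_nhdsWithin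
  have hk : ∀ (a : Var l) (S : Finset (Var l)), Filter.Tendsto
      (fun s => kCoeff s (z e) Λ a (S.erase a)) (𝓝[regularPoints z l] t)
      (𝓝 (kCoeff t (z e) Λ a (S.erase a))) := fun a S =>
    tendsto_kCoeff nhdsWithin_le_nhds (hz a)
      fun b hb => ht a b (Finset.ne_of_mem_erase hb).symm
  have hE : ∀ s ∈ regularPoints z l, ∀ i S, ⁅(E i : so r), partialWeight s (z e) v S⁆ =
      ∑ a ∈ S with a.1 = i, kCoeff s (z e) Λ a (S.erase a) • partialWeight s (z e) v (S.erase a) :=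
    fun s hs i S => E_lie_partialWeight hs.1 (fun a => hs.2 a e) (hv.lie_E i) (hv.lie_H i) S
  have hex : ∀ S, ∃ u, WeakLimit (fun s => partialWeight s (z e) v S)
      (𝓝[regularPoints z l] t) u := by
    intro S
    induction S using Finset.strongInduction with
    | H S ih =>
      rcases S.eq_empty_or_nonempty with rfl | hS
      · exact ⟨v, by simpa only [partialWeight_empty] using weakLimit_const v⟩
      choose! f hf using ih
      let δ : ℂ := topWeight Λ - S.card
      -- The kernel consists of singular vectors with `D`-eigenvalue `δ`. These exist only at the
      -- top weight, which `δ` misses because `S` is nonempty.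
      let T : X →ₗ[ℂ] (Fin r → X) × X :=
        (LinearMap.pi fun i => (LieModule.toEnd ℂ (so r) X (E i))).prod
          (LieModule.toEnd ℂ (so r) X (D r) - δ • LinearMap.id)
      have hT : Function.Injective T := by
        rw [injective_iff_map_eq_zero]
        intro u hu
        by_contra hu0
        have h1 : ∀ i, ⁅(E i : so r), u⁆ = 0 := fun i => congrFun (congrArg Prod.fst hu) i
        have h2 : ⁅D r, u⁆ - δ • u = 0 := congrArg Prod.snd hu
        have h3 := (hv.eq_smul_of_singular hu0 h1 (mem_Dspace.2 (sub_eq_zero.1 h2))).1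
        have : (S.card : ℂ) = 0 := by
          simp only [δ] at h3
          linear_combination -h3
        exact hS.card_pos.ne' (Nat.cast_eq_zero.1 this)
      let y : Fin r → X := fun i =>
        ∑ a ∈ S with a.1 = i, kCoeff t (z e) Λ a (S.erase a) • f (S.erase a)
      have hy : ∀ i, WeakLimit (fun s => ⁅(E i : so r), partialWeight s (z e) v S⁆)
          (𝓝[regularPoints z l] t) (y i) := fun i => by
        refine (weakLimit_sum _ fun a ha => (hf (S.erase a)
          (Finset.erase_ssubset (Finset.mem_filter.1 ha).1)).smul (hk a S)).congr' ?_
        filter_upwards [hreg] with s hs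
        rw [hE s hs]
      refine WeakLimit.exists_of_injective hT (y := ∑ i, (Pi.single i (y i), 0)) ?_
      refine (weakLimit_sum Finset.univ fun i _ => (hy i).map
        ((LinearMap.inl ℂ (Fin r → X) X) ∘ₗ LinearMap.single ℂ (fun _ => X) i)).congr'
        (Filter.Eventually.of_forall fun s => ?_)
      have hD := mem_Dspace.1 (partialWeight_mem_Dspace hv.mem_Dspace s (z e) S)
      refine Prod.ext ?_ ?_
      · ext j
        simp [T, Prod.fst_sum, Finset.sum_apply, Pi.single_apply]
      · simp [T, Prod.snd_sum, hD, δ]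
  choose f hf using hex
  refine ⟨f, ⟨?_, fun S => ?_, fun i S => ?_⟩, hf⟩
  · have := hf ∅
    simp only [partialWeight_empty] at this
    exact this.unique (weakLimit_const v)
  · rw [mem_Dspace]
    refine ((hf S).map (LieModule.toEnd ℂ (so r) X (D r))).unique
      (((hf S).smul (tendsto_const_nhds (x := topWeight Λ - (S.card : ℂ)))).congr'
        (Filter.Eventually.of_forall fun s => ?_))
    exact (mem_Dspace.1 (partialWeight_mem_Dspace hv.mem_Dspace s (z e) S)).symm
  · refine ((hf S).map (LieModule.toEnd ℂ (so r) X (E i))).unique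
      ((weakLimit_sum _ fun a _ => (hf (S.erase a)).smul (hk a S)).congr' ?_)
    filter_upwards [hreg] with s hs
    exact (hE s hs i S).symm

end LimitWeight

/-! ### The Bethe vector as a singular vector. -/

section BetheVectorLimit

variable {r : ℕ} {l : Fin r → ℕ} {V W : Type*}
  [AddCommGroup V] [Module ℂ V] [FiniteDimensional ℂ V] [LieRingModule (so r) V]
  [LieModule ℂ (so r) V] [LieModule.IsIrreducible ℂ (so r) V]
  [AddCommGroup W] [Module ℂ W] [LieRingModule (so r) W]
  [LieModule ℂ (so r) W] [LieModule.IsIrreducible ℂ (so r) W]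

/-- Multiplied by `symm a.1`, the sum is the negative of the Bethe equation of `a`; how the other
variables are distributed over the two factors does not matter. -/
theorem kCoeff_add_kCoeff_eq_zero {z : Fin 2 → ℂ} {Λ : Fin 2 → Fin r → ℕ} {t : Var l → ℂ}
    (ht : IsCriticalPoint z Λ l t) (a : Var l) {T : Finset (Var l)}
    (hT : T ⊆ Finset.univ.erase a) :
    kCoeff t (z 0) (Λ 0) a T + kCoeff t (z 1) (Λ 1) a (Finset.univ.erase a \ T) = 0 := by
  have h := ht.equation a
  rw [← Finset.sum_sdiff hT, Fin.sum_univ_two] at h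
  have hs : (symm a.1 : ℂ) ≠ 0 := Int.cast_ne_zero.2 (symm_ne_zero a.1)
  have h1 : ∀ S : Finset (Var l), ∑ b ∈ S, (rootPairing a.1 b.1 : ℂ) / (t a - t b) =
      symm a.1 * ∑ b ∈ S, cart a.1 b.1 / (t a - t b) := fun S => by
    rw [Finset.mul_sum]
    refine Finset.sum_congr rfl fun b _ => ?_
    rw [cart]; field_simp
  rw [h1, h1] at h
  simp only [weightPairing, Int.cast_mul, Int.cast_natCast, mul_div_assoc] at h
  have h2 : (symm a.1 : ℂ) * (kCoeff t (z 0) (Λ 0) a T +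
      kCoeff t (z 1) (Λ 1) a (Finset.univ.erase a \ T)) = 0 := by
    rw [kCoeff, kCoeff]
    linear_combination -h
  exact (mul_eq_zero.1 h2).resolve_left hs

/-- The Bethe vector is the sum of products of vectors in two weight families. -/
theorem exists_betheVector_eq {z : Fin 2 → ℂ} {Λ : Fin 2 → Fin r → ℕ} {v : V} {w : W}
    (hv : IsHighestWeightVector (Λ 0) v) (hw : IsHighestWeightVector (Λ 1) w) {t : Var l → ℂ}
    (ht : IsCriticalPoint z Λ l t) :
    ∃ (f : Finset (Var l) → V) (g : Finset (Var l) → W),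
      IsWeightFamily t (z 0) (Λ 0) v f ∧ IsWeightFamily t (z 1) (Λ 1) w g ∧
      betheVector z v w t = ∑ T ∈ Finset.univ.powerset, f T ⊗ₜ[ℂ] g (Finset.univ \ T) := by
  have := neBot_nhdsWithin_regularPoints z t
  obtain ⟨f, hf, hf'⟩ := exists_weakLimit_partialWeight (z := z) (e := 0) hv ht.ne_of_rootPairing
    (fun a => ht.ne_of_weightPairing a 0)
  obtain ⟨g, hg, hg'⟩ := exists_weakLimit_partialWeight (z := z) (e := 1) hw ht.ne_of_rootPairing
    (fun a => ht.ne_of_weightPairing a 1)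
  have hlim : IsWeightFunctionValue z v w t
      (∑ T ∈ Finset.univ.powerset, f T ⊗ₜ[ℂ] g (Finset.univ \ T)) := by
    have : WeakLimit (weightFunction z v w) (𝓝[regularPoints z l] t)
        (∑ T ∈ Finset.univ.powerset, f T ⊗ₜ[ℂ] g (Finset.univ \ T)) :=
      (weakLimit_sum _ fun T _ => (hf' T).tmul (hg' (Finset.univ \ T))).congr'
        (Filter.Eventually.of_forall fun s => (weightFunction_eq_sum z v w s).symm)
    exact this
  have hex : ∃ ω : V ⊗[ℂ] W, IsWeightFunctionValue z v w t ω := ⟨_, hlim⟩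
  refine ⟨f, g, hf, hg, ?_⟩
  rw [betheVector, dif_pos hex]
  exact WeakLimit.unique (f := weightFunction z v w) hex.choose_spec hlim

omit [FiniteDimensional ℂ V] [LieModule.IsIrreducible ℂ (so r) V]
  [LieModule.IsIrreducible ℂ (so r) W] in
theorem E_lie_sum_eq_zero {z : Fin 2 → ℂ} {Λ : Fin 2 → Fin r → ℕ} {v : V} {w : W}
    {t : Var l → ℂ} (ht : IsCriticalPoint z Λ l t) {f : Finset (Var l) → V}
    {g : Finset (Var l) → W} (hf : IsWeightFamily t (z 0) (Λ 0) v f)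
    (hg : IsWeightFamily t (z 1) (Λ 1) w g) (i : Fin r) :
    ⁅(E i : so r), ∑ T ∈ Finset.univ.powerset, f T ⊗ₜ[ℂ] g (Finset.univ \ T)⁆ = 0 :=
  E_lie_sum_tmul_eq_zero (hf.lie_E i) (hg.lie_E i) fun a _ _ hT => kCoeff_add_kCoeff_eq_zero ht a hT

end BetheVectorLimit

/-! ### The leading coefficient of a Bethe vector -/

section LeadingCoefficient

variable {r : ℕ} {l : Fin r → ℕ}

/-- The recursion satisfied by the coefficients of weight functions of the vector
representation. -/
def IsCoeffFamily (t : Var l → ℂ) (z : ℂ) (G : Finset (Var l) → ℂ) : Prop :=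
  ∀ (i : Fin r) (n : ℕ), (n = i + 1 ∨ n + i = 2 * r) → ∃ κ : ℂ, κ ≠ 0 ∧ ∀ S, S.card = n →
    κ * G S = ∑ a ∈ S with a.1 = i, kCoeff t z (omegaOne r) a (S.erase a) * G (S.erase a)

/-- The point that precedes the `i`-th one in the sequence `z, t_{s(0)}, t_{s(1)}, …`. -/
def prevPoint (t : Var l → ℂ) (z : ℂ) (s : ℕ → Var l) (i : ℕ) : ℂ :=
  if i = 0 then z else t (s (i - 1))

/-- The product of all `1 / (t_{s(i)} - t_{s(i-1)})` for `i < m`. -/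
def chainProd (t : Var l → ℂ) (z : ℂ) (s : ℕ → Var l) (m : ℕ) : ℂ :=
  ∏ i ∈ Finset.range m, (t (s i) - prevPoint t z s i)⁻¹

theorem cart_of_succ {i j : Fin r} (h : j.val + 1 = i) : cart i j = -(2 / (symm i : ℂ)) := by
  rw [cart, rootPairing, if_neg (fun h' => by rw [h'] at h; omega), if_pos (Or.inr h)]
  push_cast; ring

theorem cart_self (i : Fin r) : cart i i = 2 := by
  have : (symm i : ℂ) ≠ 0 := Int.cast_ne_zero.2 (symm_ne_zero i)
  rw [cart, rootPairing, if_pos rfl]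
  push_cast; field_simp

theorem cart_of_pred {i j : Fin r} (h : i.val + 1 = j) : cart i j = -1 := by
  rw [cart, rootPairing, if_neg (fun h' => by rw [h'] at h; omega), if_pos (Or.inl h), symm,
    if_neg (by omega)]
  norm_num

theorem cart_eq_zero_of_ne {i j : Fin r} (h1 : i ≠ j) (h2 : i.val + 1 ≠ j) (h3 : j.val + 1 ≠ i) :
    cart i j = 0 := by
  rw [cart, rootPairing, if_neg h1, if_neg (by tauto)]
  simp

theorem rootPairing_ne_zero {i j : Fin r} (h : i = j ∨ i.val + 1 = j ∨ j.val + 1 = i) :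
    rootPairing i j ≠ 0 := by
  rw [rootPairing]
  split_ifs with h1 h2
  · simp [symm_ne_zero]
  · norm_num
  · tauto

theorem ne_prevPoint {t : Var l → ℂ} {z : ℂ}
    (ht : ∀ a b : Var l, a ≠ b → rootPairing a.1 b.1 ≠ 0 → t a ≠ t b)
    (hz : ∀ a : Var l, weightPairing a.1 (omegaOne r) ≠ 0 → t a ≠ z) {j : ℕ} {s : ℕ → Var l}
    (hs : ∀ i < j, (s i).1.val = i) {a : Var l} (ha : a.1.val = j) :
    t a ≠ prevPoint t z s j := by
  rw [prevPoint]
  split_ifs with hj0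
  · refine hz a (mul_ne_zero (symm_ne_zero _) ?_)
    rw [omegaOne, if_pos (by omega)]
    norm_num
  · have := hs (j - 1) (by omega)
    refine ht _ _ (fun h => ?_) (rootPairing_ne_zero (by omega))
    rw [h] at ha
    omega

theorem chainProd_ne_zero {t : Var l → ℂ} {z : ℂ}
    (ht : ∀ a b : Var l, a ≠ b → rootPairing a.1 b.1 ≠ 0 → t a ≠ t b)
    (hz : ∀ a : Var l, weightPairing a.1 (omegaOne r) ≠ 0 → t a ≠ z) {m : ℕ} {s : ℕ → Var l}
    (hs : ∀ i < m, (s i).1.val = i) : chainProd t z s m ≠ 0 := by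
  refine Finset.prod_ne_zero_iff.2 fun i hi => inv_ne_zero (sub_ne_zero.2 ?_)
  have hi := Finset.mem_range.1 hi
  exact ne_prevPoint ht hz (fun j hj => hs j (by omega)) (hs i hi)

/-- Among the earlier singles only the one of the preceding color is linked to `j`. For `j = 0` its
place is taken by `z`, with the same constant because the first root is long when `2 ≤ r`. -/
theorem sum_range_cart (hr : 2 ≤ r) (t : Var l → ℂ) (z : ℂ) (j : Fin r) {s : ℕ → Var l}
    (hs : ∀ i < j.val, (s i).1.val = i) (x : ℂ) :
    (omegaOne r j : ℂ) / (x - z) - ∑ i ∈ Finset.range j, cart j (s i).1 / (x - t (s i)) =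
      2 / (symm j : ℂ) / (x - prevPoint t z s j) := by
  rcases Nat.eq_zero_or_pos j.val with hj | hj
  · rw [hj, Finset.sum_range_zero, prevPoint, if_pos rfl, omegaOne, if_pos hj, symm,
      if_neg (by omega)]
    norm_num
  · obtain ⟨m, hm⟩ : ∃ m, j.val = m + 1 := ⟨j.val - 1, by omega⟩
    rw [hm, Finset.sum_range_succ, Finset.sum_eq_zero, prevPoint, if_neg (by omega), omegaOne,
      if_neg (by omega), cart_of_succ (by rw [hs m (by omega)]; exact hm.symm)]
    · rw [Nat.add_sub_cancel]
      push_cast; ring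
    · intro i hi
      have hi := Finset.mem_range.1 hi
      have h1 := hs i (by omega)
      rw [cart_eq_zero_of_ne (fun h => by rw [← h] at h1; omega) (by omega) (by omega), zero_div]

theorem injOn_of_color {m : ℕ} {s : ℕ → Var l} (hs : ∀ i < m, (s i).1.val = i) :
    Set.InjOn s (Finset.range m) := fun i hi j hj h => by
  rw [← hs i (by simpa using hi), ← hs j (by simpa using hj), h]

/-- Only the last variable has the color that leads from height `m + 1` to height `m`, so the
recursion has one term per step. The constant must not depend on `s`, since later two choices of `s`
are compared. -/
theorem exists_coeff_singles (hr : 2 ≤ r) {t : Var l → ℂ} {z : ℂ} {G : Finset (Var l) → ℂ}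
    (h0 : G ∅ ≠ 0) (hG : IsCoeffFamily t z G) (m : ℕ) (hm : m ≤ r) :
    ∃ C : ℂ, C ≠ 0 ∧ ∀ s : ℕ → Var l, (∀ i < m, (s i).1.val = i) →
      G ((Finset.range m).image s) = C * chainProd t z s m := by
  induction m with
  | zero => exact ⟨G ∅, h0, fun s _ => by simp [chainProd]⟩
  | succ m ih =>
    obtain ⟨C, hC, h⟩ := ih (by omega)
    obtain ⟨κ, hκ, hrec⟩ := hG ⟨m, by omega⟩ (m + 1) (Or.inl rfl)
    have hsy : (symm (⟨m, by omega⟩ : Fin r) : ℂ) ≠ 0 := Int.cast_ne_zero.2 (symm_ne_zero _)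
    refine ⟨κ⁻¹ * (2 / (symm (⟨m, by omega⟩ : Fin r) : ℂ)) * C,
      mul_ne_zero (mul_ne_zero (inv_ne_zero hκ) (div_ne_zero two_ne_zero hsy)) hC, fun s hs => ?_⟩
    have hs' : ∀ i < m, (s i).1.val = i := fun i hi => hs i (by omega)
    have hcol : (s m).1 = ⟨m, by omega⟩ := Fin.ext (hs m (by omega))
    have h1 := hrec ((Finset.range (m + 1)).image s)
      (by rw [Finset.card_image_of_injOn (injOn_of_color hs), Finset.card_range])
    have hnot : s m ∉ (Finset.range m).image s := by
      rw [Finset.mem_image]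
      rintro ⟨i, hi, hi'⟩
      have hi := Finset.mem_range.1 hi
      have := hs i (by omega)
      rw [hi', hs m (by omega)] at this
      omega
    have h2 : ((Finset.range (m + 1)).image s).filter (fun a => a.1 = ⟨m, by omega⟩) = {s m} := by
      ext a
      simp only [Finset.mem_filter, Finset.mem_image, Finset.mem_range, Finset.mem_singleton]
      constructor
      · rintro ⟨⟨i, hi, rfl⟩, h⟩
        have := hs i hi
        rw [h] at this
        simp only at this
        rw [this]
      · rintro rfl
        exact ⟨⟨m, by omega, rfl⟩, hcol⟩
    have h3 : ((Finset.range (m + 1)).image s).erase (s m) = (Finset.range m).image s := by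
      rw [Finset.range_add_one, Finset.image_insert, Finset.erase_insert hnot]
    rw [h2, Finset.sum_singleton, h3, h s hs', kCoeff,
      Finset.sum_image (injOn_of_color hs'), hcol,
      sum_range_cart hr t z ⟨m, by omega⟩ hs'] at h1
    rw [chainProd, Finset.prod_range_succ, ← chainProd, mul_assoc κ⁻¹, mul_assoc κ⁻¹,
      eq_inv_mul_iff_mul_eq₀ hκ, h1, div_eq_mul_inv _ (t (s m) - _)]
    ring

/-- The variables `s(i)` for `i < j` and all variables of colors at least `j`. -/
def singlesAndRest (j : ℕ) (s : ℕ → Var l) : Finset (Var l) :=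
  (Finset.range j).image s ∪ Finset.univ.filter fun a => j ≤ a.1.val

theorem mem_singlesAndRest {j : ℕ} {s : ℕ → Var l} {a : Var l} :
    a ∈ singlesAndRest j s ↔ (∃ i < j, s i = a) ∨ j ≤ a.1.val := by
  simp [singlesAndRest]

theorem disjoint_singles_rest {j : ℕ} {s : ℕ → Var l} (hs : ∀ i < j, (s i).1.val = i) :
    Disjoint ((Finset.range j).image s) (Finset.univ.filter fun a => j ≤ a.1.val) := by
  rw [Finset.disjoint_left]
  simp only [Finset.mem_image, Finset.mem_range, Finset.mem_filter, not_and]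
  rintro a ⟨i, hi, rfl⟩ _
  have := hs i hi
  omega

/-- `e` and `e'` enumerate the variables of colors at least `k`, two for each color. -/
structure IsPairing (k : ℕ) (e e' : ℕ → Var l) : Prop where
  color : ∀ i, k ≤ i → i < r → (e i).1.val = i
  color' : ∀ i, k ≤ i → i < r → (e' i).1.val = i
  ne : ∀ i, k ≤ i → i < r → e i ≠ e' i
  eq_or_eq : ∀ a : Var l, k ≤ a.1.val → a = e a.1 ∨ a = e' a.1

theorem IsPairing.swap {k : ℕ} {e e' : ℕ → Var l} (h : IsPairing k e e') : IsPairing k e' e :=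
  ⟨h.color', h.color, fun i h1 h2 => (h.ne i h1 h2).symm, fun a ha => (h.eq_or_eq a ha).symm⟩

theorem erase_singlesAndRest {k : ℕ} {e e' : ℕ → Var l} (he : IsPairing k e e') {j : ℕ}
    (hkj : k ≤ j) (hj : j < r) {s : ℕ → Var l} (hs : ∀ i < j, (s i).1.val = i) :
    (singlesAndRest j s).erase (e j) = singlesAndRest (j + 1) (Function.update s j (e' j)) := by
  ext a
  simp only [Finset.mem_erase, mem_singlesAndRest]
  constructor
  · rintro ⟨h1, ⟨i, hi, rfl⟩ | h2⟩
    · exact Or.inl ⟨i, by omega, by rw [Function.update_of_ne (by omega)]⟩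
    · rcases h2.eq_or_lt with h2 | h2
      · refine Or.inl ⟨j, by omega, ?_⟩
        rw [Function.update_self]
        rcases he.eq_or_eq a (by omega) with h | h
        · rw [← h2] at h; exact absurd h h1
        · rw [← h2] at h; exact h.symm
      · exact Or.inr h2
  · rintro (⟨i, hi, h⟩ | h)
    · by_cases hij : i = j
      · subst hij
        rw [Function.update_self] at h
        rw [← h]
        exact ⟨(he.ne i hkj hj).symm, Or.inr (he.color' i hkj hj).ge⟩
      · rw [Function.update_of_ne hij] at h
        refine ⟨fun h' => ?_, Or.inl ⟨i, by omega, h⟩⟩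
        have h1 := hs i (by omega)
        rw [h, h', he.color j hkj hj] at h1
        omega
    · refine ⟨fun h' => ?_, Or.inr (by omega)⟩
      rw [h', he.color j hkj hj] at h
      omega

theorem sum_filter_color {k : ℕ} {e e' : ℕ → Var l} (he : IsPairing k e e') {j : ℕ}
    (hkj : k ≤ j) (hj : j < r) (f : Var l → ℂ) {S : Finset (Var l)}
    (hS : e j ∈ S) (hS' : e' j ∈ S) :
    ∑ a ∈ S with a.1 = ⟨j, hj⟩, f a = f (e j) + f (e' j) := by
  rw [← Finset.sum_pair (he.ne j hkj hj)]
  refine Finset.sum_congr ?_ fun _ _ => rfl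
  ext a
  simp only [Finset.mem_filter, Finset.mem_insert, Finset.mem_singleton]
  constructor
  · rintro ⟨_, h⟩
    have := he.eq_or_eq a (by rw [h]; exact hkj)
    rwa [h] at this
  · rintro (rfl | rfl)
    · exact ⟨hS, Fin.ext (he.color j hkj hj)⟩
    · exact ⟨hS', Fin.ext (he.color' j hkj hj)⟩

/-- The terms come from the preceding point, the partner of the same color, and the two variables of
the next color, which are missing at the last color. -/
theorem kCoeff_singlesAndRest (hr : 2 ≤ r) {k : ℕ} {e e' : ℕ → Var l} (he : IsPairing k e e')
    (t : Var l → ℂ) (z : ℂ) {j : ℕ} (hkj : k ≤ j) (hj : j < r) {s : ℕ → Var l}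
    (hs : ∀ i < j, (s i).1.val = i) :
    kCoeff t z (omegaOne r) (e j) (singlesAndRest (j + 1) (Function.update s j (e' j))) =
      2 / (symm (⟨j, hj⟩ : Fin r) : ℂ) / (t (e j) - prevPoint t z s j)
        - 2 / (t (e j) - t (e' j))
        + if j + 1 < r then 1 / (t (e j) - t (e (j + 1))) + 1 / (t (e j) - t (e' (j + 1)))
          else 0 := by
  have hcol : (e j).1 = ⟨j, hj⟩ := Fin.ext (he.color j hkj hj)
  have hcol' : (e' j).1 = ⟨j, hj⟩ := Fin.ext (he.color' j hkj hj)
  have hs' : ∀ i < j + 1, (Function.update s j (e' j) i).1.val = i := fun i hi => by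
    by_cases h : i = j
    · rw [h, Function.update_self, hcol']
    · rw [Function.update_of_ne h, hs i (by omega)]
  have h1 : ∑ i ∈ Finset.range j, cart ⟨j, hj⟩ (Function.update s j (e' j) i).1 /
      (t (e j) - t (Function.update s j (e' j) i)) =
      ∑ i ∈ Finset.range j, cart ⟨j, hj⟩ (s i).1 / (t (e j) - t (s i)) :=
    Finset.sum_congr rfl fun i hi => by
      rw [Function.update_of_ne (Finset.mem_range.1 hi).ne]
  have h2 : ∑ b ∈ Finset.univ.filter (fun a : Var l => j + 1 ≤ a.1.val),
      cart ⟨j, hj⟩ b.1 / (t (e j) - t b) =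
      - if j + 1 < r then 1 / (t (e j) - t (e (j + 1))) + 1 / (t (e j) - t (e' (j + 1)))
          else 0 := by
    split_ifs with hj1
    · have hc : (e (j + 1)).1 = ⟨j + 1, hj1⟩ := Fin.ext (he.color _ (by omega) hj1)
      have hc' : (e' (j + 1)).1 = ⟨j + 1, hj1⟩ := Fin.ext (he.color' _ (by omega) hj1)
      rw [← Finset.sum_filter_add_sum_filter_not _ (fun a : Var l => a.1 = ⟨j + 1, hj1⟩),
        sum_filter_color he (by omega) hj1 _ (by simp [hc]) (by simp [hc']),
        Finset.sum_eq_zero (s := Finset.filter _ _), hc, hc', cart_of_pred (by rfl)]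
      · ring
      · intro b hb
        simp only [Finset.mem_filter, Finset.mem_univ, true_and, Fin.ext_iff] at hb
        rw [cart_eq_zero_of_ne (fun h => by rw [← h] at hb; simp at hb) (by simp; omega)
          (by simp; omega), zero_div]
    · rw [neg_zero]
      refine Finset.sum_eq_zero fun b hb => ?_
      have := (Finset.mem_filter.1 hb).2
      omega
  rw [kCoeff, singlesAndRest, Finset.sum_union (disjoint_singles_rest hs'),
    Finset.sum_image (injOn_of_color hs'), hcol, Finset.sum_range_succ, h1, h2,
    Function.update_self, hcol', cart_self, ← sum_range_cart hr t z ⟨j, hj⟩ hs]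
  ring

theorem card_singlesAndRest {k : ℕ} {e e' : ℕ → Var l} (he : IsPairing k e e') {j : ℕ}
    (hkj : k ≤ j) (hj : j ≤ r) {s : ℕ → Var l} (hs : ∀ i < j, (s i).1.val = i) :
    (singlesAndRest j s).card + j = 2 * r := by
  obtain ⟨n, hn⟩ : ∃ n, j + n = r := ⟨r - j, by omega⟩
  induction n generalizing j s with
  | zero =>
    have : Finset.univ.filter (fun a : Var l => j ≤ a.1.val) = ∅ :=
      Finset.filter_eq_empty_iff.2 fun a _ => by omega
    rw [singlesAndRest, this, Finset.union_empty, Finset.card_image_of_injOn (injOn_of_color hs),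
      Finset.card_range]
    omega
  | succ n ih =>
    have hs' : ∀ i < j + 1, (Function.update s j (e' j) i).1.val = i := fun i hi => by
      by_cases h : i = j
      · rw [h, Function.update_self, he.color' j hkj (by omega)]
      · rw [Function.update_of_ne h, hs i (by omega)]
    have h1 := ih (j := j + 1) (by omega) (by omega) hs' (by omega)
    have h2 : e j ∈ singlesAndRest j s :=
      mem_singlesAndRest.2 (Or.inr (he.color j hkj (by omega)).ge)
    rw [← erase_singlesAndRest he hkj (by omega) hs, Finset.card_erase_of_mem h2] at h1
    have := Finset.card_pos.2 ⟨_, h2⟩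
    omega

/-- Here `a`, `b` are the two variables of one color, `p` is the preceding point and `x`, `y` are
the variables of the next color. The sum over which of `a`, `b` is deleted collapses to a product;
this is what makes nonvanishing visible. -/
theorem long_pair_identity {a b p x y : ℂ} (hab : a ≠ b) (hap : a ≠ p) (hbp : b ≠ p) (hax : a ≠ x)
    (hay : a ≠ y) (hbx : b ≠ x) (hby : b ≠ y) :
    (1 / (a - p) - 2 / (a - b) + (1 / (a - x) + 1 / (a - y))) *
        ((b - p)⁻¹ * ((x - b) * (y - b))⁻¹) +
      (1 / (b - p) - 2 / (b - a) + (1 / (b - x) + 1 / (b - y))) *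
        ((a - p)⁻¹ * ((x - a) * (y - a))⁻¹) =
      (a - b) ^ 2 / ((x - a) * (y - a) * ((x - b) * (y - b))) * ((a - p) * (b - p))⁻¹ := by
  have h1 := sub_ne_zero.2 hab
  have h2 := sub_ne_zero.2 hap
  have h3 := sub_ne_zero.2 hbp
  have h4 := sub_ne_zero.2 hax
  have h5 := sub_ne_zero.2 hay
  have h6 := sub_ne_zero.2 hbx
  have h7 := sub_ne_zero.2 hby
  rw [← neg_sub a x, ← neg_sub a y, ← neg_sub b x, ← neg_sub b y, ← neg_sub a b]
  field_simp
  ring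

theorem short_pair_identity {a b p : ℂ} (hab : a ≠ b) (hap : a ≠ p) (hbp : b ≠ p) :
    (2 / (a - p) - 2 / (a - b)) * (b - p)⁻¹ + (2 / (b - p) - 2 / (b - a)) * (a - p)⁻¹ =
      2 * ((a - p) * (b - p))⁻¹ := by
  have h1 := sub_ne_zero.2 hab
  have h2 := sub_ne_zero.2 hap
  have h3 := sub_ne_zero.2 hbp
  rw [← neg_sub a b]
  field_simp
  ring

/-- Descending induction on the first doubled color `j`. Deleting one of the two variables of color
`j` appends the other to the singles, and the two resulting terms combine by `long_pair_identity`,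
or by `short_pair_identity` at the last color. `R` absorbs everything independent of `s`. -/
theorem exists_coeff_pairs (hr : 2 ≤ r) {t : Var l → ℂ} {z : ℂ} {G : Finset (Var l) → ℂ}
    (h0 : G ∅ ≠ 0) (hG : IsCoeffFamily t z G)
    (ht : ∀ a b : Var l, a ≠ b → rootPairing a.1 b.1 ≠ 0 → t a ≠ t b)
    (hz : ∀ a : Var l, weightPairing a.1 (omegaOne r) ≠ 0 → t a ≠ z)
    {k : ℕ} {e e' : ℕ → Var l} (he : IsPairing k e e') (n : ℕ) :
    ∀ j, k ≤ j → j + n = r → ∃ R : ℂ, R ≠ 0 ∧ ∀ s : ℕ → Var l, (∀ i < j, (s i).1.val = i) →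
      G (singlesAndRest j s) = R * (chainProd t z s j *
        if j < r then
          ((t (e j) - prevPoint t z s j) * (t (e' j) - prevPoint t z s j))⁻¹ else 1) := by
  induction n with
  | zero =>
    intro j hkj hj
    obtain ⟨C, hC, h⟩ := exists_coeff_singles hr h0 hG j (by omega)
    refine ⟨C, hC, fun s hs => ?_⟩
    have : Finset.univ.filter (fun a : Var l => j ≤ a.1.val) = ∅ :=
      Finset.filter_eq_empty_iff.2 fun a _ => by omega
    rw [singlesAndRest, this, Finset.union_empty, h s hs, if_neg (by omega), mul_one]
  | succ n ih =>
    intro j hkj hjn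
    have hj : j < r := by omega
    obtain ⟨R, hR, h⟩ := ih (j + 1) (by omega) (by omega)
    -- The set has `2r - j` elements, and from that height it is color `j` that leads one step up in
    -- weight.
    obtain ⟨κ, hκ, hrec⟩ := hG ⟨j, hj⟩ (2 * r - j) (Or.inr (by simp; omega))
    have hne : ∀ a b : Var l, a ≠ b → (a.1.val = b.1.val ∨ a.1.val + 1 = b.1.val ∨
        b.1.val + 1 = a.1.val) → t a ≠ t b := fun a b hab h =>
      ht a b hab (rootPairing_ne_zero (by rwa [Fin.ext_iff]))
    have hcol := he.color j hkj hj
    have hcol' := he.color' j hkj hj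
    have hab : t (e j) ≠ t (e' j) := hne _ _ (he.ne j hkj hj) (Or.inl (by omega))
    have hprev : ∀ s : ℕ → Var l, (∀ i < j, (s i).1.val = i) → ∀ a : Var l, a.1.val = j →
        t a ≠ prevPoint t z s j := fun s hs a ha => ne_prevPoint ht hz hs ha
    have hmem : ∀ s : ℕ → Var l, e j ∈ singlesAndRest j s := fun s =>
      mem_singlesAndRest.2 (Or.inr hcol.ge)
    have hmem' : ∀ s : ℕ → Var l, e' j ∈ singlesAndRest j s := fun s =>
      mem_singlesAndRest.2 (Or.inr hcol'.ge)
    have hupd : ∀ s : ℕ → Var l, (∀ i < j, (s i).1.val = i) → ∀ a : Var l, a.1.val = j →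
        ∀ i < j + 1, (Function.update s j a i).1.val = i := fun s hs a ha i hi => by
      by_cases h : i = j
      · rw [h, Function.update_self, ha]
      · rw [Function.update_of_ne h, hs i (by omega)]
    have hchain : ∀ (s : ℕ → Var l) (a : Var l), chainProd t z (Function.update s j a) (j + 1) =
        chainProd t z s j * (t a - prevPoint t z s j)⁻¹ := fun s a => by
      have hp : ∀ i ≤ j, prevPoint t z (Function.update s j a) i = prevPoint t z s i :=
        fun i hi => by
          rw [prevPoint, prevPoint]
          split_ifs
          · rfl
          · rw [Function.update_of_ne (by omega)]
      rw [chainProd, Finset.prod_range_succ, Function.update_self, hp j le_rfl, chainProd]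
      congr 1
      refine Finset.prod_congr rfl fun i hi => ?_
      have hi := Finset.mem_range.1 hi
      rw [Function.update_of_ne hi.ne, hp i hi.le]
    have hprev1 : ∀ (s : ℕ → Var l) (a : Var l),
        prevPoint t z (Function.update s j a) (j + 1) = t a := fun s a => by
      rw [prevPoint, if_neg (by omega), Nat.add_sub_cancel, Function.update_self]
    have main : ∀ s : ℕ → Var l, (∀ i < j, (s i).1.val = i) → κ * G (singlesAndRest j s) =
        kCoeff t z (omegaOne r) (e j) (singlesAndRest (j + 1) (Function.update s j (e' j))) *
          G (singlesAndRest (j + 1) (Function.update s j (e' j))) +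
        kCoeff t z (omegaOne r) (e' j) (singlesAndRest (j + 1) (Function.update s j (e j))) *
          G (singlesAndRest (j + 1) (Function.update s j (e j))) := fun s hs => by
      rw [hrec _ (by have := card_singlesAndRest he hkj hj.le hs; omega),
        sum_filter_color he hkj hj _ (hmem s) (hmem' s), erase_singlesAndRest he hkj hj hs,
        erase_singlesAndRest he.swap hkj hj hs]
    by_cases hj1 : j + 1 < r
    · have hc1 := he.color (j + 1) (by omega) hj1
      have hc1' := he.color' (j + 1) (by omega) hj1
      have hneq : ∀ a b : Var l, a.1.val = j → b.1.val = j + 1 → t a ≠ t b := fun a b ha hb =>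
        hne a b (fun h => by rw [h] at ha; omega) (by omega)
      have h1 := hneq _ _ hcol hc1
      have h2 := hneq _ _ hcol hc1'
      have h3 := hneq _ _ hcol' hc1
      have h4 := hneq _ _ hcol' hc1'
      have hsy : (symm (⟨j, hj⟩ : Fin r) : ℂ) = 2 := by
        rw [symm, if_neg (by simp; omega)]; norm_num
      refine ⟨κ⁻¹ * (R * ((t (e j) - t (e' j)) ^ 2 /
        ((t (e (j + 1)) - t (e j)) * (t (e' (j + 1)) - t (e j)) *
          ((t (e (j + 1)) - t (e' j)) * (t (e' (j + 1)) - t (e' j)))))), ?_, fun s hs => ?_⟩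
      · refine mul_ne_zero (inv_ne_zero hκ) (mul_ne_zero hR (div_ne_zero
          (pow_ne_zero _ (sub_ne_zero.2 hab)) (mul_ne_zero (mul_ne_zero ?_ ?_)
          (mul_ne_zero ?_ ?_)))) <;> exact sub_ne_zero.2 (Ne.symm ‹_›)
      · rw [mul_assoc κ⁻¹, eq_inv_mul_iff_mul_eq₀ hκ, main s hs,
          kCoeff_singlesAndRest hr he t z hkj hj hs, kCoeff_singlesAndRest hr he.swap t z hkj hj hs,
          h _ (hupd s hs _ hcol), h _ (hupd s hs _ hcol'), hchain, hchain, hprev1, hprev1,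
          if_pos hj1, if_pos hj1, if_pos hj1, if_pos hj1, if_pos hj, hsy]
        have := long_pair_identity hab (hprev s hs _ hcol) (hprev s hs _ hcol') h1 h2 h3 h4
        linear_combination (R * chainProd t z s j) * this
    · have hsy : (symm (⟨j, hj⟩ : Fin r) : ℂ) = 1 := by
        rw [symm, if_pos (by simp; omega)]; norm_num
      refine ⟨κ⁻¹ * (R * 2), mul_ne_zero (inv_ne_zero hκ) (mul_ne_zero hR two_ne_zero),
        fun s hs => ?_⟩
      rw [mul_assoc κ⁻¹, eq_inv_mul_iff_mul_eq₀ hκ, main s hs,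
        kCoeff_singlesAndRest hr he t z hkj hj hs, kCoeff_singlesAndRest hr he.swap t z hkj hj hs,
        h _ (hupd s hs _ hcol), h _ (hupd s hs _ hcol'), hchain, hchain,
        if_neg hj1, if_neg hj1, if_neg hj1, if_neg hj1, if_pos hj, hsy]
      have := short_pair_identity hab (hprev s hs _ hcol) (hprev s hs _ hcol')
      linear_combination (R * chainProd t z s j) * this

theorem var_ext {a b : Var l} (h : a.1 = b.1) (hl : l a.1 = 1) : a = b := by
  obtain ⟨i, x⟩ := a
  obtain ⟨j, y⟩ := b
  obtain rfl : i = j := h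
  have : x = y := Fin.ext (by have := x.2; have := y.2; simp only at hl; omega)
  rw [this]

theorem exists_enumeration {k : ℕ} (hk : 0 < k) (hkr : k ≤ r)
    (hl : ∀ i, l i = if i.val < k then 1 else 0) :
    ∃ s : ℕ → Var l, (∀ i < k, (s i).1.val = i) ∧ Finset.univ = (Finset.range k).image s := by
  have hl' : ∀ i : Fin r, i.val < k → l i = 1 := fun i hi => by rw [hl, if_pos hi]
  have hex : ∀ i, ∃ a : Var l, i < k → a.1.val = i := fun i => by
    by_cases hi : i < k
    · exact ⟨⟨⟨i, by omega⟩, ⟨0, by rw [hl' _ hi]; exact one_pos⟩⟩, fun _ => rfl⟩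
    · exact ⟨⟨⟨0, by omega⟩, ⟨0, by rw [hl' _ hk]; exact one_pos⟩⟩, fun h => absurd h hi⟩
  choose s hs using hex
  refine ⟨s, hs, (Finset.eq_univ_iff_forall.2 fun a => ?_).symm⟩
  have ha : a.1.val < k := by
    by_contra h
    have h1 := a.2.2
    have h2 := hl a.1
    rw [if_neg h] at h2
    omega
  refine Finset.mem_image.2 ⟨a.1, Finset.mem_range.2 ha, ?_⟩
  have h1 : (s a.1).1 = a.1 := Fin.ext (hs _ ha)
  exact var_ext h1 (by rw [h1]; exact hl' a.1 ha)

theorem exists_pairing {k : ℕ} (hkr : k < r) (hl : ∀ i, l i = if i.val < k then 1 else 2) :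
    ∃ s e e' : ℕ → Var l, (∀ i < k, (s i).1.val = i) ∧ IsPairing k e e' ∧
      Finset.univ = singlesAndRest k s := by
  have hl1 : ∀ i : Fin r, i.val < k → l i = 1 := fun i hi => by rw [hl, if_pos hi]
  have hl2 : ∀ i : Fin r, k ≤ i.val → l i = 2 := fun i hi => by rw [hl, if_neg (by omega)]
  have hne : Nonempty (Var l) := ⟨⟨⟨k, hkr⟩, ⟨0, by rw [hl2 _ le_rfl]; exact two_pos⟩⟩⟩
  have hex : ∀ i, ∃ a : Var l, i < k → a.1.val = i := fun i => by
    by_cases hi : i < k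
    · exact ⟨⟨⟨i, by omega⟩, ⟨0, by rw [hl1 _ hi]; exact one_pos⟩⟩, fun _ => rfl⟩
    · exact ⟨hne.some, fun h => absurd h hi⟩
  have hex2 : ∀ i, ∃ a b : Var l, k ≤ i → i < r →
      a.1.val = i ∧ b.1.val = i ∧ a ≠ b ∧ ∀ c : Var l, c.1.val = i → c = a ∨ c = b := fun i => by
    by_cases hi : k ≤ i ∧ i < r
    · have h2 := hl2 ⟨i, hi.2⟩ hi.1
      refine ⟨⟨⟨i, hi.2⟩, ⟨0, by omega⟩⟩, ⟨⟨i, hi.2⟩, ⟨1, by omega⟩⟩, fun _ _ =>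
        ⟨rfl, rfl, fun h => ?_, ?_⟩⟩
      · have := eq_of_heq (Sigma.mk.inj h).2
        simp at this
      · rintro ⟨⟨j, hj⟩, x⟩ rfl
        rcases Nat.lt_or_ge x.val 1 with h | h
        · exact Or.inl (congrArg _ (Fin.ext (by simp; omega)))
        · exact Or.inr (congrArg _ (Fin.ext (by have := x.2; simp only at h2 ⊢; omega)))
    · exact ⟨hne.some, hne.some, fun h1 h2 => absurd ⟨h1, h2⟩ hi⟩
  choose s hs using hex
  choose e e' he using hex2
  refine ⟨s, e, e', hs, ⟨fun i h1 h2 => (he i h1 h2).1, fun i h1 h2 => (he i h1 h2).2.1,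
    fun i h1 h2 => (he i h1 h2).2.2.1, fun a ha => (he a.1 ha a.1.2).2.2.2 a rfl⟩,
    (Finset.eq_univ_iff_forall.2 fun a => mem_singlesAndRest.2 ?_).symm⟩
  by_cases ha : a.1.val < k
  · refine Or.inl ⟨a.1, ha, ?_⟩
    have h1 : (s a.1).1 = a.1 := Fin.ext (hs _ ha)
    exact var_ext h1 (by rw [h1]; exact hl1 a.1 ha)
  · exact Or.inr (by omega)

theorem coeff_univ_ne_zero (hr : 2 ≤ r) (hl : HasAdmissibleForm l) {t : Var l → ℂ} {z : ℂ}
    {G : Finset (Var l) → ℂ} (h0 : G ∅ ≠ 0) (hG : IsCoeffFamily t z G)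
    (ht : ∀ a b : Var l, a ≠ b → rootPairing a.1 b.1 ≠ 0 → t a ≠ t b)
    (hz : ∀ a : Var l, weightPairing a.1 (omegaOne r) ≠ 0 → t a ≠ z) : G Finset.univ ≠ 0 := by
  obtain ⟨k, hkr, hl⟩ := hl
  -- For `k = r` the two admissible forms coincide, and there are no pairs.
  by_cases hk : (∀ i, l i = if i.val < k then 1 else 0) ∨ k = r
  · have hl : ∀ i, l i = if i.val < k then 1 else 0 := by
      rcases hk with hk | rfl
      · exact hk
      · intro i
        rcases hl with hl | hl <;> simp [hl]
    rcases Nat.eq_zero_or_pos k with rfl | hk0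
    · have : (Finset.univ : Finset (Var l)) = ∅ := by
        refine Finset.univ_eq_empty_iff.2 ⟨fun a => ?_⟩
        have h1 := a.2.2
        have h2 := hl a.1
        rw [if_neg (by omega)] at h2
        omega
      rwa [this]
    · obtain ⟨s, hs, hu⟩ := exists_enumeration hk0 hkr hl
      obtain ⟨C, hC, h⟩ := exists_coeff_singles hr h0 hG k hkr
      rw [hu, h s hs]
      exact mul_ne_zero hC (chainProd_ne_zero ht hz hs)
  · push Not at hk
    obtain ⟨s, e, e', hs, he, hu⟩ := exists_pairing (by omega : k < r)
      (hl.resolve_left fun h => by obtain ⟨i, hi⟩ := hk.1; exact hi (h i))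
    obtain ⟨R, hR, h⟩ := exists_coeff_pairs hr h0 hG ht hz he (r - k) k le_rfl (by omega)
    rw [hu, h s hs, if_pos (by omega)]
    exact mul_ne_zero hR (mul_ne_zero (chainProd_ne_zero ht hz hs) (inv_ne_zero (mul_ne_zero
      (sub_ne_zero.2 (ne_prevPoint ht hz hs (he.color k le_rfl (by omega))))
      (sub_ne_zero.2 (ne_prevPoint ht hz hs (he.color' k le_rfl (by omega)))))))

end LeadingCoefficient

/-! ### Coordinates in the vector representation -/

section Coordinates

variable {r : ℕ} {l : Fin r → ℕ} {W : Type*} [AddCommGroup W] [Module ℂ W]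
  [LieRingModule (so r) W] [LieModule ℂ (so r) W]

/-- The basis `b` identifies the module `W` with the vector representation. -/
def IsVectorBasis (b : Module.Basis (Idx r) ℂ W) : Prop :=
  ∀ (x : so r) a, ⁅x, b a⁆ = ∑ c, x.1 c a • b c

variable {b : Module.Basis (Idx r) ℂ W}

theorem IsVectorBasis.coord_lie (hb : IsVectorBasis b) (x : so r) (y : W) (c : Idx r) :
    b.coord c ⁅x, y⁆ = ∑ a, x.1 c a * b.coord a y := by
  conv_lhs => rw [← b.sum_repr y, lie_sum]
  simp only [lie_smul, hb x, map_sum, map_smul, smul_eq_mul, Module.Basis.coord_apply,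
    Module.Basis.repr_self, Finsupp.single_apply]
  refine Finset.sum_congr rfl fun a _ => ?_
  simp [mul_comm]

theorem IsVectorBasis.mem_Dspace (hb : IsVectorBasis b) (a : Idx r) :
    b a ∈ Dspace r W ((r : ℂ) - ht a) := by
  rw [GaudinB.mem_Dspace, hb, Finset.sum_eq_single a]
  · simp [D]
  · intro c _ hc
    simp [D, Matrix.diagonal_apply_ne _ hc]
  · simp

theorem IsVectorBasis.coord_eq_zero (hb : IsVectorBasis b) {n : ℕ} {y : W}
    (hy : y ∈ Dspace r W ((r : ℂ) - n)) {a : Idx r} (ha : ht a ≠ n) : b.coord a y = 0 := by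
  have h := congrArg (b.coord a) (GaudinB.mem_Dspace.1 hy)
  rw [hb.coord_lie, Finset.sum_eq_single a, map_smul, smul_eq_mul] at h
  · simp only [D, Matrix.diagonal_apply_eq] at h
    have h1 : ((n : ℂ) - ht a) * b.coord a y = 0 := by linear_combination h
    refine (mul_eq_zero.1 h1).resolve_left (sub_ne_zero.2 fun h2 => ha ?_)
    exact (Nat.cast_injective h2).symm
  · intro c _ hc
    simp [D, Matrix.diagonal_apply_ne _ hc.symm]
  · simp

theorem IsVectorBasis.topWeight_eq (hb : IsVectorBasis b) {w : W}
    (hw : IsHighestWeightVector (omegaOne r) w) (hbw : ∀ a, ht a = 0 → b a = w) :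
    topWeight (omegaOne r) = r := by
  obtain ⟨a, ha⟩ := exists_ht_eq (r := r) (m := 0) (by omega)
  have h1 := GaudinB.mem_Dspace.1 (hb.mem_Dspace a)
  rw [hbw a ha, lie_D_of_lie_H hw.lie_H, ha, Nat.cast_zero, sub_zero] at h1
  exact smul_left_injective ℂ hw.ne_zero h1

theorem sum_E_apply (i : Fin r) {a : Idx r} {n : ℕ} (ha : ht a = n)
    (hn : n = i + 1 ∨ n + i = 2 * r) : ∑ c, (E i).1 c a ≠ 0 := by
  obtain ⟨p, hp⟩ := exists_ht_eq (r := r) (m := i) (by omega)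
  obtain ⟨q, hq⟩ := exists_ht_eq (r := r) (m := 2 * r - 1 - i) (by omega)
  rw [E_eq_wedge (b := q) hp (by omega)]
  simp only [wedge, wedgeMat_apply, Finset.sum_sub_distrib, ite_and, Finset.sum_ite_eq',
    Finset.mem_univ, if_true]
  rcases hn with hn | hn
  · rw [if_pos (by rw [eq_bar_iff_ht]; omega), if_neg (by rw [eq_bar_iff_ht]; omega), sub_zero]
    exact nrm_ne_zero q
  · rw [if_neg (by rw [eq_bar_iff_ht]; omega), if_pos (by rw [eq_bar_iff_ht]; omega), zero_sub]
    exact neg_ne_zero.2 (nrm_ne_zero p)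

theorem IsVectorBasis.sum_coord_eq (hb : IsVectorBasis b) {n : ℕ} {y : W}
    (hy : y ∈ Dspace r W ((r : ℂ) - n)) {a : Idx r} (ha : ht a = n) :
    ∑ c, b.coord c y = b.coord a y :=
  Finset.sum_eq_single a (fun c _ hc => hb.coord_eq_zero hy fun h =>
    hc (ht_injective (h.trans ha.symm))) (by simp)

/-- At a given height only one coordinate is nonzero, so the sum of all coordinates selects it
without reference to its index. The constant is the single nonzero entry of `E i` in the
corresponding column. -/
theorem IsWeightFamily.isCoeffFamily (hb : IsVectorBasis b) {w : W}
    (hw : IsHighestWeightVector (omegaOne r) w) (hbw : ∀ a, ht a = 0 → b a = w)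
    {t : Var l → ℂ} {z : ℂ} {g : Finset (Var l) → W}
    (hg : IsWeightFamily t z (omegaOne r) w g) :
    IsCoeffFamily t z fun S => ∑ c, b.coord c (g S) := by
  intro i n hn
  obtain ⟨a, ha⟩ := exists_ht_eq (r := r) (m := n) (by omega)
  refine ⟨∑ c, (E i).1 c a, sum_E_apply i ha hn, fun S hS => ?_⟩
  have hy := hg.mem_Dspace S
  rw [hb.topWeight_eq hw hbw, hS] at hy
  have h := congrArg (fun y => ∑ c, b.coord c y) (hg.lie_E i S)
  simp only [map_sum, map_smul, smul_eq_mul, hb.coord_lie] at h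
  rw [Finset.sum_comm (s := Finset.univ) (t := Finset.filter _ _)] at h
  simp only [← Finset.mul_sum] at h
  change _ * ∑ c, b.coord c (g S) = _
  rw [← h, hb.sum_coord_eq hy ha, Finset.sum_mul]
  refine Finset.sum_congr rfl fun c _ => ?_
  rw [Finset.sum_eq_single a]
  · exact fun d _ hd => by
      rw [hb.coord_eq_zero hy fun h => hd (ht_injective (h.trans ha.symm)), mul_zero]
  · simp

theorem IsWeightFamily.coord_univ_ne_zero (hr : 2 ≤ r) (hl : HasAdmissibleForm l)
    (hb : IsVectorBasis b) {w : W}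
    (hw : IsHighestWeightVector (omegaOne r) w) (hbw : ∀ a, ht a = 0 → b a = w)
    {t : Var l → ℂ} {z : ℂ} {g : Finset (Var l) → W}
    (hg : IsWeightFamily t z (omegaOne r) w g)
    (ht : ∀ a b : Var l, a ≠ b → rootPairing a.1 b.1 ≠ 0 → t a ≠ t b)
    (hz : ∀ a : Var l, weightPairing a.1 (omegaOne r) ≠ 0 → t a ≠ z) {a : Idx r}
    (ha : GaudinB.ht a = Fintype.card (Var l)) : b.coord a (g Finset.univ) ≠ 0 := by
  have hy := hg.mem_Dspace Finset.univ
  rw [hb.topWeight_eq hw hbw, Finset.card_univ] at hy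
  rw [← hb.sum_coord_eq hy ha]
  refine coeff_univ_ne_zero hr hl (G := fun S => ∑ c, b.coord c (g S)) ?_
    (hg.isCoeffFamily hb hw hbw) ht hz
  have hy0 := hg.mem_Dspace ∅
  rw [hb.topWeight_eq hw hbw, Finset.card_empty] at hy0
  obtain ⟨a0, ha0⟩ := exists_ht_eq (r := r) (m := 0) (by omega)
  change ∑ c, b.coord c (g ∅) ≠ 0
  rw [hb.sum_coord_eq hy0 ha0, hg.map_empty, ← hbw a0 ha0]
  simp

end Coordinates

/-! ### The Casimir tensor -/

section Casimir

variable {r : ℕ}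

theorem form_wedge (a b : Idx r) (y : so r) :
    form (wedge a b) y = (1 / 2) * (nrm b * y.1 (bar b) a) := by
  have h := (mem_so_iff_apply y.1).1 y.2 a b
  have hw : (wedge a b).1 = nrm b • Matrix.single a (bar b) 1 - nrm a • Matrix.single b (bar a) 1 :=
    rfl
  rw [form, hw, Matrix.sub_mul, Matrix.smul_mul, Matrix.smul_mul, Matrix.trace_sub,
    Matrix.trace_smul, Matrix.trace_smul, Matrix.trace_single_mul, Matrix.trace_single_mul]
  simp only [smul_eq_mul, one_mul]
  linear_combination -(1 / 4) * h

/-- The element of `so(2r+1)` dual to the matrix coefficient `(p, q)`. -/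
def coeffDual (p q : Idx r) : so r := (2 / nrm p) • wedge q (bar p)

theorem form_smul_left (c : ℂ) (x y : so r) : form (c • x) y = c * form x y := by
  simp [form]; ring

theorem form_sum_left {ι : Type*} (S : Finset ι) (x : ι → so r) (y : so r) :
    form (∑ k ∈ S, x k) y = ∑ k ∈ S, form (x k) y := by
  simp [form, Finset.sum_mul, Matrix.trace_sum, Finset.mul_sum]

theorem form_coeffDual (p q : Idx r) (y : so r) : form (coeffDual p q) y = y.1 p q := by
  have := nrm_ne_zero p
  rw [coeffDual, form_smul_left, form_wedge, bar_bar, nrm_bar]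
  field_simp

/-- Invariance and symmetry of the trace form combined: the adjoint action is skew, which is what
makes the Casimir tensor invariant. -/
theorem form_lie (y a b : so r) : form ⁅y, a⁆ b = - form ⁅y, b⁆ a := by
  simp only [form, LieSubalgebra.coe_bracket, Ring.lie_def, Matrix.sub_mul, Matrix.trace_sub]
  rw [Matrix.trace_mul_cycle y.1 a.1 b.1, ← Matrix.trace_mul_cycle y.1 b.1 a.1,
    Matrix.trace_mul_cycle y.1 b.1 a.1, Matrix.trace_mul_cycle b.1 y.1 a.1]
  ring

variable {ι : Type*} [Fintype ι] [DecidableEq ι] {x : Module.Basis ι ℂ (so r)}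

theorem IsOrthonormalBasis.repr_eq (hx : IsOrthonormalBasis x) (y : so r) (k : ι) :
    x.repr y k = form y (x k) := by
  conv_rhs => rw [← x.sum_repr y, form_sum_left]
  simp [form_smul_left, hx _ k]

theorem IsOrthonormalBasis.sum_form_smul (hx : IsOrthonormalBasis x) (y : so r) :
    ∑ k, form y (x k) • x k = y := by
  simp only [← hx.repr_eq]
  exact x.sum_repr y

theorem IsOrthonormalBasis.sum_coeff_smul (hx : IsOrthonormalBasis x) (p q : Idx r) :
    ∑ k, (x k).1 p q • x k = coeffDual p q := by
  conv_rhs => rw [← hx.sum_form_smul (coeffDual p q)]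
  simp only [form_coeffDual]

/-- The Casimir tensor is invariant. -/
theorem IsOrthonormalBasis.sum_lie_add (hx : IsOrthonormalBasis x) {Y : Type*} [AddCommGroup Y]
    [Module ℂ Y] (B : so r →ₗ[ℂ] so r →ₗ[ℂ] Y) (y : so r) :
    ∑ k, (B ⁅y, x k⁆ (x k) + B (x k) ⁅y, x k⁆) = 0 := by
  have h1 : ∀ k, B ⁅y, x k⁆ (x k) = ∑ j, form ⁅y, x k⁆ (x j) • B (x j) (x k) := fun k => by
    conv_lhs => rw [← hx.sum_form_smul ⁅y, x k⁆]
    simp [map_sum, LinearMap.sum_apply]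
  have h2 : ∀ k, B (x k) ⁅y, x k⁆ = ∑ j, form ⁅y, x k⁆ (x j) • B (x k) (x j) := fun k => by
    conv_lhs => rw [← hx.sum_form_smul ⁅y, x k⁆]
    simp [map_sum]
  simp only [Finset.sum_add_distrib, h1, h2]
  rw [Finset.sum_comm, ← Finset.sum_add_distrib]
  refine Finset.sum_eq_zero fun k _ => ?_
  rw [← Finset.sum_add_distrib]
  refine Finset.sum_eq_zero fun j _ => ?_
  rw [form_lie y (x j) (x k), neg_smul, neg_add_cancel]

end Casimir

/-! ### The action of the Casimir tensor on singular vectors. -/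

section Omega

variable {r : ℕ} {V W : Type*}
  [AddCommGroup V] [Module ℂ V] [LieRingModule (so r) V] [LieModule ℂ (so r) V]
  [AddCommGroup W] [Module ℂ W] [LieRingModule (so r) W] [LieModule ℂ (so r) W]
  {ι : Type*} [Fintype ι] {x : Module.Basis ι ℂ (so r)}

theorem Omega_tmul (v : V) (w : W) :
    Omega V W x 0 1 (v ⊗ₜ[ℂ] w) = ∑ k, ⁅x k, v⁆ ⊗ₜ[ℂ] ⁅x k, w⁆ := by
  simp [Omega, siteAction, LinearMap.sum_apply]

theorem Omega_comm : Omega V W x 1 0 = Omega V W x 0 1 := by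
  refine TensorProduct.ext' fun v w => ?_
  simp [Omega, siteAction, LinearMap.sum_apply]

variable [DecidableEq ι]

theorem lie_Omega (hx : IsOrthonormalBasis x) (y : so r) (u : V ⊗[ℂ] W) :
    ⁅y, Omega V W x 0 1 u⁆ = Omega V W x 0 1 ⁅y, u⁆ := by
  induction u using TensorProduct.induction_on with
  | zero => simp
  | add u u' h h' => rw [map_add, lie_add, h, h', lie_add, map_add]
  | tmul v w =>
    let B : so r →ₗ[ℂ] so r →ₗ[ℂ] V ⊗[ℂ] W := (TensorProduct.mk ℂ V W).compl₁₂
      ((LieModule.toEnd ℂ (so r) V).toLinearMap.flip v)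
      ((LieModule.toEnd ℂ (so r) W).toLinearMap.flip w)
    have hB : ∀ a b, B a b = ⁅a, v⁆ ⊗ₜ[ℂ] ⁅b, w⁆ := fun a b => rfl
    have h := hx.sum_lie_add B y
    simp only [hB] at h
    rw [TensorProduct.LieModule.lie_tmul_right, map_add, Omega_tmul, Omega_tmul, Omega_tmul,
      lie_sum, ← Finset.sum_add_distrib, ← sub_eq_zero, ← Finset.sum_sub_distrib, ← h]
    refine Finset.sum_congr rfl fun k _ => ?_
    rw [TensorProduct.LieModule.lie_tmul_right, lie_lie, lie_lie, TensorProduct.sub_tmul,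
      TensorProduct.tmul_sub]
    abel

variable {b : Module.Basis (Idx r) ℂ W}

variable (V b) in
/-- The coordinate of a tensor at the basis vector `b a`. -/
def comp (a : Idx r) : V ⊗[ℂ] W →ₗ[ℂ] V :=
  (TensorProduct.rid ℂ V).toLinearMap ∘ₗ (b.coord a).lTensor V

omit [LieRingModule (so r) V] [LieModule ℂ (so r) V] [LieRingModule (so r) W]
  [LieModule ℂ (so r) W] in
theorem comp_tmul (a : Idx r) (v : V) (w : W) : comp V b a (v ⊗ₜ[ℂ] w) = b.coord a w • v := by
  simp [comp]

omit [LieRingModule (so r) V] [LieModule ℂ (so r) V] [LieRingModule (so r) W]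
  [LieModule ℂ (so r) W] in
theorem sum_comp_tmul (u : V ⊗[ℂ] W) : ∑ a, comp V b a u ⊗ₜ[ℂ] b a = u := by
  induction u using TensorProduct.induction_on with
  | zero => simp
  | add u u' h h' =>
    conv_rhs => rw [← h, ← h']
    simp [TensorProduct.add_tmul, Finset.sum_add_distrib]
  | tmul v w =>
    conv_rhs => rw [← b.sum_repr w, TensorProduct.tmul_sum]
    refine Finset.sum_congr rfl fun a _ => ?_
    rw [comp_tmul, TensorProduct.smul_tmul, Module.Basis.coord_apply]

theorem comp_lie (hb : IsVectorBasis b) (y : so r) (u : V ⊗[ℂ] W) (a : Idx r) :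
    comp V b a ⁅y, u⁆ = ⁅y, comp V b a u⁆ + ∑ c, y.1 a c • comp V b c u := by
  induction u using TensorProduct.induction_on with
  | zero => simp
  | add u u' h h' =>
    simp only [lie_add, map_add, h, h', smul_add, Finset.sum_add_distrib]
    abel
  | tmul v w =>
    rw [TensorProduct.LieModule.lie_tmul_right, map_add, comp_tmul, comp_tmul, comp_tmul,
      hb.coord_lie, lie_smul, Finset.sum_smul]
    simp only [comp_tmul, smul_smul]

/-- In the basis `b`, `Ω` becomes a matrix with entries in the Lie algebra acting on `V`;
orthonormality turns each entry into a single multiple of a wedge. -/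
theorem comp_Omega (hx : IsOrthonormalBasis x) (hb : IsVectorBasis b) (u : V ⊗[ℂ] W)
    (p : Idx r) : comp V b p (Omega V W x 0 1 u) = ∑ q, ⁅coeffDual p q, comp V b q u⁆ := by
  conv_lhs => rw [← sum_comp_tmul (b := b) u]
  rw [map_sum, map_sum]
  refine Finset.sum_congr rfl fun q _ => ?_
  rw [Omega_tmul, map_sum, ← hx.sum_coeff_smul, sum_lie]
  refine Finset.sum_congr rfl fun k _ => ?_
  rw [comp_tmul, hb.coord_lie, smul_lie]
  congr 1
  simp [Finsupp.single_apply]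

/-- A singular vector is determined by its coordinate of the appropriate height. -/
theorem eq_zero_of_comp_eq_zero [LieModule.IsIrreducible ℂ (so r) V] (hb : IsVectorBasis b)
    {Λ : Fin r → ℕ} {v : V} (hv : IsHighestWeightVector Λ v) {u : V ⊗[ℂ] W} {n : ℕ}
    (hE : ∀ i, ⁅(E i : so r), u⁆ = 0) (hD : u ∈ Dspace r _ (topWeight Λ + (r - n)))
    (h0 : ∀ a, ht a = n → comp V b a u = 0) : u = 0 := by
  -- Descending in the height: once all components of larger height vanish, the next one is singular
  -- in `V`. If it were nonzero it would have the weight of `v`, which happens only at height `n`.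
  have main : ∀ m : ℕ, ∀ a : Idx r, ht a + m = 2 * r → comp V b a u = 0 := by
    intro m
    induction m using Nat.strong_induction_on with
    | _ m ih =>
      intro a ha
      by_contra hne
      have h1 : ∀ i, ⁅(E i : so r), comp V b a u⁆ = 0 := fun i => by
        have h := comp_lie hb (E i) u a
        rw [hE, map_zero, Finset.sum_eq_zero, add_zero] at h
        · exact h.symm
        · intro c _
          by_cases hc : ht a < ht c
          · have := ht_le c
            rw [ih (2 * r - ht c) (by omega) c (by omega), smul_zero]
          · obtain ⟨p, hp⟩ := exists_ht_eq (r := r) (m := i) (by omega)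
            obtain ⟨q, hq⟩ := exists_ht_eq (r := r) (m := 2 * r - 1 - i) (by omega)
            have h2 : ¬ (a = p ∧ c = bar q) := by
              rintro ⟨rfl, h⟩; rw [eq_bar_iff_ht] at h; omega
            have h3 : ¬ (a = q ∧ c = bar p) := by
              rintro ⟨rfl, h⟩; rw [eq_bar_iff_ht] at h; omega
            rw [E_eq_wedge (b := q) hp (by omega)]
            simp only [wedge, wedgeMat_apply, if_neg h2, if_neg h3, sub_zero, zero_smul]
      have h2 : comp V b a u ∈ Dspace r V (topWeight Λ + (ht a - n)) := by
        have h := comp_lie hb (D r) u a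
        rw [mem_Dspace.1 hD, map_smul, Finset.sum_eq_single a] at h
        · have hDa : (D r).1 a a = r - ht a := by simp [D]
          rw [hDa] at h
          rw [mem_Dspace, ← sub_eq_iff_eq_add.2 h]
          module
        · intro c _ hc
          simp [D, Matrix.diagonal_apply_ne _ hc.symm]
        · simp
      have h3 := (hv.eq_smul_of_singular hne h1 h2).1
      have h4 : ((ht a : ℕ) : ℂ) = n := by linear_combination h3
      exact hne (h0 a (Nat.cast_injective h4))
  rw [← sum_comp_tmul (b := b) u]
  refine Finset.sum_eq_zero fun a _ => ?_
  have := ht_le a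
  rw [main (2 * r - ht a) a (by omega), TensorProduct.zero_tmul]

theorem wedge_lie_eq_zero {u : V ⊗[ℂ] W} (hE : ∀ i, ⁅(E i : so r), u⁆ = 0) {p q : Idx r}
    (hpq : ht p + ht q < 2 * r) : ⁅wedge p q, u⁆ = 0 := by
  let S : LieSubalgebra ℂ (so r) :=
    { carrier := {y | ⁅y, u⁆ = 0}
      add_mem' := fun {a b} (ha : ⁅a, u⁆ = 0) (hb : ⁅b, u⁆ = 0) => by
        change ⁅a + b, u⁆ = 0
        rw [add_lie, ha, hb, add_zero]
      zero_mem' := zero_lie u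
      smul_mem' := fun c a (ha : ⁅a, u⁆ = 0) => by
        change ⁅c • a, u⁆ = 0
        rw [smul_lie, ha, smul_zero]
      lie_mem' := fun {a b} (ha : ⁅a, u⁆ = 0) (hb : ⁅b, u⁆ = 0) => by
        change ⁅⁅a, b⁆, u⁆ = 0
        rw [lie_lie, ha, hb, lie_zero, lie_zero, sub_zero] }
  exact wedge_mem_of_E_mem (S := S) hE (2 * r - 1 - (ht p + ht q)) p q (by omega)

/-- For `c` of smaller height than `a`, `coeffDual a c` is zero or a multiple of a positive root
vector. In the latter case it kills `u`, so its action on component `c` is minus its matrix entry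
times component `a`, and that entry is 2. The exception `c = bar a` is where the wedge is zero. -/
theorem comp_Omega_of_singular (hx : IsOrthonormalBasis x) (hb : IsVectorBasis b)
    {u : V ⊗[ℂ] W} (hE : ∀ i, ⁅(E i : so r), u⁆ = 0) {a : Idx r}
    (h0 : ∀ c, ht a < ht c → comp V b c u = 0) :
    comp V b a (Omega V W x 0 1 u) = ⁅coeffDual a a, comp V b a u⁆ -
      (2 * (Finset.univ.filter fun c => ht c < ht a ∧ c ≠ bar a).card : ℂ) • comp V b a u := by
  rw [comp_Omega hx hb, ← Finset.add_sum_erase _ _ (Finset.mem_univ a), sub_eq_add_neg]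
  congr 1
  have h1 : ∀ c ∈ Finset.univ.erase a, ⁅coeffDual a c, comp V b c u⁆ =
      if ht c < ht a ∧ c ≠ bar a then (-2 : ℂ) • comp V b a u else 0 := by
    intro c hc
    have hca : ht c ≠ ht a := fun h => Finset.ne_of_mem_erase hc (ht_injective h)
    split_ifs with h
    · have hz : ⁅coeffDual a c, u⁆ = 0 := by
        rw [coeffDual, smul_lie, wedge_lie_eq_zero hE, smul_zero]
        have := ht_le a
        rw [ht_bar]
        omega
      have h2 := comp_lie hb (coeffDual a c) u c
      rw [hz, map_zero, Finset.sum_eq_single a] at h2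
      · have h3 : (coeffDual a c).1 c a = 2 := by
          have := nrm_ne_zero a
          simp only [coeffDual, SetLike.val_smul, Matrix.smul_apply, wedge, wedgeMat_apply, bar_bar,
            and_self, if_true, nrm_bar, if_neg (fun h' : c = bar a ∧ a = bar c => h.2 h'.1),
            sub_zero, smul_eq_mul]
          field_simp
        rw [h3] at h2
        rw [neg_smul]
        exact eq_neg_of_add_eq_zero_left h2.symm
      · intro d _ hd
        have : (coeffDual a c).1 c d = 0 := by
          simp only [coeffDual, SetLike.val_smul, Matrix.smul_apply, wedge, wedgeMat_apply, bar_bar,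
            true_and, if_neg hd,
            if_neg (fun h' : c = bar a ∧ d = bar c => h.2 h'.1), sub_zero, smul_zero]
        rw [this, zero_smul]
      · simp
    · by_cases hlt : ht a < ht c
      · rw [h0 c hlt, lie_zero]
      · have hc' : c = bar a := by
          by_contra hne
          exact h ⟨by omega, hne⟩
        rw [coeffDual, hc', wedge_self, smul_zero, zero_lie]
  rw [Finset.sum_congr rfl h1, ← Finset.sum_filter, Finset.sum_const, ← Nat.cast_smul_eq_nsmul ℂ,
    smul_smul]
  have h2 : (Finset.univ.erase a).filter (fun c => ht c < ht a ∧ c ≠ bar a) =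
      Finset.univ.filter (fun c => ht c < ht a ∧ c ≠ bar a) := by
    ext c
    simp only [Finset.mem_filter, Finset.mem_erase, Finset.mem_univ, and_true, true_and]
    exact ⟨fun h => h.2, fun h => ⟨fun h' => by rw [h'] at h; exact absurd h.1 (lt_irrefl _), h⟩⟩
  rw [h2, ← neg_smul]
  congr 1
  ring

end Omega

/-! ### The eigenvalues -/

section Eigenvalue

variable {r : ℕ}

/-- The coordinates of a weight in the standard orthogonal basis `ε_1, …, ε_r`. -/
def weightCoord (Λ : Fin r → ℕ) (m : ℕ) : ℝ :=
  ∑ j ∈ Finset.Ico m r, if h : j < r then (Λ ⟨j, h⟩ : ℝ) / (if j + 1 = r then 2 else 1) else 0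

theorem weightCoord_self (Λ : Fin r → ℕ) : weightCoord Λ r = 0 := by simp [weightCoord]

theorem weightCoord_eq_add (Λ : Fin r → ℕ) (j : Fin r) :
    weightCoord Λ j = (Λ j : ℝ) / (if j.val + 1 = r then 2 else 1) + weightCoord Λ (j + 1) := by
  rw [weightCoord, Finset.sum_eq_sum_Ico_succ_bot j.2, dif_pos j.2, weightCoord]

theorem weightCoord_antitone (Λ : Fin r → ℕ) : Antitone (weightCoord Λ) := fun m n hmn => by
  refine Finset.sum_le_sum_of_subset_of_nonneg (Finset.Ico_subset_Ico_left hmn) fun j _ _ => ?_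
  split_ifs <;> positivity

theorem weightCoord_nonneg (Λ : Fin r → ℕ) (m : ℕ) : 0 ≤ weightCoord Λ m :=
  Finset.sum_nonneg fun j _ => by split_ifs <;> positivity

/-- The eigenvalue of the Casimir tensor on the singular vectors of height `L`. -/
def casimirValue (Λ : Fin r → ℕ) (L : ℕ) : ℝ :=
  if L ≤ r then 2 * weightCoord Λ L - 2 * L
  else -(2 * weightCoord Λ (2 * r - L)) - 2 * (L - 1)

/-- The linear terms give strict decrease except from `r` to `r + 1`, where crossing the middle
index costs nothing. There the difference is twice the last coordinate of the weight, which is half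
its last label. -/
theorem casimirValue_lt {Λ : Fin r → ℕ} {L M : ℕ} (hLM : L < M)
    (h : ∀ i : Fin r, i.val + 1 = r → L = r → Λ i ≠ 0) (hr : 0 < r) :
    casimirValue Λ M < casimirValue Λ L := by
  have hlt : (L : ℝ) + 1 ≤ M := by exact_mod_cast hLM
  have h1 := weightCoord_nonneg Λ L
  have h2 := weightCoord_nonneg Λ (2 * r - M)
  rw [casimirValue, casimirValue]
  split_ifs with hM hL hL
  · linarith [weightCoord_antitone Λ hLM.le]
  · omega
  · rcases hL.lt_or_eq with hL | hL
    · rcases (Nat.succ_le_of_lt hLM).lt_or_eq with hM' | hM'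
      · have : (L : ℝ) + 2 ≤ M := by exact_mod_cast hM'
        linarith
      · omega
    · rcases (Nat.succ_le_of_lt hLM).lt_or_eq with hM' | hM'
      · have : (L : ℝ) + 2 ≤ M := by exact_mod_cast hM'
        linarith
      · have h3 := weightCoord_eq_add Λ ⟨r - 1, by omega⟩
        have h4 := h ⟨r - 1, by omega⟩ (by simp; omega) hL
        have h5 : (0 : ℝ) < Λ ⟨r - 1, by omega⟩ := by exact_mod_cast Nat.pos_of_ne_zero h4
        have h6 := weightCoord_nonneg Λ (r - 1 + 1)
        rw [if_pos (by simp; omega)] at h3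
        have h7 : 2 * r - M = r - 1 := by omega
        rw [h7]
        simp only at h3
        linarith
  · have := weightCoord_antitone Λ (show 2 * r - M ≤ 2 * r - L by omega)
    linarith

theorem card_filter_ht_lt {m : ℕ} (hm : m ≤ 2 * r + 1) :
    (Finset.univ.filter fun c : Idx r => ht c < m).card = m := by
  rw [← Finset.card_image_of_injective _ ht_injective]
  conv_rhs => rw [← Finset.card_range m]
  congr 1
  ext n
  simp only [Finset.mem_image, Finset.mem_filter, Finset.mem_univ, true_and, Finset.mem_range]
  refine ⟨?_, fun hn => ?_⟩
  · rintro ⟨c, hc, rfl⟩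
    exact hc
  · obtain ⟨c, hc⟩ := exists_ht_eq (r := r) (m := n) (by omega)
    exact ⟨c, hc ▸ hn, hc⟩

theorem card_filter_ht_lt_ne_bar (a : Idx r) :
    (Finset.univ.filter fun c : Idx r => ht c < ht a ∧ c ≠ bar a).card =
      if ht a ≤ r then ht a else ht a - 1 := by
  have ha := ht_le a
  have hc := card_filter_ht_lt (r := r) (m := ht a) (by omega)
  have he : (Finset.univ.filter fun c : Idx r => ht c < ht a ∧ c ≠ bar a) =
      (Finset.univ.filter fun c : Idx r => ht c < ht a).erase (bar a) := by
    ext c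
    simp [and_comm]
  rw [he]
  split_ifs with h
  · rw [Finset.erase_eq_of_notMem, hc]
    simp only [Finset.mem_filter, ht_bar]
    omega
  · rw [Finset.card_erase_of_mem, hc]
    simp only [Finset.mem_filter, Finset.mem_univ, true_and, ht_bar]
    omega

variable {V : Type*} [AddCommGroup V] [Module ℂ V] [LieRingModule (so r) V]
  [LieModule ℂ (so r) V] {Λ : Fin r → ℕ} {v : V}

/-- Induction away from the middle index, where the wedge is zero: each coroot expresses one
diagonal wedge by the next. The halved last label comes from the norm 2 of the middle vector. -/
theorem wedge_bar_lie (hv : ∀ i, ⁅(H i : so r), v⁆ = (Λ i : ℂ) • v) {n : ℕ} {a : Idx r}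
    (ha : ht a + n = r) : ⁅wedge a (bar a), v⁆ = (weightCoord Λ (ht a) : ℂ) • v := by
  induction n generalizing a with
  | zero =>
    have : bar a = a := (eq_bar_iff_ht.2 (by omega : ht a + ht a = 2 * r)).symm
    rw [this, wedge_self, zero_lie, show ht a = r from ha, weightCoord_self, Complex.ofReal_zero,
      zero_smul]
  | succ n ih =>
    obtain ⟨c, hc⟩ := exists_ht_eq (r := r) (m := ht a + 1) (by omega)
    have h := hv ⟨ht a, by omega⟩
    rw [H_eq_wedge (a := a) rfl hc, sub_lie, smul_lie, ih (a := c) (by omega), sub_eq_iff_eq_add,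
      hc, ← add_smul] at h
    rw [← inv_smul_smul₀ (nrm_ne_zero c) ⁅wedge a (bar a), v⁆, h, smul_smul]
    congr 1
    rw [weightCoord_eq_add Λ ⟨ht a, by omega⟩]
    by_cases hr : ht a + 1 = r
    · rw [nrm_eq_two (by omega), if_pos hr, hr, weightCoord_self]
      push_cast
      ring
    · rw [nrm_eq_one (by omega), if_neg hr]
      push_cast
      ring

theorem coeffDual_lie_sub (hv : ∀ i, ⁅(H i : so r), v⁆ = (Λ i : ℂ) • v) (a : Idx r) :
    ⁅coeffDual a a, v⁆ - (2 * (Finset.univ.filter fun c => ht c < ht a ∧ c ≠ bar a).card : ℂ) • v =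
      (casimirValue Λ (ht a) : ℂ) • v := by
  have ha := ht_le a
  rw [card_filter_ht_lt_ne_bar, casimirValue, coeffDual, smul_lie]
  split_ifs with h
  · rw [wedge_bar_lie hv (n := r - ht a) (by omega), smul_smul, ← sub_smul]
    congr 1
    rcases h.lt_or_eq with h | h
    · rw [nrm_eq_one (by omega)]
      push_cast
      ring
    · rw [h, weightCoord_self]
      push_cast
      ring
  · have h1 := wedge_bar_lie hv (n := ht a - r) (a := bar a) (by rw [ht_bar]; omega)
    rw [bar_bar, ht_bar, wedge_swap, neg_lie, neg_eq_iff_eq_neg] at h1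
    rw [h1, nrm_eq_one (by omega), ← neg_smul, smul_smul, ← sub_smul]
    congr 1
    rw [Nat.cast_sub (by omega)]
    push_cast
    ring

end Eigenvalue

/-! ### Bethe vectors as eigenvectors. -/

section BetheVectorEigenvalue

variable {r : ℕ} {l : Fin r → ℕ}

theorem HasAdmissibleForm.sum_le (hl : HasAdmissibleForm l) : ∑ i, l i ≤ 2 * r := by
  have h : ∀ i ∈ Finset.univ, l i ≤ 2 := fun i _ => by
    obtain ⟨k, _, h | h⟩ := hl <;> rw [h] <;> split_ifs <;> norm_num
  have := Finset.sum_le_card_nsmul _ _ _ h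
  simpa [mul_comm] using this

theorem HasAdmissibleForm.eq_one (hl : HasAdmissibleForm l) (hs : ∑ i, l i = r) (i : Fin r) :
    l i = 1 := by
  have hr : ∑ _i : Fin r, 1 = r := by simp
  obtain ⟨k, _, h | h⟩ := hl
  · have h1 : ∀ i ∈ Finset.univ, l i ≤ 1 := fun i _ => by rw [h]; split_ifs <;> norm_num
    exact (Finset.sum_eq_sum_iff_of_le h1).1 (hs.trans hr.symm) i (Finset.mem_univ i)
  · have h1 : ∀ i ∈ Finset.univ, 1 ≤ l i := fun i _ => by rw [h]; split_ifs <;> norm_num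
    exact ((Finset.sum_eq_sum_iff_of_le h1).1 (hr.trans hs.symm) i (Finset.mem_univ i)).symm

theorem card_var (l : Fin r → ℕ) : Fintype.card (Var l) = ∑ i, l i := by simp

/-- For `(1, …, 1)` the variable of the last color is linked only to its predecessor and to the
label of `λ`. Without that label its Bethe equation is a single nonzero fraction equated to zero. -/
theorem label_ne_zero_of_isCriticalPoint (hr : 2 ≤ r) {z : Fin 2 → ℂ} {lam : Fin r → ℕ}
    {t : Var l → ℂ} (ht : IsCriticalPoint z ![lam, omegaOne r] l t) (hl : HasAdmissibleForm l)
    (hs : ∑ i, l i = r) {i : Fin r} (hi : i.val + 1 = r) : lam i ≠ 0 := by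
  obtain ⟨s, hs, hu⟩ := exists_enumeration (l := l) (k := r) (by omega) le_rfl
    fun j => by rw [if_pos j.2, hl.eq_one hs]
  have hsi := hs i (by omega)
  have hsi' : (s i).1 = i := Fin.ext hsi
  have hs' : ∀ j < i.val, (s j).1.val = j := fun j hj => hs j (by omega)
  have he : Finset.univ.erase (s i) = (Finset.range i).image s := by
    rw [hu, show Finset.range r = Finset.range (i.val + 1) by rw [hi], Finset.range_add_one,
      Finset.image_insert, Finset.erase_insert]
    rw [Finset.mem_image]
    rintro ⟨j, hj, h⟩
    have h1 := hs' j (Finset.mem_range.1 hj)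
    rw [h, hsi] at h1
    exact (Finset.mem_range.1 hj).ne h1.symm
  intro h0
  have h := kCoeff_add_kCoeff_eq_zero ht (s i) (T := ∅) (Finset.empty_subset _)
  rw [Finset.sdiff_empty, he, kCoeff, kCoeff, Finset.sum_image (injOn_of_color hs'), hsi'] at h
  have h1 := sum_range_cart hr t (z 1) i hs' (t (s i))
  simp only [Matrix.cons_val_zero, Matrix.cons_val_one, h0, Nat.cast_zero, zero_div,
    Finset.sum_empty, sub_zero, zero_add] at h
  rw [h] at h1
  refine div_ne_zero (div_ne_zero two_ne_zero (Int.cast_ne_zero.2 (symm_ne_zero i)))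
    (sub_ne_zero.2 ?_) h1.symm
  exact ne_prevPoint ht.ne_of_rootPairing (fun a => ht.ne_of_weightPairing a 1) hs' hsi

variable {V W : Type*}
  [AddCommGroup V] [Module ℂ V] [FiniteDimensional ℂ V] [LieRingModule (so r) V]
  [LieModule ℂ (so r) V] [LieModule.IsIrreducible ℂ (so r) V]
  [AddCommGroup W] [Module ℂ W] [LieRingModule (so r) W]
  [LieModule ℂ (so r) W] [LieModule.IsIrreducible ℂ (so r) W]
  {ι : Type*} [Fintype ι] [DecidableEq ι] {x : Module.Basis ι ℂ (so r)}

theorem Omega_hasEigenvector (hr : 2 ≤ r) (hx : IsOrthonormalBasis x) {lam : Fin r → ℕ} {v : V}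
    (hv : IsHighestWeightVector lam v) {w : W} (hw : IsHighestWeightVector (omegaOne r) w)
    {z : Fin 2 → ℂ} (hl : HasAdmissibleForm l) {t : Var l → ℂ}
    (ht : IsCriticalPoint z ![lam, omegaOne r] l t) :
    (Omega V W x 0 1).HasEigenvector (casimirValue lam (∑ i, l i) : ℂ) (betheVector z v w t) := by
  obtain ⟨b, hb, hbw⟩ := exists_basis_of_omegaOne hr hw
  replace hb : IsVectorBasis b := hb
  obtain ⟨f, g, hf, hg, hu⟩ := exists_betheVector_eq (Λ := ![lam, omegaOne r]) (z := z) hv hw ht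
  have hE := E_lie_sum_eq_zero ht hf hg
  rw [← hu] at hE
  rw [← card_var]
  set u := betheVector z v w t
  set L := Fintype.card (Var l) with hL
  change IsWeightFamily t (z 0) lam v f at hf
  change IsWeightFamily t (z 1) (omegaOne r) w g at hg
  have hLr : L ≤ 2 * r := (card_var l).trans_le hl.sum_le
  have hcard : ∀ T : Finset (Var l), ((Finset.univ \ T).card : ℂ) = L - T.card := fun T => by
    rw [← Finset.compl_eq_univ_sdiff, Finset.card_compl, Nat.cast_sub (Finset.card_le_univ T)]
  have hgD : ∀ S, g S ∈ Dspace r W ((r : ℂ) - S.card) := fun S => by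
    rw [← hb.topWeight_eq hw hbw]
    exact hg.mem_Dspace S
  have hD : u ∈ Dspace r _ (topWeight lam + (r - L)) := by
    rw [hu]
    refine Submodule.sum_mem _ fun T _ => ?_
    have h1 := mem_Dspace.1 (hf.mem_Dspace T)
    have h2 := mem_Dspace.1 (hgD (Finset.univ \ T))
    rw [mem_Dspace, TensorProduct.LieModule.lie_tmul_right, h1, h2, TensorProduct.tmul_smul,
      ← TensorProduct.smul_tmul', ← add_smul, hcard]
    congr 1
    ring
  have hcomp : ∀ a, comp V b a u =
      ∑ T ∈ Finset.univ.powerset, b.coord a (g (Finset.univ \ T)) • f T :=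
    fun a => by simp only [hu, map_sum, comp_tmul]
  have hzero : ∀ a (T : Finset (Var l)), GaudinB.ht a + T.card ≠ L →
      b.coord a (g (Finset.univ \ T)) = 0 := fun a T h => by
    refine hb.coord_eq_zero (hgD _) fun h1 => h ?_
    rw [h1, ← Finset.compl_eq_univ_sdiff, Finset.card_compl, hL]
    have := Finset.card_le_univ T
    omega
  -- At height `L` all variables must be used by the second factor, so only `T = ∅` contributes.
  have htop : ∀ a, GaudinB.ht a = L → comp V b a u = b.coord a (g Finset.univ) • v := fun a ha => by
    rw [hcomp, Finset.sum_eq_single ∅, hf.map_empty, Finset.sdiff_empty]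
    · intro T _ hT
      have := Finset.card_pos.2 (Finset.nonempty_iff_ne_empty.2 hT)
      rw [hzero a T (by omega), zero_smul]
    · simp
  have hgt : ∀ c, L < GaudinB.ht c → comp V b c u = 0 := fun c hc => by
    rw [hcomp]
    exact Finset.sum_eq_zero fun T _ => by rw [hzero c T (by omega), zero_smul]
  obtain ⟨a, ha⟩ := exists_ht_eq (r := r) (m := L) hLr
  have hne := hg.coord_univ_ne_zero hr hl hb hw hbw ht.ne_of_rootPairing
    (fun a => ht.ne_of_weightPairing a 1) ha
  refine ⟨Module.End.mem_eigenspace_iff.2 (sub_eq_zero.1 ?_), fun h => ?_⟩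
  · refine eq_zero_of_comp_eq_zero hb hv (n := L) (fun i => ?_) ?_ fun c hc => ?_
    · rw [lie_sub, lie_Omega hx, lie_smul, hE, map_zero, smul_zero, sub_zero]
    · refine Submodule.sub_mem _ ?_ (Submodule.smul_mem _ _ hD)
      rw [mem_Dspace, lie_Omega hx, mem_Dspace.1 hD, map_smul]
    · rw [map_sub, map_smul, comp_Omega_of_singular hx hb hE (by rwa [hc]), htop c hc, lie_smul,
        smul_comm _ _ v, ← smul_sub, coeffDual_lie_sub hv.lie_H, hc, smul_comm, sub_self]
  · have h1 := htop a ha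
    rw [h, map_zero] at h1
    exact smul_ne_zero hne hv.ne_zero h1.symm

end BetheVectorEigenvalue

/-! ### From the Casimir tensor to the Gaudin Hamiltonians. -/

section Hamiltonian

variable {r : ℕ} {V W : Type*}
  [AddCommGroup V] [Module ℂ V] [LieRingModule (so r) V] [LieModule ℂ (so r) V]
  [AddCommGroup W] [Module ℂ W] [LieRingModule (so r) W] [LieModule ℂ (so r) W]
  {ι : Type*} [Fintype ι] {x : Module.Basis ι ℂ (so r)}

theorem hamiltonian_zero (z : Fin 2 → ℂ) :
    hamiltonian V W x z 0 = (z 0 - z 1)⁻¹ • Omega V W x 0 1 := by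
  rw [hamiltonian, show Finset.univ.erase (0 : Fin 2) = {1} from rfl, Finset.sum_singleton]

theorem hamiltonian_one (z : Fin 2 → ℂ) :
    hamiltonian V W x z 1 = (z 1 - z 0)⁻¹ • Omega V W x 1 0 := by
  rw [hamiltonian, show Finset.univ.erase (1 : Fin 2) = {0} from rfl, Finset.sum_singleton]

theorem hamiltonian_zero_eq_neg (z : Fin 2 → ℂ) :
    hamiltonian V W x z 0 = -hamiltonian V W x z 1 := by
  rw [hamiltonian_zero, hamiltonian_one, Omega_comm,
    show (z 0 - z 1)⁻¹ = -(z 1 - z 0)⁻¹ by rw [← inv_neg, neg_sub]]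
  exact neg_smul (z 1 - z 0)⁻¹ (Omega V W x 0 1)

theorem hasEigenvector_smul {K U : Type*} [Field K] [AddCommGroup U] [Module K U]
    {φ : Module.End K U} {μ : K} {u : U} (c : K) (h : φ.HasEigenvector μ u) :
    (c • φ).HasEigenvector (c * μ) u :=
  ⟨Module.End.mem_eigenspace_iff.2 (by rw [LinearMap.smul_apply, h.apply_eq_smul, smul_smul]), h.2⟩

end Hamiltonian

end GaudinB

end

theorem mainTheorem5 (r : ℕ) (hr : 2 ≤ r)
    {ι : Type*} [Fintype ι] [DecidableEq ι]
    (x : Module.Basis ι ℂ (GaudinB.so r)) (hx : GaudinB.IsOrthonormalBasis x)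
    (lam : Fin r → ℕ)
    (V : Type*) [AddCommGroup V] [Module ℂ V] [FiniteDimensional ℂ V]
    [LieRingModule (GaudinB.so r) V] [LieModule ℂ (GaudinB.so r) V]
    [LieModule.IsIrreducible ℂ (GaudinB.so r) V]
    (v : V) (hv : GaudinB.IsHighestWeightVector lam v)
    (W : Type*) [AddCommGroup W] [Module ℂ W] [FiniteDimensional ℂ W]
    [LieRingModule (GaudinB.so r) W] [LieModule ℂ (GaudinB.so r) W]
    [LieModule.IsIrreducible ℂ (GaudinB.so r) W]
    (w : W) (hw : GaudinB.IsHighestWeightVector (GaudinB.omegaOne r) w)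
    (z : Fin 2 → ℂ) (hz : z 0 ≠ z 1)
    (l l' : Fin r → ℕ)
    (hl : GaudinB.HasAdmissibleForm l) (hl' : GaudinB.HasAdmissibleForm l')
    (hne : ∑ i, l i ≠ ∑ i, l' i)
    (t : GaudinB.Var l → ℂ)
    (ht : GaudinB.IsCriticalPoint z ![lam, GaudinB.omegaOne r] l t)
    (t' : GaudinB.Var l' → ℂ)
    (ht' : GaudinB.IsCriticalPoint z ![lam, GaudinB.omegaOne r] l' t') :
    GaudinB.hamiltonian V W x z 0 = - GaudinB.hamiltonian V W x z 1 ∧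
    ∃ e e' : ℂ, e ≠ e' ∧
      (GaudinB.hamiltonian V W x z 0).HasEigenvector e (GaudinB.betheVector z v w t) ∧
      (GaudinB.hamiltonian V W x z 0).HasEigenvector e' (GaudinB.betheVector z v w t') := by
  have h := GaudinB.Omega_hasEigenvector hr hx hv hw hl ht
  have h' := GaudinB.Omega_hasEigenvector hr hx hv hw hl' ht'
  have h0 := GaudinB.hamiltonian_zero (V := V) (W := W) (x := x) z
  refine ⟨GaudinB.hamiltonian_zero_eq_neg z, _, _, ?_,
    h0.symm ▸ GaudinB.hasEigenvector_smul (z 0 - z 1)⁻¹ h,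
    h0.symm ▸ GaudinB.hasEigenvector_smul (z 0 - z 1)⁻¹ h'⟩
  -- Both eigenvalues carry the same nonzero factor, so strict monotonicity of the real numbers
  -- `casimirValue` is enough. The condition at length `r` is supplied by whichever solution has the
  -- smaller length.
  refine (mul_right_injective₀ (inv_ne_zero (sub_ne_zero.2 hz))).ne
    (Complex.ofReal_injective.ne ?_)
  rcases hne.lt_or_gt with h1 | h1
  · exact (GaudinB.casimirValue_lt h1 (fun i hi hs =>
      GaudinB.label_ne_zero_of_isCriticalPoint hr ht hl hs hi) (by omega)).ne'
  · exact (GaudinB.casimirValue_lt h1 (fun i hi hs =>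
      GaudinB.label_ne_zero_of_isCriticalPoint hr ht' hl' hs hi) (by omega)).ne
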